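/- Let $n\ge 1$ and $0<s<1<p<\infty$. Let $H:\mathbb R^n\to[0,\infty)$ be a Finsler–Minkowski norm, i.e. $H\in C^1(\mathbb R^n\setminus\{0\})$, $H(x)=0$ iff $x=0$, $H(tx)=|t|H(x)$ for all $t\in\mathbb R$, $C_1|x|\le H(x)\le C_2|x|$ for some constants $C_1,C_2>0$, and $H$ is strictly convex as a norm: $H(x+y)<H(x)+H(y)$ whenever $x,y$ do not lie on a common ray from the origin. Let $(\alpha,\beta)$ be one of $(1,0)$, $(1,\gamma)$ with $\gamma>0$, or $(0,1)$. Let $W^{1,p}(\mathbb R^n)$ be the space of $u\in L^p(\mathbb R^n)$ with weak gradient $\nabla u$ in $L^p$, and $W^{s,p}(\mathbb R^n)$ the space of $u\in L^p(\mathbb R^n)$ with $[u]_{s,p}^p:=\int_{\mathbb R^n}\int_{\mathbb R^n}\frac{|u(x)-u(y)|^p}{|x-y|^{n+ps}}\,dx\,dy<\infty$. Let $C^{0,l}(\mathbb R^n)$ be the space of bounded, globally $l$-Hölder continuous functions, and $C^{1,1}(\mathbb R^n)$ the space of bounded $C^1$ functions with bounded and globally Lipschitz gradient. Put $$X_{\alpha,\beta}=\begin{cases}W^{1,p}(\mathbb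 R^n), & (\alpha,\beta)=(1,0),\\ \{u\in W^{1,p}(\mathbb R^n)\cap W^{s,p}(\mathbb R^n):\ u\in C^{0,l}(\mathbb R^n)\text{ for some } l\in(s,1]\}, & (\alpha,\beta)=(1,\gamma),\ \gamma>0,\\ \big(W^{s,p}(\mathbb R^n)\cap C^{1,1}(\mathbb R^n)\big)\cup\big(W^{1,p}(\mathbb R^n)\cap W^{s,p}(\mathbb R^n)\big), & (\alpha,\beta)=(0,1).\end{cases}$$ Let $g\in C^1(\mathbb R^2)$, with partial derivatives $g_u,g_v$ in its first and second variable, satisfy, for some constant $C>0$, $$|g_u(t,r)|+|g_v(t,r)|\le C\big(|t|^{p-1}+|r|^{p-1}\big)\qquad\text{for all }(t,r)\in\mathbb R^2 .$$ Let $(u,v)\in X_{\alpha,\beta}\times X_{\alpha,\beta}$ be a weak solution of the system $$-\alpha H_pu+\beta(-\Delta_p)^su=g_u(u,v),\qquad -\alpha H_pv+\beta(-\Delta_p)^sv=g_v(u,v)\quad\text{in }\mathbb R^n,$$ which means that for all $\phi,\psi\in C^1_c(\mathbb R^n)$, with $J_p(r)=|r|^{p-2}r$, $$\alpha\int_{\mathbb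 R^n}H(\nabla u)^{p-1}\nabla_\xi H(\nabla u)\cdot\nabla\phi\,dx+\beta\int_{\mathbb R^n}\int_{\mathbb R^n}\frac{J_p(u(x)-u(y))(\phi(x)-\phi(y))}{|x-y|^{n+sp}}\,dx\,dy=\int_{\mathbb R^n}g_u(u,v)\phi\,dx,$$ $$\alpha\int_{\mathbb R^n}H(\nabla v)^{p-1}\nabla_\xi H(\nabla v)\cdot\nabla\psi\,dx+\beta\int_{\mathbb R^n}\int_{\mathbb R^n}\frac{J_p(v(x)-v(y))(\psi(x)-\psi(y))}{|x-y|^{n+sp}}\,dx\,dy=\int_{\mathbb R^n}g_v(u,v)\psi\,dx$$ (where $H(\xi)^{p-1}\nabla_\xi H(\xi)$ is read as $0$ at $\xi=0$). Assume that $g(u,v)\in L^1(\mathbb R^n)$. Then $$\frac{\alpha(n-p)}p\Big(\|H(\nabla u)\|_{L^p(\mathbb R^n)}^p+\|H(\nabla v)\|_{L^p(\mathbb R^n)}^p\Big)+\frac{\beta(n-sp)}p\Big([u]_{s,p}^p+[v]_{s,p}^p\Big)=n\int_{\mathbb R^n}g(u,v)\,dx ,$$ where $\|H(\nabla w)\|_{L^p(\mathbb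 R^n)}^p=\int_{\mathbb R^n}H(\nabla w)^p\,dx$, and a term with coefficient $\alpha=0$ or $\beta=0$ is absent. -/

import Mathlib

open MeasureTheory
open scoped NNReal

noncomputable section

namespace Pohozaev

/-- The Euclidean space `ℝⁿ`. -/
abbrev Eu (n : ℕ) : Type := EuclideanSpace ℝ (Fin n)

/-- A Finsler–Minkowski norm on `ℝⁿ`.  Strict convexity is understood as for norms: since `H` is
linear along rays from the origin, the triangle inequality can be (and is) strict exactly for pairs
of vectors that do not lie on a common ray. -/
structure IsFinslerMinkowski {n : ℕ} (H : Eu n → ℝ) : Prop where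
  nonneg : ∀ x, 0 ≤ H x
  eq_zero_iff : ∀ x, H x = 0 ↔ x = 0
  homogeneous : ∀ (t : ℝ) (x : Eu n), H (t • x) = |t| * H x
  equiv_norm : ∃ C₁ C₂ : ℝ, 0 < C₁ ∧ 0 < C₂ ∧ ∀ x, C₁ * ‖x‖ ≤ H x ∧ H x ≤ C₂ * ‖x‖
  strictly_convex : ∀ x y : Eu n, ¬ SameRay ℝ x y → H (x + y) < H x + H y
  contDiffOn : ContDiffOn ℝ 1 H {0}ᶜ

/-- The nonlinearity `J_p(r) = |r|^{p-2} r`. -/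
def J (p r : ℝ) : ℝ := |r| ^ (p - 2) * r

/-- `G` is a weak gradient of `u` on `ℝⁿ`: both are locally integrable and
`∫ u ∂ᵢφ = - ∫ Gᵢ φ` for all test functions `φ ∈ C_c^∞(ℝⁿ)` and all `i`. -/
def IsWeakGradient {n : ℕ} (u : Eu n → ℝ) (G : Eu n → Eu n) : Prop :=
  LocallyIntegrable u volume ∧ LocallyIntegrable G volume ∧
    ∀ φ : Eu n → ℝ, ContDiff ℝ (⊤ : ℕ∞) φ → HasCompactSupport φ → ∀ i : Fin n,
      ∫ x, u x * fderiv ℝ φ x (EuclideanSpace.single i 1) = - ∫ x, G x i * φ x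

open Classical in
/-- The weak gradient `∇u` (unique up to null sets); a representative is chosen when one exists, and
the value is `0` otherwise. -/
def weakGradient {n : ℕ} (u : Eu n → ℝ) : Eu n → Eu n :=
  if h : ∃ G, IsWeakGradient u G then h.choose else 0

/-- The Sobolev space `W^{1,p}(ℝⁿ)`. -/
def W1p (n : ℕ) (p : ℝ) : Set (Eu n → ℝ) :=
  {u | MemLp u (ENNReal.ofReal p) volume ∧ (∃ G, IsWeakGradient u G) ∧
    MemLp (weakGradient u) (ENNReal.ofReal p) volume}

/-- The fractional Sobolev space `W^{s,p}(ℝⁿ)`. -/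
def Wsp (n : ℕ) (s p : ℝ) : Set (Eu n → ℝ) :=
  {u | MemLp u (ENNReal.ofReal p) volume ∧
    MemLp (fun z : Eu n × Eu n => |u z.1 - u z.2| / ‖z.1 - z.2‖ ^ ((n : ℝ) / p + s))
      (ENNReal.ofReal p) (volume.prod volume)}

/-- The Hölder space `C^{0,l}(ℝⁿ)`. -/
def C0l (n : ℕ) (l : ℝ≥0) : Set (Eu n → ℝ) :=
  {u | (∃ M : ℝ, ∀ x, |u x| ≤ M) ∧ ∃ K : ℝ≥0, HolderWith K l u}

/-- The space `C^{1,1}(ℝⁿ)`. -/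
def C11 (n : ℕ) : Set (Eu n → ℝ) :=
  {u | ContDiff ℝ 1 u ∧ (∃ M : ℝ, ∀ x, |u x| ≤ M) ∧ (∃ M : ℝ, ∀ x, ‖fderiv ℝ u x‖ ≤ M) ∧
    ∃ K : ℝ≥0, LipschitzWith K (fderiv ℝ u)}

/-- The admissible parameters `S = {(1,0), (1,γ), (0,1)}`, `γ > 0`. -/
def S : Set (ℝ × ℝ) := {q | q = (1, 0) ∨ (∃ γ : ℝ, 0 < γ ∧ q = (1, γ)) ∨ q = (0, 1)}

/-- The solution space `X_{α,β}`, for `(α,β) ∈ S`. -/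
def X (n : ℕ) (s p α β : ℝ) : Set (Eu n → ℝ) :=
  {u | (α = 1 ∧ β = 0 ∧ u ∈ W1p n p) ∨
    (α = 1 ∧ 0 < β ∧ u ∈ W1p n p ∩ Wsp n s p ∧ ∃ l : ℝ≥0, s < l ∧ l ≤ 1 ∧ u ∈ C0l n l) ∨
    (α = 0 ∧ β = 1 ∧ u ∈ (Wsp n s p ∩ C11 n) ∪ (W1p n p ∩ Wsp n s p))}

/-- The left-hand side of the weak formulation, for the function `u` and the test function `φ`. -/
def weakForm {n : ℕ} (H : Eu n → ℝ) (s p α β : ℝ) (u φ : Eu n → ℝ) : ℝ :=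
  α * (∫ x, H (weakGradient u x) ^ (p - 1) *
      inner ℝ (gradient H (weakGradient u x)) (gradient φ x)) +
  β * (∫ z : Eu n × Eu n, J p (u z.1 - u z.2) * (φ z.1 - φ z.2) / ‖z.1 - z.2‖ ^ (n + s * p)
      ∂(volume.prod volume))

/-- The partial derivative of `g` in its first variable. -/
def partialFst (g : ℝ × ℝ → ℝ) (t r : ℝ) : ℝ := deriv (fun τ => g (τ, r)) t

/-- The partial derivative of `g` in its second variable. -/
def partialSnd (g : ℝ × ℝ → ℝ) (t r : ℝ) : ℝ := deriv (fun ρ => g (t, ρ)) r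

/-- `(u,v) ∈ X_{α,β} × X_{α,β}` is a weak solution of the system
`-α H_p u + β (-Δ_p)^s u = g_u(u,v)`, `-α H_p v + β (-Δ_p)^s v = g_v(u,v)` in `ℝⁿ`. -/
def IsWeakSolution {n : ℕ} (H : Eu n → ℝ) (s p α β : ℝ) (g : ℝ × ℝ → ℝ) (u v : Eu n → ℝ) :
    Prop :=
  u ∈ X n s p α β ∧ v ∈ X n s p α β ∧
  ∀ φ ψ : Eu n → ℝ, ContDiff ℝ 1 φ → HasCompactSupport φ → ContDiff ℝ 1 ψ → HasCompactSupport ψ →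
    weakForm H s p α β u φ = ∫ x, partialFst g (u x) (v x) * φ x ∧
    weakForm H s p α β v ψ = ∫ x, partialSnd g (u x) (v x) * ψ x

/-- `‖H(∇u)‖_{L^p(ℝⁿ)}^p`. -/
def anisoEnergy {n : ℕ} (H : Eu n → ℝ) (p : ℝ) (u : Eu n → ℝ) : ℝ :=
  ∫ x, H (weakGradient u x) ^ p

/-- `[u]_{s,p}^p`. -/
def gagliardo {n : ℕ} (s p : ℝ) (u : Eu n → ℝ) : ℝ :=
  ∫ z : Eu n × Eu n, |u z.1 - u z.2| ^ p / ‖z.1 - z.2‖ ^ (n + p * s) ∂(volume.prod volume)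

end Pohozaev

end

/-!
The identity expresses that the energy `α / p ∫ H(∇u)^p + β / p [u]^p` of both components, minus
`∫ g(u, v)`, is stationary under the dilations `u ↦ u ∘ S⁻¹`, `S x = (1 + t) x`, for which the three
integrals scale by `(1 + t)^(n - p)`, `(1 + t)^(n - s p)` and `(1 + t)^n`.  To make this rigorous
for functions which are merely in the energy space, the dilation is replaced by `S x = x + V x`, where
`V` (`dilationField`) is `t x` on the ball of radius `R`, vanishes off the ball of radius `2 R`, and
has a Lipschitz constant `|t| L` in which `L` does not depend on `R`.

The equation is tested with `u ∘ S⁻¹ - u`.  Neither smoothness of `u` nor differentiability of the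
energy along the deformation is needed: as `H ^ p / p` and `|r| ^ p / p` are convex, the tested left
side is at most the change in energy from `u` to `u ∘ S⁻¹` (`exists_tendsto_variation_bound`), and
the changes of variables `integral_finsler_rpow_le` and `integral_diffQuot_rpow_le` evaluate this
change exactly where `V x = t x` and up to a factor `1 + O(|t|)` elsewhere.  The variation itself is
not an admissible test function, so it is approximated by `u_k ∘ S⁻¹ - u_k` with the mollifications
`u_k` of `u`; these functions are `C¹` with compact support, since `S` is the identity off a ball.
Mollification commutes with the weak gradient (`gradient_mollify`) and with the fractional
difference quotient (`diffQuot_smooth`), hence converges in energy.  The result is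
`integral_mul_variation_le`.

The right sides of the two equations, tested in this way, are the first order part of
`∫ g(u ∘ S⁻¹, v ∘ S⁻¹) - ∫ g(u, v)`, which `le_integral_comp_symm_sub` computes by a change of
variables.  The remainder is `o(t)` along `t = ± τ₀ 2^{-j}`: functions in `W^{1,p}` or `C^{1,1}` are
moved by `O(|t|)` in `L^p` (`exists_eLpNorm_comp_symm_sub_le`), so the increments are summable along
this sequence, which provides the dominating function in `exists_tendsto_taylorRemainder`.

Dividing by `|t|` and letting `t → 0` from either side gives two inequalities on the ball of radius
`R`, with errors that are multiples, uniform in `R`, of the energies and of `∫ |g(u, v)|` off the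
ball (`pohozaev_ball_le`).  As `R → ∞` the errors vanish, and the two inequalities are opposite.
-/

namespace Pohozaev

open Filter Topology
open scoped ENNReal

/-! ### Averages and translations in `L^p` -/

section Averaging

variable {Z Y F : Type*} [MeasurableSpace Z] [MeasurableSpace Y] [NormedAddCommGroup F]
  {ν : Measure Z} [IsProbabilityMeasure ν] {μ : Measure Y} [SFinite μ]
  {T : Z → Y → Y} {f : Y → F} {p : ℝ}

theorem aestronglyMeasurable_uncurry_comp (hT : Measurable (Function.uncurry T))
    (hTz : ∀ z, MeasurePreserving (T z) μ μ) (hf : AEStronglyMeasurable f μ) :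
    AEStronglyMeasurable (fun q : Z × Y => f (T q.1 q.2)) (ν.prod μ) := by
  have h : MeasurePreserving (fun q : Z × Y => (q.1, T q.1 q.2)) (ν.prod μ) (ν.prod μ) :=
    (MeasurePreserving.id ν).skew_product hT (Eventually.of_forall fun z => (hTz z).map_eq)
  exact (hf.comp_quasiMeasurePreserving
    (Measure.quasiMeasurePreserving_snd (μ := ν))).comp_measurePreserving h

theorem aestronglyMeasurable_average [NormedSpace ℝ F] (hT : Measurable (Function.uncurry T))
    (hTz : ∀ z, MeasurePreserving (T z) μ μ) (hf : AEStronglyMeasurable f μ) :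
    AEStronglyMeasurable (fun y => ∫ z, f (T z y) ∂ν) μ :=
  (aestronglyMeasurable_uncurry_comp (ν := ν) hT hTz hf).prod_swap.integral_prod_right'

/-- Averaging `f` over a probability space of measure preserving maps `T z` moves it in `L^p` by at
most the largest `L^p` distance between `f ∘ T z` and `f`: Jensen's inequality and Tonelli. -/
theorem eLpNorm_average_sub_le [NormedSpace ℝ F] [CompleteSpace F] (hp : 1 ≤ p)
    (hT : Measurable (Function.uncurry T))
    (hTz : ∀ z, MeasurePreserving (T z) μ μ) (hf : MemLp f (ENNReal.ofReal p) μ) {ε : ℝ≥0∞}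
    (hε : ∀ᵐ z ∂ν, eLpNorm (fun y => f (T z y) - f y) (ENNReal.ofReal p) μ ≤ ε) :
    eLpNorm (fun y => (∫ z, f (T z y) ∂ν) - f y) (ENNReal.ofReal p) μ ≤ ε := by
  have p0 : 0 < p := by linarith
  have hp0 : ENNReal.ofReal p ≠ 0 := by simpa using p0
  have hp1 : (1 : ℝ≥0∞) ≤ ENNReal.ofReal p := by simpa using hp
  have htr : (ENNReal.ofReal p).toReal = p := ENNReal.toReal_ofReal p0.le
  have hmeas := aestronglyMeasurable_uncurry_comp (ν := ν) hT hTz hf.1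
  have hmeas2 : AEStronglyMeasurable (fun q : Z × Y => f (T q.1 q.2) - f q.2) (ν.prod μ) :=
    hmeas.sub (hf.1.comp_quasiMeasurePreserving Measure.quasiMeasurePreserving_snd)
  -- for almost every `y` the function `z ↦ f (T z y)` is integrable
  have hfin : ∫⁻ y, ∫⁻ z, ‖f (T z y)‖ₑ ^ p ∂ν ∂μ ≠ ∞ := by
    rw [← lintegral_lintegral_swap (hmeas.enorm.pow_const p)]
    have : ∀ z, ∫⁻ y, ‖f (T z y)‖ₑ ^ p ∂μ = ∫⁻ y, ‖f y‖ₑ ^ p ∂μ := fun z => by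
      have h := lintegral_map' (f := fun y => ‖f y‖ₑ ^ p) (μ := μ) (g := T z)
        (by rw [(hTz z).map_eq]; exact hf.1.enorm.pow_const p) (hTz z).measurable.aemeasurable
      rw [← h, (hTz z).map_eq]
    simp only [this, lintegral_const, measure_univ, mul_one]
    have := lintegral_rpow_enorm_lt_top_of_eLpNorm_lt_top hp0 ENNReal.ofReal_ne_top hf.2
    rw [htr] at this
    exact this.ne
  have hae : ∀ᵐ y ∂μ, ∫⁻ z, ‖f (T z y)‖ₑ ^ p ∂ν < ∞ :=
    ae_lt_top' (hmeas.prod_swap.enorm.pow_const p).lintegral_prod_right' hfin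
  have hae2 := hmeas.prod_swap.prodMk_left
  have hint : ∀ᵐ y ∂μ, Integrable (fun z => f (T z y)) ν := by
    filter_upwards [hae, hae2] with y hy hy2
    have : MemLp (fun z => f (T z y)) (ENNReal.ofReal p) ν := by
      refine ⟨hy2, ?_⟩
      rw [eLpNorm_lt_top_iff_lintegral_rpow_enorm_lt_top hp0 ENNReal.ofReal_ne_top, htr]
      exact hy
    exact this.integrable hp1
  have hpt : ∀ᵐ y ∂μ, ‖(∫ z, f (T z y) ∂ν) - f y‖ₑ ^ p ≤ ∫⁻ z, ‖f (T z y) - f y‖ₑ ^ p ∂ν := by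
    filter_upwards [hint, hae2] with y hy hy2
    have h1 : (∫ z, f (T z y) ∂ν) - f y = ∫ z, (f (T z y) - f y) ∂ν := by
      rw [integral_sub hy (integrable_const _)]; simp
    rw [h1]
    have h2 : ‖∫ z, (f (T z y) - f y) ∂ν‖ₑ ≤
        eLpNorm (fun z => f (T z y) - f y) (ENNReal.ofReal p) ν :=
      (enorm_integral_le_lintegral_enorm _).trans
        ((eLpNorm_one_eq_lintegral_enorm (f := fun z => f (T z y) - f y)).symm.le.trans
          (eLpNorm_le_eLpNorm_of_exponent_le hp1 (hy2.sub aestronglyMeasurable_const)))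
    calc _ ≤ (eLpNorm (fun z => f (T z y) - f y) (ENNReal.ofReal p) ν) ^ p := by gcongr
      _ = _ := by
        rw [eLpNorm_eq_lintegral_rpow_enorm_toReal hp0 ENNReal.ofReal_ne_top, htr,
          ← ENNReal.rpow_mul, one_div, inv_mul_cancel₀ p0.ne', ENNReal.rpow_one]
  rw [eLpNorm_eq_lintegral_rpow_enorm_toReal hp0 ENNReal.ofReal_ne_top, htr, one_div,
    ENNReal.rpow_inv_le_iff p0]
  calc _ ≤ ∫⁻ y, ∫⁻ z, ‖f (T z y) - f y‖ₑ ^ p ∂ν ∂μ := lintegral_mono_ae hpt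
    _ = ∫⁻ z, ∫⁻ y, ‖f (T z y) - f y‖ₑ ^ p ∂μ ∂ν :=
      (lintegral_lintegral_swap (hmeas2.enorm.pow_const p)).symm
    _ ≤ ∫⁻ z, ε ^ p ∂ν := by
      refine lintegral_mono_ae ?_
      filter_upwards [hε] with z hz
      have := ENNReal.rpow_le_rpow hz p0.le
      rwa [eLpNorm_eq_lintegral_rpow_enorm_toReal hp0 ENNReal.ofReal_ne_top, htr,
          ← ENNReal.rpow_mul, one_div, inv_mul_cancel₀ p0.ne', ENNReal.rpow_one] at this
    _ = ε ^ p := by simp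

end Averaging

section Translation

variable {Y F : Type*} [NormedAddCommGroup Y] [MeasurableSpace Y] [BorelSpace Y]
  [NormedAddCommGroup F] {μ : Measure Y} [IsLocallyFiniteMeasure μ] [μ.InnerRegularCompactLTTop]
  [μ.IsAddRightInvariant]

/-- Continuity of translations in `L^p`, `p < ∞`. -/
theorem tendsto_eLpNorm_translate_sub {p : ℝ≥0∞} (hp : 1 ≤ p) (hp' : p ≠ ∞) {f : Y → F}
    (hf : MemLp f p μ) :
    Tendsto (fun a : Y => eLpNorm (fun y => f (y - a) - f y) p μ) (𝓝 0) (𝓝 0) := by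
  have : Fact (1 ≤ p) := ⟨hp⟩
  let τ : Y → C(Y, Y) := fun a => ⟨fun y => y - a, by fun_prop⟩
  have hτ : Continuous τ :=
    ContinuousMap.continuous_of_continuous_uncurry _ (by
      change Continuous (fun q : Y × Y => q.2 - q.1); fun_prop)
  have hmp : ∀ a, MeasurePreserving (τ a) μ μ := fun a => measurePreserving_sub_right μ a
  have h := (continuous_const (y := hf.toLp f)).compMeasurePreservingLp hτ hmp hp'
  have h0 := (h.tendsto 0)
  have h00 : Lp.compMeasurePreserving (τ 0) (hmp 0) (hf.toLp f) = hf.toLp f := by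
    rw [Lp.toLp_compMeasurePreserving]
    congr 1
    ext y; simp [τ]
  rw [h00, Lp.tendsto_Lp_iff_tendsto_eLpNorm'] at h0
  refine h0.congr fun a => ?_
  rw [Lp.toLp_compMeasurePreserving]
  refine eLpNorm_congr_ae ?_
  filter_upwards [Lp.coeFn_sub (MemLp.toLp (f ∘ τ a) (hf.comp_measurePreserving (hmp a)))
    (hf.toLp f), hf.coeFn_toLp, (hf.comp_measurePreserving (hmp a)).coeFn_toLp] with y h1 h2 h3
  simp only [Pi.sub_apply, h2, h3]
  rfl

end Translation

/-! ### Mollification -/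

section Mollifier

variable {n : ℕ}

/-- A smooth bump function at the origin of `ℝⁿ` supported in the ball of radius `1 / (k + 1)`. -/
noncomputable def mollifier (n k : ℕ) : ContDiffBump (0 : Eu n) where
  rIn := 1 / (k + 2)
  rOut := 1 / (k + 1)
  rIn_pos := by positivity
  rIn_lt_rOut := by
    apply one_div_lt_one_div_of_lt <;> [positivity; linarith]

/-- The probability measure on `ℝⁿ` whose density is the normalized bump `mollifier n k`. -/
noncomputable def mollifierMeasure (n k : ℕ) : Measure (Eu n) :=
  volume.withDensity fun z => ENNReal.ofReal ((mollifier n k).normed volume z)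

instance (n k : ℕ) : IsProbabilityMeasure (mollifierMeasure n k) := by
  constructor
  rw [mollifierMeasure, withDensity_apply _ MeasurableSet.univ, Measure.restrict_univ,
    ← ofReal_integral_eq_lintegral_ofReal (mollifier n k).integrable_normed
      (Eventually.of_forall fun z => (mollifier n k).nonneg_normed z),
    (mollifier n k).integral_normed, ENNReal.ofReal_one]

theorem integral_mollifierMeasure {F : Type*} [NormedAddCommGroup F] [NormedSpace ℝ F] (k : ℕ)
    (f : Eu n → F) :
    ∫ z, f z ∂(mollifierMeasure n k) = ∫ z, (mollifier n k).normed volume z • f z := by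
  have hm : Measurable fun z => ((mollifier n k).normed volume z) :=
    (mollifier n k).continuous_normed.measurable
  rw [mollifierMeasure, integral_withDensity_eq_integral_toReal_smul hm.ennreal_ofReal
    (Eventually.of_forall fun z => ENNReal.ofReal_lt_top)]
  refine integral_congr_ae (Eventually.of_forall fun z => ?_)
  simp only [ENNReal.toReal_ofReal ((mollifier n k).nonneg_normed z)]

theorem ae_mollifierMeasure_norm_lt (n k : ℕ) :
    ∀ᵐ z ∂(mollifierMeasure n k), ‖z‖ < 1 / (k + 1 : ℝ) := by
  have hm : Measurable fun z => ((mollifier n k).normed volume z) :=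
    (mollifier n k).continuous_normed.measurable
  rw [mollifierMeasure, ae_withDensity_iff hm.ennreal_ofReal]
  refine Eventually.of_forall fun z hz => ?_
  have : z ∈ Function.support ((mollifier n k).normed volume) := by
    intro h; simp [h] at hz
  rw [(mollifier n k).support_normed_eq] at this
  simpa [mollifier] using this

variable {Y F : Type*} [NormedAddCommGroup Y] [NormedSpace ℝ Y] [MeasurableSpace Y]
  [BorelSpace Y] [SecondCountableTopology Y]
  [NormedAddCommGroup F] [NormedSpace ℝ F]

/-- Mollification of a function on `Y` along the translations by the vectors `ι z`, `z ∈ ℝⁿ`.  With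
`ι` the identity this is the usual mollification on `ℝⁿ`; with `ι` the diagonal embedding it is the
operation on functions of two points that corresponds to mollifying a difference quotient. -/
noncomputable def mollify (ι : Eu n →L[ℝ] Y) (k : ℕ) (f : Y → F) (y : Y) : F :=
  ∫ z, f (y - ι z) ∂(mollifierMeasure n k)

variable {μ : Measure Y} [SFinite μ] [IsLocallyFiniteMeasure μ] [μ.InnerRegularCompactLTTop]
  [μ.IsAddRightInvariant] [CompleteSpace F] {p : ℝ}

omit [IsLocallyFiniteMeasure μ] [μ.InnerRegularCompactLTTop] in
theorem memLp_mollify (ι : Eu n →L[ℝ] Y) (hp : 1 ≤ p) {f : Y → F}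
    (hf : MemLp f (ENNReal.ofReal p) μ) (k : ℕ) : MemLp (mollify ι k f) (ENNReal.ofReal p) μ := by
  have hT : Measurable (Function.uncurry fun (z : Eu n) (y : Y) => y - ι z) := by
    simp only [Function.uncurry_def]; fun_prop
  have hTz : ∀ z : Eu n, MeasurePreserving (fun y : Y => y - ι z) μ μ :=
    fun z => measurePreserving_sub_right μ _
  have h1 : AEStronglyMeasurable (mollify ι k f) μ := aestronglyMeasurable_average hT hTz hf.1
  have h2 := eLpNorm_average_sub_le (ν := mollifierMeasure n k) hp hT hTz hf
    (ε := 2 * eLpNorm f (ENNReal.ofReal p) μ) (Eventually.of_forall fun z => by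
      refine (eLpNorm_sub_le (hf.comp_measurePreserving (hTz z)).1 hf.1
        (by simpa using hp)).trans ?_
      rw [two_mul, eLpNorm_comp_measurePreserving hf.1 (hTz z)])
  have h3 : MemLp (mollify ι k f - f) (ENNReal.ofReal p) μ :=
    ⟨h1.sub hf.1, h2.trans_lt (ENNReal.mul_lt_top (by simp) hf.2)⟩
  simpa using h3.add hf

theorem tendsto_eLpNorm_mollify_sub (ι : Eu n →L[ℝ] Y) (hp : 1 ≤ p) {f : Y → F}
    (hf : MemLp f (ENNReal.ofReal p) μ) :
    Tendsto (fun k => eLpNorm (mollify ι k f - f) (ENNReal.ofReal p) μ) atTop (𝓝 0) := by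
  have hT : Measurable (Function.uncurry fun (z : Eu n) (y : Y) => y - ι z) := by
    simp only [Function.uncurry_def]; fun_prop
  have hTz : ∀ z : Eu n, MeasurePreserving (fun y : Y => y - ι z) μ μ :=
    fun z => measurePreserving_sub_right μ _
  have h0 := (tendsto_eLpNorm_translate_sub (by simpa using hp) ENNReal.ofReal_ne_top hf).comp
    (ι.continuous.tendsto' 0 0 (map_zero ι))
  rw [ENNReal.tendsto_nhds_zero] at h0 ⊢
  intro ε hε
  obtain ⟨δ, hδ, hball⟩ := Metric.eventually_nhds_iff.1 (h0 ε hε)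
  obtain ⟨K, hK⟩ := exists_nat_one_div_lt hδ
  filter_upwards [eventually_ge_atTop K] with k hk
  refine eLpNorm_average_sub_le hp hT hTz hf ?_
  filter_upwards [ae_mollifierMeasure_norm_lt n k] with z hz
  refine hball ?_
  rw [dist_zero_right]
  have : 1 / (k + 1 : ℝ) ≤ 1 / (K + 1 : ℝ) := by gcongr
  linarith

omit [CompleteSpace F] in
theorem mollify_id_eq_convolution (k : ℕ) (f : Eu n → F) :
    mollify (.id ℝ (Eu n)) k f =
      convolution ((mollifier n k).normed volume) f (ContinuousLinearMap.lsmul ℝ ℝ) volume := by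
  ext x
  simp [mollify, convolution, integral_mollifierMeasure]

omit [CompleteSpace F] in
theorem integrable_mollifierMeasure_sub (k : ℕ) {f : Eu n → F} (hf : LocallyIntegrable f volume)
    (x : Eu n) : Integrable (fun z => f (x - z)) (mollifierMeasure n k) := by
  have hm : Measurable fun z => ((mollifier n k).normed volume z) :=
    (mollifier n k).continuous_normed.measurable
  have h : ConvolutionExistsAt ((mollifier n k).normed volume) f x
      (ContinuousLinearMap.lsmul ℝ ℝ) volume :=
    (mollifier n k).hasCompactSupport_normed.convolutionExists_left _
      (mollifier n k).continuous_normed hf x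
  rw [mollifierMeasure, integrable_withDensity_iff_integrable_smul' hm.ennreal_ofReal
    (Eventually.of_forall fun z => ENNReal.ofReal_lt_top)]
  refine h.congr (Eventually.of_forall fun z => ?_)
  simp [ENNReal.toReal_ofReal ((mollifier n k).nonneg_normed z)]

omit [CompleteSpace F] in
theorem contDiff_mollify (k : ℕ) {f : Eu n → F} (hf : LocallyIntegrable f volume) :
    ContDiff ℝ (⊤ : ℕ∞) (mollify (.id ℝ (Eu n)) k f) := by
  rw [mollify_id_eq_convolution]
  exact (mollifier n k).hasCompactSupport_normed.contDiff_convolution_left _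
    (mollifier n k).contDiff_normed hf

/-- Mollification commutes with the weak gradient. -/
theorem gradient_mollify (k : ℕ) {u : Eu n → ℝ} {G : Eu n → Eu n} (h : IsWeakGradient u G) :
    gradient (mollify (.id ℝ (Eu n)) k u) = mollify (.id ℝ (Eu n)) k G := by
  obtain ⟨hu, hG, hφ⟩ := h
  set ρ := (mollifier n k).normed volume with hρ
  have hρs : ContDiff ℝ (⊤ : ℕ∞) ρ := (mollifier n k).contDiff_normed
  have hρc : HasCompactSupport ρ := (mollifier n k).hasCompactSupport_normed
  have hd : ∀ x, HasFDerivAt (mollify (.id ℝ (Eu n)) k u) _ x := fun x => by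
    rw [mollify_id_eq_convolution]
    exact hρc.hasFDerivAt_convolution_left (ContinuousLinearMap.lsmul ℝ ℝ)
      (hρs.of_le (by exact_mod_cast le_top)) hu x
  ext x i
  have hgr : gradient (mollify (.id ℝ (Eu n)) k u) x i =
      fderiv ℝ (mollify (.id ℝ (Eu n)) k u) x (EuclideanSpace.single i 1) := by
    have := InnerProductSpace.toDual_symm_apply (𝕜 := ℝ) (x := EuclideanSpace.single i 1)
      (y := fderiv ℝ (mollify (.id ℝ (Eu n)) k u) x)
    rw [← this, gradient, EuclideanSpace.inner_single_right]
    simp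
  have hex : ConvolutionExistsAt (fderiv ℝ ρ) u x
      ((ContinuousLinearMap.lsmul ℝ ℝ).precompL (Eu n)) volume :=
    (hρc.fderiv ℝ).convolutionExists_left _
      (hρs.continuous_fderiv (by simp)) hu x
  -- the reflected translate of the mollifier is the test function
  let φ : Eu n → ℝ := fun y => ρ (x - y)
  have hφs : ContDiff ℝ (⊤ : ℕ∞) φ := hρs.comp (contDiff_const.sub contDiff_id)
  have hφc : HasCompactSupport φ := by
    exact hρc.comp_homeomorph (Homeomorph.subLeft x)
  have hφd : ∀ y, fderiv ℝ φ y = -fderiv ℝ ρ (x - y) := fun y => by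
    have h1 : HasFDerivAt ρ (fderiv ℝ ρ (x - y)) (x - y) :=
      (hρs.differentiable (by simp)).differentiableAt.hasFDerivAt
    have h2 : HasFDerivAt φ _ y := h1.comp y ((hasFDerivAt_id y).const_sub x)
    rw [h2.fderiv]
    ext v; simp
  have key := hφ φ hφs hφc i
  have hL : fderiv ℝ (mollify (.id ℝ (Eu n)) k u) x (EuclideanSpace.single i 1) =
      ∫ t, fderiv ℝ ρ t (EuclideanSpace.single i 1) * u (x - t) := by
    rw [(hd x).fderiv, convolution, ContinuousLinearMap.integral_apply hex]
    simp [ContinuousLinearMap.precompL_apply]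
  have hR : mollify (.id ℝ (Eu n)) k G x i = ∫ t, ρ t * G (x - t) i := by
    have h1 := (EuclideanSpace.proj i : Eu n →L[ℝ] ℝ).integral_comp_comm
      (integrable_mollifierMeasure_sub k hG x)
    simp only [PiLp.proj_apply, integral_mollifierMeasure] at h1
    simpa [mollify, integral_mollifierMeasure] using h1.symm
  rw [hgr, hL, hR, ← integral_sub_left_eq_self _ volume x,
    ← integral_sub_left_eq_self (fun t => ρ t * G (x - t) i) volume x]
  simp only [sub_sub_cancel]
  have e1 : ∀ y, u y * fderiv ℝ φ y (EuclideanSpace.single i 1) =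
      -(fderiv ℝ ρ (x - y) (EuclideanSpace.single i 1) * u y) := fun y => by
    rw [hφd]; simp [mul_comm]
  simp only [e1, integral_neg, neg_inj] at key
  rw [key]
  simp only [φ, mul_comm]

end Mollifier
/-! ### Volume distortion and perturbations of the identity -/

section Determinant

variable {n : ℕ}

theorem abs_det_le_pow {A : Eu n →L[ℝ] Eu n} {c : ℝ} (hc : 0 < c) (h : ∀ v, ‖A v‖ ≤ c * ‖v‖) :
    |A.det| ≤ c ^ n := by
  have h1 := Measure.addHaar_image_continuousLinearMap (volume : Measure (Eu n)) A
    (Metric.closedBall 0 1)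
  have h2 : A '' Metric.closedBall 0 1 ⊆ Metric.closedBall 0 c := by
    rintro _ ⟨v, hv, rfl⟩
    rw [mem_closedBall_zero_iff] at hv ⊢
    calc ‖A v‖ ≤ c * ‖v‖ := h v
      _ ≤ c * 1 := by gcongr
      _ = c := mul_one c
  have h3 := measure_mono (μ := (volume : Measure (Eu n))) h2
  rw [h1, Measure.addHaar_closedBall' _ _ hc.le, finrank_euclideanSpace_fin] at h3
  have hpos : volume (Metric.closedBall (0 : Eu n) 1) ≠ 0 :=
    (Metric.measure_closedBall_pos volume _ one_pos).ne'
  rw [ENNReal.mul_le_mul_iff_left hpos measure_closedBall_lt_top.ne,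
    ENNReal.ofReal_le_ofReal_iff (by positivity)] at h3
  exact h3

theorem pow_le_abs_det {A : Eu n →L[ℝ] Eu n} {c : ℝ} (hc : 0 < c) (h : ∀ v, c * ‖v‖ ≤ ‖A v‖) :
    c ^ n ≤ |A.det| := by
  have hinj : Function.Injective A := by
    refine (injective_iff_map_eq_zero A).2 fun v hv => ?_
    have := h v
    rw [hv, norm_zero] at this
    exact norm_le_zero_iff.1 (nonpos_of_mul_nonpos_right this hc)
  have hdet : A.det ≠ 0 := by
    have : LinearMap.det (A : Eu n →ₗ[ℝ] Eu n) ≠ 0 :=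
      (LinearEquiv.ofInjectiveEndo (A : Eu n →ₗ[ℝ] Eu n) hinj).isUnit_det'.ne_zero
    exact this
  have h1 := Measure.addHaar_preimage_continuousLinearMap (volume : Measure (Eu n)) hdet
    (Metric.closedBall 0 c)
  have h2 : A ⁻¹' Metric.closedBall 0 c ⊆ Metric.closedBall 0 1 := by
    intro v hv
    rw [Set.mem_preimage, mem_closedBall_zero_iff] at hv
    rw [mem_closedBall_zero_iff]
    have := (h v).trans hv
    exact le_of_mul_le_mul_left (by simpa using this) hc
  have h3 := measure_mono (μ := (volume : Measure (Eu n))) h2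
  rw [h1, Measure.addHaar_closedBall' _ _ hc.le, finrank_euclideanSpace_fin, ← mul_assoc,
    ← ENNReal.ofReal_mul (by positivity)] at h3
  have hpos : volume (Metric.closedBall (0 : Eu n) 1) ≠ 0 :=
    (Metric.measure_closedBall_pos volume _ one_pos).ne'
  have h4 : ENNReal.ofReal (|A.det⁻¹| * c ^ n) ≤ 1 := by
    rw [← ENNReal.mul_le_mul_iff_left hpos measure_closedBall_lt_top.ne, one_mul]
    exact h3
  rw [ENNReal.ofReal_le_one, abs_inv, inv_mul_le_iff₀ (abs_pos.2 hdet), mul_one] at h4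
  exact h4

end Determinant

section Perturbation

variable {n : ℕ} {V : Eu n → Eu n} {ℓ : ℝ}

/-- `V` is a `C¹` vector field whose derivative is bounded by `ℓ < 1`, so that `x ↦ x + V x` is a
diffeomorphism of `ℝⁿ`. -/
structure IsContractingField (V : Eu n → Eu n) (ℓ : ℝ) : Prop where
  contDiff : ContDiff ℝ 1 V
  norm_fderiv_le : ∀ x, ‖fderiv ℝ V x‖ ≤ ℓ
  lt_one : ℓ < 1

namespace IsContractingField

theorem nonneg (h : IsContractingField V ℓ) : 0 ≤ ℓ := (norm_nonneg _).trans (h.norm_fderiv_le 0)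

theorem norm_sub_le (h : IsContractingField V ℓ) (x y : Eu n) : ‖V x - V y‖ ≤ ℓ * ‖x - y‖ :=
  convex_univ.norm_image_sub_le_of_norm_fderiv_le (𝕜 := ℝ)
    (fun _ _ => (h.contDiff.differentiable one_ne_zero).differentiableAt)
    (fun z _ => h.norm_fderiv_le z) (Set.mem_univ y) (Set.mem_univ x)

theorem le_norm_add_sub (h : IsContractingField V ℓ) (x y : Eu n) :
    (1 - ℓ) * ‖x - y‖ ≤ ‖(x + V x) - (y + V y)‖ := by
  have h1 : (x + V x) - (y + V y) = (x - y) + (V x - V y) := by abel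
  have h2 := norm_sub_le_norm_add (x - y) (V x - V y)
  have h3 := h.norm_sub_le x y
  rw [h1]; linarith

theorem approximatesLinearOn (h : IsContractingField V ℓ) :
    ApproximatesLinearOn (fun x => x + V x)
      ((ContinuousLinearEquiv.refl ℝ (Eu n) : Eu n ≃L[ℝ] Eu n) : Eu n →L[ℝ] Eu n) Set.univ
      ⟨ℓ, h.nonneg⟩ := by
  intro x _ y _
  have h1 : x + V x - (y + V y) - ((ContinuousLinearEquiv.refl ℝ (Eu n) : Eu n ≃L[ℝ] Eu n) :
      Eu n →L[ℝ] Eu n) (x - y) = V x - V y := by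
    simp only [ContinuousLinearEquiv.coe_refl, ContinuousLinearMap.id_apply]; abel
  rw [h1]
  exact h.norm_sub_le x y

theorem subsingleton_or_lt (h : IsContractingField V ℓ) :
    Subsingleton (Eu n) ∨ (⟨ℓ, h.nonneg⟩ : ℝ≥0) <
      ‖((ContinuousLinearEquiv.refl ℝ (Eu n)).symm : Eu n →L[ℝ] Eu n)‖₊⁻¹ := by
  rcases subsingleton_or_nontrivial (Eu n) with hs | hs
  · exact Or.inl hs
  · right
    have : ‖((ContinuousLinearEquiv.refl ℝ (Eu n)).symm : Eu n →L[ℝ] Eu n)‖₊ = 1 := by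
      ext; simp
    rw [this, inv_one]
    exact h.lt_one

/-- The diffeomorphism `x ↦ x + V x`. -/
noncomputable def homeo (h : IsContractingField V ℓ) : Eu n ≃ₜ Eu n :=
  h.approximatesLinearOn.toHomeomorph (fun x => x + V x) h.subsingleton_or_lt

theorem homeo_apply (h : IsContractingField V ℓ) (x : Eu n) : h.homeo x = x + V x := rfl

theorem hasFDerivAt_homeo (h : IsContractingField V ℓ) (x : Eu n) :
    HasFDerivAt h.homeo (.id ℝ (Eu n) + fderiv ℝ V x) x :=
  (hasFDerivAt_id x).add (h.contDiff.differentiable one_ne_zero).differentiableAt.hasFDerivAt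

theorem contDiff_homeo (h : IsContractingField V ℓ) : ContDiff ℝ 1 h.homeo :=
  contDiff_id.add h.contDiff

theorem le_norm_deriv (h : IsContractingField V ℓ) (x v : Eu n) :
    (1 - ℓ) * ‖v‖ ≤ ‖(.id ℝ (Eu n) + fderiv ℝ V x : Eu n →L[ℝ] Eu n) v‖ := by
  have h2 := norm_sub_le_norm_add v (fderiv ℝ V x v)
  have h3 := (fderiv ℝ V x).le_of_opNorm_le (h.norm_fderiv_le x) v
  simp only [_root_.add_apply, ContinuousLinearMap.id_apply]
  linarith

theorem norm_deriv_le (h : IsContractingField V ℓ) (x v : Eu n) :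
    ‖(.id ℝ (Eu n) + fderiv ℝ V x : Eu n →L[ℝ] Eu n) v‖ ≤ (1 + ℓ) * ‖v‖ := by
  have h2 := norm_add_le v (fderiv ℝ V x v)
  have h3 := (fderiv ℝ V x).le_of_opNorm_le (h.norm_fderiv_le x) v
  simp only [_root_.add_apply, ContinuousLinearMap.id_apply]
  linarith

theorem contDiff_symm (h : IsContractingField V ℓ) : ContDiff ℝ 1 h.homeo.symm := by
  have hinj : ∀ x, Function.Injective (.id ℝ (Eu n) + fderiv ℝ V x : Eu n →L[ℝ] Eu n) :=
    fun x => (injective_iff_map_eq_zero _).2 fun v hv => by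
      have h1 := h.le_norm_deriv x v
      rw [hv, norm_zero] at h1
      have := h.lt_one
      exact norm_le_zero_iff.1 (nonpos_of_mul_nonpos_right h1 (by linarith))
  refine h.homeo.contDiff_symm (f₀' := fun x =>
    (LinearEquiv.ofInjectiveEndo _ (hinj x)).toContinuousLinearEquiv) (fun x => ?_) h.contDiff_homeo
  exact (h.hasFDerivAt_homeo x).congr_fderiv (by ext v; rfl)

/-- The absolute value of the Jacobian determinant of `x ↦ x + V x`. -/
noncomputable def jac (_ : IsContractingField V ℓ) (x : Eu n) : ℝ :=
  |(.id ℝ (Eu n) + fderiv ℝ V x : Eu n →L[ℝ] Eu n).det|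

theorem jac_le (h : IsContractingField V ℓ) (x : Eu n) : h.jac x ≤ (1 + ℓ) ^ n :=
  abs_det_le_pow (by linarith [h.nonneg]) (h.norm_deriv_le x)

theorem le_jac (h : IsContractingField V ℓ) (x : Eu n) : (1 - ℓ) ^ n ≤ h.jac x :=
  pow_le_abs_det (by linarith [h.lt_one]) (h.le_norm_deriv x)

theorem jac_nonneg (h : IsContractingField V ℓ) (x : Eu n) : 0 ≤ h.jac x := abs_nonneg _

theorem jac_eq_of_fderiv_eq (h : IsContractingField V ℓ) {x : Eu n} {t : ℝ}
    (hx : fderiv ℝ V x = t • .id ℝ (Eu n)) : h.jac x = |1 + t| ^ n := by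
  have : (.id ℝ (Eu n) + fderiv ℝ V x : Eu n →L[ℝ] Eu n) = (1 + t) • .id ℝ (Eu n) := by
    rw [hx]; ext v; simp [add_mul]
  rw [jac, this]
  have h2 : ((1 + t) • ContinuousLinearMap.id ℝ (Eu n)).det = (1 + t) ^ n := by
    change LinearMap.det ((1 + t) • (LinearMap.id : Eu n →ₗ[ℝ] Eu n)) = _
    rw [LinearMap.det_smul]; simp
  rw [h2, abs_pow]

theorem measurable_jac (h : IsContractingField V ℓ) : Measurable h.jac := by
  have : Continuous h.jac := by
    have := h.contDiff.continuous_fderiv one_ne_zero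
    exact (ContinuousLinearMap.continuous_det.comp (continuous_const.add this)).abs
  exact this.measurable

theorem map_homeo_symm (h : IsContractingField V ℓ) :
    (volume : Measure (Eu n)).map h.homeo.symm =
      volume.withDensity fun x => ENNReal.ofReal (h.jac x) := by
  have h1 := map_withDensity_abs_det_fderiv_eq_addHaar (volume : Measure (Eu n))
    (s := Set.univ) MeasurableSet.univ.nullMeasurableSet
    (fun x _ => (h.hasFDerivAt_homeo x).hasFDerivWithinAt) h.homeo.injective.injOn
  rw [Measure.restrict_univ, Set.image_univ, h.homeo.range_coe, Measure.restrict_univ] at h1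
  conv_lhs => rw [← h1]
  rw [Measure.map_map h.homeo.symm.measurable h.homeo.measurable]
  simp [jac]

theorem map_homeo_symm_le (h : IsContractingField V ℓ) :
    (volume : Measure (Eu n)).map h.homeo.symm ≤ ENNReal.ofReal ((1 + ℓ) ^ n) • volume := by
  rw [h.map_homeo_symm, ← withDensity_const]
  exact withDensity_mono (Eventually.of_forall fun x => ENNReal.ofReal_le_ofReal (h.jac_le x))

/-- `x ↦ x + V x` shrinks volumes by at most the factor `(1 - ℓ) ^ n`. -/
theorem map_homeo_le (h : IsContractingField V ℓ) :
    (volume : Measure (Eu n)).map h.homeo ≤ ENNReal.ofReal (((1 - ℓ) ^ n)⁻¹) • volume := by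
  have hp : 0 < (1 - ℓ) ^ n := pow_pos (by linarith [h.lt_one]) n
  have h1 : ENNReal.ofReal ((1 - ℓ) ^ n) • (volume : Measure (Eu n)) ≤
      (volume : Measure (Eu n)).map h.homeo.symm := by
    rw [h.map_homeo_symm, ← withDensity_const]
    exact withDensity_mono (Eventually.of_forall fun x => ENNReal.ofReal_le_ofReal (h.le_jac x))
  have h2 := Measure.map_mono h1 h.homeo.measurable
  rw [Measure.map_map h.homeo.measurable h.homeo.symm.measurable, Measure.map_smul] at h2
  simp only [Homeomorph.self_comp_symm, Measure.map_id] at h2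
  rw [Measure.le_iff'] at h2 ⊢
  intro s
  have h3 := h2 s
  simp only [Measure.smul_apply, smul_eq_mul] at h3 ⊢
  rw [ENNReal.ofReal_inv_of_pos hp, ← ENNReal.div_eq_inv_mul, ENNReal.le_div_iff_mul_le
    (Or.inl (by simpa using hp)) (Or.inl ENNReal.ofReal_ne_top), mul_comm]
  exact h3

end IsContractingField

end Perturbation

/-! ### The cut-off dilation field -/

section DilationField

variable {n : ℕ}

/-- The unit cut-off of the dilation field `x ↦ x`: it equals `x` for `‖x‖ ≤ 1` and vanishes for
`‖x‖ ≥ 2`. -/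
noncomputable def unitDilationField (n : ℕ) (x : Eu n) : Eu n :=
  (⟨1, 2, one_pos, one_lt_two⟩ : ContDiffBump (0 : Eu n)) x • x

/-- The cut-off dilation field `t x`, localized to the ball of radius `2 R`.  The rescaling makes
the Lipschitz constant independent of `R`. -/
noncomputable def dilationField (n : ℕ) (R t : ℝ) (x : Eu n) : Eu n :=
  (t * R) • unitDilationField n (R⁻¹ • x)

theorem contDiff_unitDilationField : ContDiff ℝ 1 (unitDilationField n) :=
  (ContDiffBump.contDiff _).smul contDiff_id

theorem unitDilationField_eq_zero {x : Eu n} (hx : 2 ≤ ‖x‖) : unitDilationField n x = 0 := by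
  rw [unitDilationField, ContDiffBump.zero_of_le_dist _ (by simpa using hx), zero_smul]

theorem unitDilationField_eq {x : Eu n} (hx : ‖x‖ ≤ 1) : unitDilationField n x = x := by
  rw [unitDilationField, ContDiffBump.one_of_mem_closedBall _ (by simpa using hx), one_smul]

theorem norm_unitDilationField_le (x : Eu n) : ‖unitDilationField n x‖ ≤ 2 := by
  rcases le_total 2 ‖x‖ with hx | hx
  · simp [unitDilationField_eq_zero hx]
  · rw [unitDilationField, norm_smul, Real.norm_of_nonneg (ContDiffBump.nonneg _)]
    calc _ ≤ 1 * ‖x‖ := by gcongr; exact ContDiffBump.le_one _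
      _ ≤ 2 := by linarith

theorem dilationField_eq_zero {R t : ℝ} (hR : 0 < R) {x : Eu n} (hx : 2 * R ≤ ‖x‖) :
    dilationField n R t x = 0 := by
  rw [dilationField, unitDilationField_eq_zero, smul_zero]
  rw [norm_smul, Real.norm_of_nonneg (by positivity), ← div_eq_inv_mul, le_div_iff₀ hR]
  exact hx

theorem dilationField_eq {R t : ℝ} (hR : 0 < R) {x : Eu n} (hx : ‖x‖ ≤ R) :
    dilationField n R t x = t • x := by
  rw [dilationField, unitDilationField_eq, smul_smul, mul_assoc, mul_inv_cancel₀ hR.ne', mul_one]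
  rw [norm_smul, Real.norm_of_nonneg (by positivity), ← div_eq_inv_mul, div_le_one hR]
  exact hx

theorem norm_dilationField_le {R t : ℝ} (hR : 0 < R) (x : Eu n) :
    ‖dilationField n R t x‖ ≤ |t| * (2 * R) := by
  rw [dilationField, norm_smul, Real.norm_eq_abs, abs_mul, abs_of_pos hR]
  calc _ ≤ |t| * R * 2 := by gcongr; exact norm_unitDilationField_le _
    _ = _ := by ring

theorem hasCompactSupport_dilationField {R t : ℝ} (hR : 0 < R) :
    HasCompactSupport (dilationField n R t) :=
  HasCompactSupport.intro (isCompact_closedBall 0 (2 * R)) fun x hx => by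
    refine dilationField_eq_zero hR ?_
    rw [mem_closedBall_zero_iff, not_le] at hx
    exact hx.le

theorem fderiv_dilationField_eq {R t : ℝ} (hR : 0 < R) {x : Eu n} (hx : ‖x‖ < R) :
    fderiv ℝ (dilationField n R t) x = t • .id ℝ (Eu n) := by
  have h : dilationField n R t =ᶠ[𝓝 x] fun y => t • y := by
    filter_upwards [Metric.isOpen_ball.mem_nhds (mem_ball_zero_iff.2 hx)] with y hy
    exact dilationField_eq hR (mem_ball_zero_iff.1 hy).le
  rw [h.fderiv_eq]
  exact ((hasFDerivAt_id x).const_smul t).fderiv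

theorem contDiff_dilationField {R t : ℝ} : ContDiff ℝ 1 (dilationField n R t) :=
  (contDiff_unitDilationField.comp (contDiff_id.const_smul R⁻¹)).const_smul (t * R)

/-- The cut-off dilation fields of all radii have a common Lipschitz constant. -/
theorem exists_isContractingField_dilationField (n : ℕ) : ∃ L : ℝ, 0 < L ∧
    ∀ R : ℝ, 0 < R → ∀ t : ℝ, |t| * L < 1 →
      IsContractingField (dilationField n R t) (|t| * L) := by
  have hc : HasCompactSupport (unitDilationField n) :=
    HasCompactSupport.intro (isCompact_closedBall 0 2) fun x hx => by
      refine unitDilationField_eq_zero ?_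
      rw [mem_closedBall_zero_iff, not_le] at hx
      exact hx.le
  obtain ⟨L, hL⟩ := (hc.fderiv ℝ).exists_bound_of_continuous
    (contDiff_unitDilationField.continuous_fderiv one_ne_zero)
  have hL0 : 0 ≤ L := (norm_nonneg _).trans (hL 0)
  refine ⟨L + 1, by linarith, fun R hR t ht => ⟨contDiff_dilationField, fun x => ?_, ht⟩⟩
  have h1 : HasFDerivAt (dilationField n R t) ((t * R) •
      ((fderiv ℝ (unitDilationField n) (R⁻¹ • x)).comp (R⁻¹ • .id ℝ (Eu n)))) x :=
    (((contDiff_unitDilationField.differentiable one_ne_zero).differentiableAt.hasFDerivAt).comp x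
      ((hasFDerivAt_id x).const_smul R⁻¹)).const_smul (t * R)
  have h2 : (t * R) • ((fderiv ℝ (unitDilationField n) (R⁻¹ • x)).comp (R⁻¹ • .id ℝ (Eu n))) =
      t • fderiv ℝ (unitDilationField n) (R⁻¹ • x) := by
    ext1 v
    simp only [_root_.smul_apply, ContinuousLinearMap.comp_apply, ContinuousLinearMap.id_apply,
      map_smul, smul_smul]
    rw [mul_assoc, mul_inv_cancel₀ hR.ne', mul_one]
  rw [h1.fderiv, h2, norm_smul, Real.norm_eq_abs]
  gcongr
  linarith [hL (R⁻¹ • x)]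

end DilationField

/-! ### Convexity of Finsler–Minkowski norms -/

section Finsler

variable {n : ℕ} {H : Eu n → ℝ}

namespace IsFinslerMinkowski

theorem map_zero (hH : IsFinslerMinkowski H) : H 0 = 0 := (hH.eq_zero_iff 0).2 rfl

theorem map_smul_of_nonneg (hH : IsFinslerMinkowski H) {t : ℝ} (ht : 0 ≤ t) (x : Eu n) :
    H (t • x) = t * H x := by rw [hH.homogeneous, abs_of_nonneg ht]

theorem map_add_le (hH : IsFinslerMinkowski H) (x y : Eu n) : H (x + y) ≤ H x + H y := by
  by_cases h : SameRay ℝ x y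
  · rcases h.exists_eq_smul with ⟨v, a, b, ha, hb, -, rfl, rfl⟩
    rw [← add_smul, hH.map_smul_of_nonneg ha, hH.map_smul_of_nonneg hb,
      hH.map_smul_of_nonneg (by positivity), add_mul]
  · exact (hH.strictly_convex x y h).le

theorem differentiableAt (hH : IsFinslerMinkowski H) {x : Eu n} (hx : x ≠ 0) :
    DifferentiableAt ℝ H x :=
  ((hH.contDiffOn.contDiffAt (isOpen_compl_singleton.mem_nhds hx)).differentiableAt one_ne_zero)

theorem continuous (hH : IsFinslerMinkowski H) : Continuous H := by
  rw [continuous_iff_continuousAt]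
  intro x
  by_cases hx : x = 0
  · subst hx
    obtain ⟨C₁, C₂, -, -, h⟩ := hH.equiv_norm
    rw [ContinuousAt, hH.map_zero]
    refine squeeze_zero (fun y => hH.nonneg y) (fun y => (h y).2) ?_
    simpa using (tendsto_norm_zero (E := Eu n)).const_mul C₂
  · exact (hH.differentiableAt hx).continuousAt

theorem hasDerivAt_line (hH : IsFinslerMinkowski H) {x : Eu n} (hx : x ≠ 0) (y : Eu n) :
    HasDerivAt (fun t : ℝ => H (x + t • y)) (inner ℝ (gradient H x) y) 0 := by
  have h1 : HasFDerivAt H (fderiv ℝ H x) (x + (0 : ℝ) • y) := by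
    simpa using (hH.differentiableAt hx).hasFDerivAt
  have h2 : HasDerivAt (fun t : ℝ => x + t • y) y 0 := by
    simpa using ((hasDerivAt_id (0 : ℝ)).smul_const y).const_add x
  have h3 := h1.comp_hasDerivAt 0 h2
  rw [gradient, InnerProductSpace.toDual_symm_apply]
  exact h3

theorem inner_gradient_le (hH : IsFinslerMinkowski H) {x : Eu n} (hx : x ≠ 0) (y : Eu n) :
    inner ℝ (gradient H x) y ≤ H y := by
  have h1 := (hH.hasDerivAt_line hx y).tendsto_slope_zero_right
  refine le_of_tendsto h1 ?_
  filter_upwards [self_mem_nhdsWithin] with t (ht : 0 < t)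
  have h2 := hH.map_add_le x (t • y)
  rw [hH.map_smul_of_nonneg ht.le] at h2
  simp only [zero_add, zero_smul, add_zero, smul_eq_mul]
  rw [inv_mul_le_iff₀ ht]
  linarith

/-- Euler's relation for the one-homogeneous function `H`. -/
theorem inner_gradient_self (hH : IsFinslerMinkowski H) {x : Eu n} (hx : x ≠ 0) :
    inner ℝ (gradient H x) x = H x := by
  have h1 := hH.hasDerivAt_line hx x
  have h2 : HasDerivAt (fun t : ℝ => H (x + t • x)) (H x) 0 := by
    have h3 : HasDerivAt (fun t : ℝ => (1 + t) * H x) (H x) 0 := by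
      simpa using ((hasDerivAt_id (0 : ℝ)).const_add 1).mul_const (H x)
    refine h3.congr_of_eventuallyEq ?_
    filter_upwards [Ioi_mem_nhds (show (-1 : ℝ) < 0 by norm_num)] with t (ht : -1 < t)
    rw [← hH.map_smul_of_nonneg (by linarith), add_smul, one_smul]
  exact h1.unique h2

theorem norm_gradient_le (hH : IsFinslerMinkowski H) {C : ℝ} (hC : ∀ x, H x ≤ C * ‖x‖)
    {x : Eu n} (hx : x ≠ 0) : ‖gradient H x‖ ≤ C := by
  have h1 := (hH.inner_gradient_le hx (gradient H x)).trans (hC _)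
  rw [real_inner_self_eq_norm_mul_norm] at h1
  rcases (norm_nonneg (gradient H x)).eq_or_lt with h0 | h0
  · rw [← h0]
    have h2 := (hH.nonneg x).trans (hC x)
    exact nonneg_of_mul_nonneg_left h2 (norm_pos_iff.2 hx)
  · exact le_of_mul_le_mul_right h1 h0

end IsFinslerMinkowski

/-- The flux `H(ξ)^{p-1} ∇H(ξ)` of the Finsler `p`-Laplacian; it vanishes at `ξ = 0`. -/
noncomputable def flux (H : Eu n → ℝ) (p : ℝ) (ξ : Eu n) : Eu n := H ξ ^ (p - 1) • gradient H ξ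

theorem young_rpow_sub_one_mul {p a b : ℝ} (hp : 1 < p) (ha : 0 ≤ a) (hb : 0 ≤ b) :
    a ^ (p - 1) * b - a ^ p ≤ (b ^ p - a ^ p) / p := by
  have p0 : 0 < p := by linarith
  have hpq : p.HolderConjugate (p / (p - 1)) := Real.HolderConjugate.conjExponent hp
  have h := Real.young_inequality_of_nonneg hb (Real.rpow_nonneg ha (p - 1)) hpq
  have h2 : (a ^ (p - 1)) ^ (p / (p - 1)) = a ^ p := by
    rw [← Real.rpow_mul ha]; congr 1; field_simp [show p - 1 ≠ 0 by linarith]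
  rw [h2] at h
  have h3 : a ^ p / (p / (p - 1)) = a ^ p - a ^ p / p := by
    field_simp
  rw [h3] at h
  rw [sub_div, mul_comm]; linarith

theorem IsFinslerMinkowski.flux_zero (hH : IsFinslerMinkowski H) {p : ℝ} (hp : 1 < p) :
    flux H p 0 = 0 := by
  rw [flux, hH.map_zero, Real.zero_rpow (by linarith), zero_smul]

/-- The convexity inequality for `H ^ p / p`. -/
theorem IsFinslerMinkowski.inner_flux_sub_le (hH : IsFinslerMinkowski H) {p : ℝ} (hp : 1 < p)
    (ξ ζ : Eu n) : inner ℝ (flux H p ξ) (ζ - ξ) ≤ (H ζ ^ p - H ξ ^ p) / p := by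
  have p0 : 0 < p := by linarith
  by_cases hξ : ξ = 0
  · rw [hξ, hH.flux_zero hp, inner_zero_left, hH.map_zero, Real.zero_rpow p0.ne', sub_zero]
    have := hH.nonneg ζ
    positivity
  · have hpos : 0 < H ξ := lt_of_le_of_ne (hH.nonneg ξ) fun h => hξ ((hH.eq_zero_iff ξ).1 h.symm)
    rw [flux, real_inner_smul_left, inner_sub_right, hH.inner_gradient_self hξ]
    refine le_trans ?_ (young_rpow_sub_one_mul hp (hH.nonneg ξ) (hH.nonneg ζ))
    have h1 := mul_le_mul_of_nonneg_left (hH.inner_gradient_le hξ ζ)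
      (Real.rpow_nonneg (hH.nonneg ξ) (p - 1))
    have h2 : H ξ ^ p = H ξ ^ (p - 1) * H ξ := by
      rw [← Real.rpow_add_one hpos.ne']; ring_nf
    rw [mul_sub, h2]
    linarith

theorem IsFinslerMinkowski.norm_flux_le (hH : IsFinslerMinkowski H) {p : ℝ} (hp : 1 < p) :
    ∃ C : ℝ, ∀ ξ, ‖flux H p ξ‖ ≤ C * ‖ξ‖ ^ (p - 1) := by
  obtain ⟨C₁, C₂, -, h0, h⟩ := hH.equiv_norm
  refine ⟨C₂ ^ (p - 1) * C₂, fun ξ => ?_⟩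
  by_cases hξ : ξ = 0
  · rw [hξ, hH.flux_zero hp, norm_zero]; positivity
  · rw [flux, norm_smul, Real.norm_of_nonneg (Real.rpow_nonneg (hH.nonneg ξ) _)]
    calc H ξ ^ (p - 1) * ‖gradient H ξ‖ ≤ (C₂ * ‖ξ‖) ^ (p - 1) * C₂ := by
          gcongr
          · exact hH.nonneg ξ
          · exact (h ξ).2
          · exact hH.norm_gradient_le (fun x => (h x).2) hξ
      _ = _ := by rw [Real.mul_rpow h0.le (norm_nonneg _)]; ring

theorem IsFinslerMinkowski.measurable_flux (hH : IsFinslerMinkowski H) (p : ℝ) :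
    Measurable (flux H p) := by
  have h1 : Measurable (gradient H) :=
    (InnerProductSpace.toDual ℝ (Eu n)).symm.continuous.measurable.comp (measurable_fderiv ℝ H)
  exact (hH.continuous.measurable.pow_const (p - 1)).smul h1

end Finsler

section Scalar

theorem abs_J {p : ℝ} (hp : 1 < p) (r : ℝ) : |J p r| = |r| ^ (p - 1) := by
  rcases eq_or_ne r 0 with rfl | hr
  · simp [J, Real.zero_rpow (show p - 1 ≠ 0 by linarith)]
  · rw [J, abs_mul, abs_of_nonneg (Real.rpow_nonneg (abs_nonneg r) _),
      ← Real.rpow_add_one (abs_pos.2 hr).ne']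
    ring_nf

theorem J_mul_self {p : ℝ} (hp : 1 < p) (r : ℝ) : J p r * r = |r| ^ p := by
  rcases eq_or_ne r 0 with rfl | hr
  · simp [Real.zero_rpow (show p ≠ 0 by linarith)]
  · have h : r * r = |r| * |r| := (abs_mul_abs_self r).symm
    rw [J, mul_assoc, h, ← mul_assoc, ← Real.rpow_add_one (abs_pos.2 hr).ne',
      ← Real.rpow_add_one (abs_pos.2 hr).ne']
    ring_nf

/-- The convexity inequality for `|r| ^ p / p`. -/
theorem J_mul_sub_le {p : ℝ} (hp : 1 < p) (a b : ℝ) :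
    J p a * (b - a) ≤ (|b| ^ p - |a| ^ p) / p := by
  refine le_trans ?_ (young_rpow_sub_one_mul hp (abs_nonneg a) (abs_nonneg b))
  rw [mul_sub, J_mul_self hp, ← abs_J hp, ← abs_mul]
  linarith [le_abs_self (J p a * b)]

theorem measurable_J (p : ℝ) : Measurable (J p) :=
  (measurable_id.abs.pow_const (p - 2)).mul measurable_id

end Scalar

/-! ### Duality in `L^p` and the abstract variational inequality -/

section Duality

variable {Y : Type*} [MeasurableSpace Y] {μ : Measure Y} {F : Type*} [NormedAddCommGroup F]
  {p : ℝ}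

/-- A function of growth `p - 1` in a function in `L^p` is in the dual of `L^p`. -/
theorem memLp_conjExponent {F' : Type*} [NormedAddCommGroup F'] (hp : 1 < p) {f : Y → F}
    (hf : MemLp f (ENNReal.ofReal p) μ) {w : Y → F'} (hw : AEStronglyMeasurable w μ) {C : ℝ}
    (hC : ∀ᵐ y ∂μ, ‖w y‖ ≤ C * ‖f y‖ ^ (p - 1)) :
    MemLp w (ENNReal.ofReal (p / (p - 1))) μ := by
  have h1 := hf.norm_rpow_div (ENNReal.ofReal (p - 1))
  rw [← ENNReal.ofReal_div_of_pos (by linarith), ENNReal.toReal_ofReal (by linarith)] at h1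
  exact h1.of_le_mul hw (c := C) (by
    filter_upwards [hC] with y hy
    rwa [Real.norm_of_nonneg (Real.rpow_nonneg (norm_nonneg _) _)])

theorem holderConjugate_conjExponent (hp : 1 < p) :
    ENNReal.HolderConjugate (ENNReal.ofReal (p / (p - 1))) (ENNReal.ofReal p) :=
  (Real.HolderConjugate.conjExponent hp).symm.ennrealOfReal

variable [InnerProductSpace ℝ F]

theorem eLpNorm_inner_le (hp : 1 < p) {w g : Y → F} (hw : AEStronglyMeasurable w μ)
    (hg : AEStronglyMeasurable g μ) :
    eLpNorm (fun y => (inner ℝ (w y) (g y) : ℝ)) 1 μ ≤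
      eLpNorm w (ENNReal.ofReal (p / (p - 1))) μ * eLpNorm g (ENNReal.ofReal p) μ := by
  have := holderConjugate_conjExponent hp
  simpa using eLpNorm_le_eLpNorm_mul_eLpNorm'_of_norm hw hg
    (fun x y => (inner ℝ x y : ℝ)) 1 (Eventually.of_forall fun y => by
      simpa using norm_inner_le_norm (𝕜 := ℝ) (w y) (g y))
      (p := ENNReal.ofReal (p / (p - 1))) (q := ENNReal.ofReal p) (r := 1)

theorem integrable_inner (hp : 1 < p) {w g : Y → F}
    (hw : MemLp w (ENNReal.ofReal (p / (p - 1))) μ) (hg : MemLp g (ENNReal.ofReal p) μ) :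
    Integrable (fun y => (inner ℝ (w y) (g y) : ℝ)) μ := by
  rw [← memLp_one_iff_integrable]
  exact ⟨hw.1.inner hg.1, (eLpNorm_inner_le hp hw.1 hg.1).trans_lt
    (ENNReal.mul_lt_top hw.2 hg.2)⟩

theorem enorm_integral_inner_le (hp : 1 < p) {w g : Y → F} (hw : AEStronglyMeasurable w μ)
    (hg : AEStronglyMeasurable g μ) :
    ‖∫ y, (inner ℝ (w y) (g y) : ℝ) ∂μ‖ₑ ≤
      eLpNorm w (ENNReal.ofReal (p / (p - 1))) μ * eLpNorm g (ENNReal.ofReal p) μ := by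
  refine (enorm_integral_le_lintegral_enorm _).trans ?_
  rw [← eLpNorm_one_eq_lintegral_enorm]
  exact eLpNorm_inner_le hp hw hg

/-- The duality pairing of `L^p` with its dual is continuous. -/
theorem tendsto_integral_inner (hp : 1 < p) {w : Y → F}
    (hw : MemLp w (ENNReal.ofReal (p / (p - 1))) μ) {f : Y → F} {fk : ℕ → Y → F}
    (hf : MemLp f (ENNReal.ofReal p) μ) (hfk : ∀ k, MemLp (fk k) (ENNReal.ofReal p) μ)
    (hlim : Tendsto (fun k => eLpNorm (fk k - f) (ENNReal.ofReal p) μ) atTop (𝓝 0)) :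
    Tendsto (fun k => ∫ y, (inner ℝ (w y) (fk k y) : ℝ) ∂μ) atTop
      (𝓝 (∫ y, (inner ℝ (w y) (f y) : ℝ) ∂μ)) := by
  rw [tendsto_iff_edist_tendsto_0]
  have h0 : Tendsto (fun k => eLpNorm w (ENNReal.ofReal (p / (p - 1))) μ *
      eLpNorm (fk k - f) (ENNReal.ofReal p) μ) atTop (𝓝 0) := by
    simpa using ENNReal.Tendsto.const_mul hlim (Or.inr hw.2.ne)
  refine tendsto_of_tendsto_of_tendsto_of_le_of_le tendsto_const_nhds h0 (fun _ => zero_le)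
    fun k => ?_
  rw [edist_eq_enorm_sub,
    ← integral_sub (integrable_inner hp hw (hfk k)) (integrable_inner hp hw hf)]
  simp only [← inner_sub_right]
  exact enorm_integral_inner_le hp hw.1 ((hfk k).sub hf).1

end Duality

section Energy

variable {Y : Type*} [MeasurableSpace Y] {μ : Measure Y} {F : Type*} [NormedAddCommGroup F]
  {p : ℝ} {N : F → ℝ} {K : ℝ≥0}

theorem integrable_gauge_rpow (hp : 1 < p) (hN : LipschitzWith K N) (hN0 : N 0 = 0)
    (hNn : ∀ x, 0 ≤ N x) {f : Y → F} (hf : MemLp f (ENNReal.ofReal p) μ) :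
    Integrable (fun y => N (f y) ^ p) μ := by
  have h := (hN.comp_memLp hN0 hf).integrable_norm_rpow (by simp; linarith) ENNReal.ofReal_ne_top
  rw [ENNReal.toReal_ofReal (by linarith)] at h
  refine h.congr (Eventually.of_forall fun y => ?_)
  simp [Real.norm_of_nonneg (hNn (f y))]

theorem tendsto_integral_gauge_rpow (hp : 1 < p) (hN : LipschitzWith K N) (hN0 : N 0 = 0)
    (hNn : ∀ x, 0 ≤ N x) {f : Y → F} {fk : ℕ → Y → F} (hf : MemLp f (ENNReal.ofReal p) μ)
    (hfk : ∀ k, MemLp (fk k) (ENNReal.ofReal p) μ)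
    (hlim : Tendsto (fun k => eLpNorm (fk k - f) (ENNReal.ofReal p) μ) atTop (𝓝 0)) :
    Tendsto (fun k => ∫ y, N (fk k y) ^ p ∂μ) atTop (𝓝 (∫ y, N (f y) ^ p ∂μ)) := by
  have p0 : 0 < p := by linarith
  have : Fact (1 ≤ ENNReal.ofReal p) := ⟨by simpa using hp.le⟩
  have hm := hN.comp_memLp hN0 hf
  have hmk := fun k => hN.comp_memLp hN0 (hfk k)
  have h1 : Tendsto (fun k => (hmk k).toLp (N ∘ fk k)) atTop (𝓝 (hm.toLp (N ∘ f))) := by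
    rw [Lp.tendsto_Lp_iff_tendsto_eLpNorm'']
    have h0 : Tendsto (fun k => (K : ℝ≥0∞) * eLpNorm (fk k - f) (ENNReal.ofReal p) μ) atTop
        (𝓝 0) := by
      simpa using ENNReal.Tendsto.const_mul hlim (Or.inr ENNReal.coe_ne_top)
    refine tendsto_of_tendsto_of_tendsto_of_le_of_le tendsto_const_nhds h0 (fun _ => zero_le)
      fun k => ?_
    have := eLpNorm_le_nnreal_smul_eLpNorm_of_ae_le_mul (μ := μ) (f := N ∘ fk k - N ∘ f)
      (g := fk k - f) (c := K) (Eventually.of_forall fun y => by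
        have := hN.nndist_le (fk k y) (f y)
        simpa [nndist_eq_nnnorm] using this) (ENNReal.ofReal p)
    simpa [ENNReal.smul_def] using this
  have h2 := (h1.norm).rpow_const (p := p) (Or.inr p0.le)
  have e : ∀ g : Y → F, ∀ hg : MemLp (N ∘ g) (ENNReal.ofReal p) μ,
      ‖hg.toLp (N ∘ g)‖ ^ p = ∫ y, N (g y) ^ p ∂μ := by
    intro g hg
    have hint : 0 ≤ ∫ y, ‖(N ∘ g) y‖ ^ p ∂μ :=
      integral_nonneg fun y => Real.rpow_nonneg (norm_nonneg _) _
    rw [Lp.norm_toLp, hg.eLpNorm_eq_integral_rpow_norm (by simpa using p0) ENNReal.ofReal_ne_top,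
      ENNReal.toReal_ofReal p0.le, ENNReal.toReal_ofReal (Real.rpow_nonneg hint _),
      ← Real.rpow_mul hint, inv_mul_cancel₀ p0.ne', Real.rpow_one]
    refine integral_congr_ae (Eventually.of_forall fun y => ?_)
    simp [Real.norm_of_nonneg (hNn (g y))]
  simp only [e] at h2
  exact h2

variable [InnerProductSpace ℝ F]

/-- The variational inequality behind the identity.  Let `N ^ p / p` be a convex energy density with
subdifferential `a`, let `f` be the datum of the solution, let `fk → f` in `L^p`, and let `ζ k` be
obtained from `fk k` by a change of variables which multiplies the energy by at most `b₁` on `B` and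
by at most `b₂` off `B`.  By convexity, testing the equation with `ζ k - fk k` gives at most the
change in energy in the limit `k → ∞`. -/
theorem exists_tendsto_variation_bound (hp : 1 < p) (hN : LipschitzWith K N) (hN0 : N 0 = 0)
    (hNn : ∀ x, 0 ≤ N x) {a : F → F} {C : ℝ} (haC : ∀ ξ, ‖a ξ‖ ≤ C * ‖ξ‖ ^ (p - 1))
    (hconv : ∀ ξ ζ, inner ℝ (a ξ) (ζ - ξ) ≤ (N ζ ^ p - N ξ ^ p) / p)
    {f : Y → F} (ham : AEStronglyMeasurable (fun y => a (f y)) μ) {fk ζ : ℕ → Y → F}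
    (hf : MemLp f (ENNReal.ofReal p) μ)
    (hfk : ∀ k, MemLp (fk k) (ENNReal.ofReal p) μ) (hζ : ∀ k, MemLp (ζ k) (ENNReal.ofReal p) μ)
    (hlim : Tendsto (fun k => eLpNorm (fk k - f) (ENNReal.ofReal p) μ) atTop (𝓝 0))
    {B : Set Y} {b₁ b₂ : ℝ}
    (hb : ∀ k, ∫ y, N (ζ k y) ^ p ∂μ ≤
      b₁ * ∫ y in B, N (fk k y) ^ p ∂μ + b₂ * ∫ y in Bᶜ, N (fk k y) ^ p ∂μ) :
    ∃ U : ℕ → ℝ, (∀ k, ∫ y, (inner ℝ (a (f y)) (ζ k y - fk k y) : ℝ) ∂μ ≤ U k) ∧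
      Tendsto U atTop (𝓝 ((b₁ * ∫ y in B, N (f y) ^ p ∂μ + b₂ * ∫ y in Bᶜ, N (f y) ^ p ∂μ
        - ∫ y, N (f y) ^ p ∂μ) / p)) := by
  have hw : MemLp (fun y => a (f y)) (ENNReal.ofReal (p / (p - 1))) μ :=
    memLp_conjExponent hp hf ham (Eventually.of_forall fun y => haC (f y))
  refine ⟨fun k => (b₁ * ∫ y in B, N (fk k y) ^ p ∂μ + b₂ * ∫ y in Bᶜ, N (fk k y) ^ p ∂μ
        - ∫ y, N (f y) ^ p ∂μ) / p + (∫ y, (inner ℝ (a (f y)) (f y) : ℝ) ∂μ -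
          ∫ y, (inner ℝ (a (f y)) (fk k y) : ℝ) ∂μ), fun k => ?_, ?_⟩
  · have hi1 := integrable_inner hp hw (hζ k)
    have hi2 := integrable_inner hp hw (hfk k)
    have hi3 := integrable_inner hp hw hf
    have hi4 := integrable_inner hp hw ((hζ k).sub hf)
    have hj1 := integrable_gauge_rpow hp hN hN0 hNn (hζ k)
    have hj2 := integrable_gauge_rpow hp hN hN0 hNn hf
    have e1 : ∫ y, (inner ℝ (a (f y)) (ζ k y - fk k y) : ℝ) ∂μ =
        ∫ y, (inner ℝ (a (f y)) (ζ k y - f y) : ℝ) ∂μ +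
        (∫ y, (inner ℝ (a (f y)) (f y) : ℝ) ∂μ - ∫ y, (inner ℝ (a (f y)) (fk k y) : ℝ) ∂μ) := by
      simp only [inner_sub_right]
      rw [integral_sub hi1 hi2, integral_sub hi1 hi3]; ring
    have e2 : ∫ y, (inner ℝ (a (f y)) (ζ k y - f y) : ℝ) ∂μ ≤
        (∫ y, N (ζ k y) ^ p ∂μ - ∫ y, N (f y) ^ p ∂μ) / p := by
      rw [← integral_sub hj1 hj2, ← integral_div]
      exact integral_mono hi4 ((hj1.sub hj2).div_const p) fun y => hconv _ _
    rw [e1]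
    have hp0 : 0 < p := by linarith
    have := hb k
    refine add_le_add (e2.trans ?_) le_rfl
    gcongr
  · have ht := tendsto_integral_inner hp hw hf hfk hlim
    have hr : ∀ s : Set Y, Tendsto (fun k => ∫ y in s, N (fk k y) ^ p ∂μ) atTop
        (𝓝 (∫ y in s, N (f y) ^ p ∂μ)) := fun s =>
      tendsto_integral_gauge_rpow hp hN hN0 hNn (hf.restrict s) (fun k => (hfk k).restrict s)
        (tendsto_of_tendsto_of_tendsto_of_le_of_le tendsto_const_nhds hlim (fun _ => zero_le)
          fun k => eLpNorm_restrict_le _ _ _ _)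
    have h1 := ((((hr B).const_mul b₁).add ((hr Bᶜ).const_mul b₂)).sub_const
      (∫ y, N (f y) ^ p ∂μ)).div_const p
    have h2 := ht.const_sub (∫ y, (inner ℝ (a (f y)) (f y) : ℝ) ∂μ)
    rw [sub_self] at h2
    simpa using h1.add h2

end Energy

/-! ### Change of variables and the anisotropic energy -/

section ChangeOfVariables

variable {n : ℕ} {V : Eu n → Eu n} {ℓ : ℝ}

theorem integral_le_piecewise {Y : Type*} [MeasurableSpace Y] {μ : Measure Y} {q r : Y → ℝ}
    {B : Set Y} (hB : MeasurableSet B) {b₁ b₂ : ℝ} (hq : ∀ y, 0 ≤ q y) (hr : Integrable r μ)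
    (h₁ : ∀ y ∈ B, q y ≤ b₁ * r y) (h₂ : ∀ y ∉ B, q y ≤ b₂ * r y) :
    ∫ y, q y ∂μ ≤ b₁ * ∫ y in B, r y ∂μ + b₂ * ∫ y in Bᶜ, r y ∂μ := by
  have i1 := (hr.const_mul b₁).indicator hB
  have i2 := (hr.const_mul b₂).indicator hB.compl
  have e : b₁ * ∫ y in B, r y ∂μ + b₂ * ∫ y in Bᶜ, r y ∂μ =
      ∫ y, (B.indicator (fun y => b₁ * r y) y + Bᶜ.indicator (fun y => b₂ * r y) y) ∂μ := by
    rw [integral_add i1 i2, integral_indicator hB, integral_indicator hB.compl,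
      integral_const_mul, integral_const_mul]
  rw [e]
  refine integral_mono_of_nonneg (Eventually.of_forall hq) (i1.add i2)
    (Eventually.of_forall fun y => ?_)
  by_cases hy : y ∈ B
  · simpa [hy] using h₁ y hy
  · simpa [hy] using h₂ y hy

namespace IsContractingField

theorem integral_eq (h : IsContractingField V ℓ) (f : Eu n → ℝ) :
    ∫ x, f x = ∫ y, h.jac y * f (h.homeo y) := by
  have h1 : ∫ x, f x = ∫ y, f (h.homeo y) ∂((volume : Measure (Eu n)).map h.homeo.symm) := by
    rw [h.homeo.symm.measurableEmbedding.integral_map]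
    simp
  rw [h1, h.map_homeo_symm,
    integral_withDensity_eq_integral_toReal_smul h.measurable_jac.ennreal_ofReal
      (Eventually.of_forall fun _ => ENNReal.ofReal_lt_top)]
  simp [ENNReal.toReal_ofReal (h.jac_nonneg _)]

theorem map_prod_homeo_symm (h : IsContractingField V ℓ) :
    ((volume : Measure (Eu n)).prod volume).map (Prod.map h.homeo.symm h.homeo.symm) =
      ((volume : Measure (Eu n)).prod volume).withDensity
        fun z => ENNReal.ofReal (h.jac z.1 * h.jac z.2) := by
  rw [← Measure.map_prod_map _ _ h.homeo.symm.measurable h.homeo.symm.measurable,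
    h.map_homeo_symm, prod_withDensity h.measurable_jac.ennreal_ofReal
      h.measurable_jac.ennreal_ofReal]
  simp only [ENNReal.ofReal_mul (h.jac_nonneg _)]

theorem integral_prod_eq (h : IsContractingField V ℓ) (f : Eu n × Eu n → ℝ) :
    ∫ z, f z ∂((volume : Measure (Eu n)).prod volume) =
      ∫ z, h.jac z.1 * h.jac z.2 * f (h.homeo z.1, h.homeo z.2)
        ∂((volume : Measure (Eu n)).prod volume) := by
  have h1 : ∫ z, f z ∂((volume : Measure (Eu n)).prod volume) =
      ∫ z, f (h.homeo z.1, h.homeo z.2)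
        ∂(((volume : Measure (Eu n)).prod volume).map (Prod.map h.homeo.symm h.homeo.symm)) := by
    have := (h.homeo.symm.prodCongr h.homeo.symm).measurableEmbedding.integral_map
      (μ := (volume : Measure (Eu n)).prod volume) (fun z => f (h.homeo z.1, h.homeo z.2))
    rw [Homeomorph.coe_prodCongr] at this
    rw [this]
    simp
  have hm : Measurable fun z : Eu n × Eu n => h.jac z.1 * h.jac z.2 :=
    (h.measurable_jac.comp measurable_fst).mul (h.measurable_jac.comp measurable_snd)
  rw [h1, h.map_prod_homeo_symm,
    integral_withDensity_eq_integral_toReal_smul hm.ennreal_ofReal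
      (Eventually.of_forall fun _ => ENNReal.ofReal_lt_top)]
  simp [ENNReal.toReal_ofReal (mul_nonneg (h.jac_nonneg _) (h.jac_nonneg _))]

theorem eLpNorm_comp_symm_le {F : Type*} [NormedAddCommGroup F] (h : IsContractingField V ℓ)
    {p : ℝ≥0∞} (hp : p ≠ ∞) {f : Eu n → F} (hf : AEStronglyMeasurable f volume) :
    eLpNorm (f ∘ h.homeo.symm) p volume ≤
      ENNReal.ofReal ((1 + ℓ) ^ n) ^ (1 / p).toReal * eLpNorm f p volume := by
  have hle := h.map_homeo_symm_le
  have hac : (volume : Measure (Eu n)).map h.homeo.symm ≪ volume :=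
    (Measure.absolutelyContinuous_of_le hle).trans Measure.smul_absolutelyContinuous
  rw [← eLpNorm_map_measure (hf.mono_ac hac) h.homeo.symm.measurable.aemeasurable]
  refine (eLpNorm_mono_measure f hle).trans_eq ?_
  rw [eLpNorm_smul_measure_of_ne_top hp, smul_eq_mul]

theorem quasiMeasurePreserving_symm (h : IsContractingField V ℓ) :
    Measure.QuasiMeasurePreserving h.homeo.symm (volume : Measure (Eu n)) volume :=
  ⟨h.homeo.symm.measurable, (Measure.absolutelyContinuous_of_le h.map_homeo_symm_le).trans
    Measure.smul_absolutelyContinuous⟩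

theorem memLp_comp_symm {F : Type*} [NormedAddCommGroup F] (h : IsContractingField V ℓ)
    {p : ℝ≥0∞} (hp : p ≠ ∞) {f : Eu n → F} (hf : MemLp f p volume) :
    MemLp (f ∘ h.homeo.symm) p volume :=
  ⟨hf.1.comp_quasiMeasurePreserving h.quasiMeasurePreserving_symm,
    (h.eLpNorm_comp_symm_le hp hf.1).trans_lt
      (ENNReal.mul_lt_top (ENNReal.rpow_lt_top_of_nonneg (by simp) ENNReal.ofReal_ne_top) hf.2)⟩

/-- The chain rule for the gradient under the inverse of `x ↦ x + V x`, in implicit form. -/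
theorem gradient_comp_symm (h : IsContractingField V ℓ) {f : Eu n → ℝ} (hf : ContDiff ℝ 1 f)
    (y : Eu n) :
    gradient (f ∘ h.homeo.symm) (h.homeo y) +
      (fderiv ℝ V y).adjoint (gradient (f ∘ h.homeo.symm) (h.homeo y)) = gradient f y := by
  have hg : ContDiff ℝ 1 (f ∘ h.homeo.symm) := hf.comp h.contDiff_symm
  have h1 : HasFDerivAt ((f ∘ h.homeo.symm) ∘ h.homeo) _ y :=
    ((hg.differentiable one_ne_zero).differentiableAt.hasFDerivAt).comp y (h.hasFDerivAt_homeo y)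
  have h2 : (f ∘ h.homeo.symm) ∘ h.homeo = f := by ext x; simp
  rw [h2] at h1
  refine ext_inner_right ℝ fun v => ?_
  rw [inner_add_left, ContinuousLinearMap.adjoint_inner_left, gradient, gradient,
    InnerProductSpace.toDual_symm_apply, InnerProductSpace.toDual_symm_apply,
    InnerProductSpace.toDual_symm_apply, h1.fderiv]
  simp

theorem norm_gradient_comp_symm_le (h : IsContractingField V ℓ) {f : Eu n → ℝ}
    (hf : ContDiff ℝ 1 f) (x : Eu n) :
    ‖gradient (f ∘ h.homeo.symm) x‖ ≤ (1 - ℓ)⁻¹ * ‖gradient f (h.homeo.symm x)‖ := by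
  have h1 := h.gradient_comp_symm hf (h.homeo.symm x)
  rw [Homeomorph.apply_symm_apply] at h1
  have h2 := ((fderiv ℝ V (h.homeo.symm x)).adjoint).le_of_opNorm_le
    ((LinearIsometryEquiv.norm_map _ _).trans_le (h.norm_fderiv_le _))
    (gradient (f ∘ h.homeo.symm) x)
  have h3 := norm_sub_le_norm_add (gradient (f ∘ h.homeo.symm) x)
    ((fderiv ℝ V (h.homeo.symm x)).adjoint (gradient (f ∘ h.homeo.symm) x))
  rw [h1] at h3
  rw [← div_eq_inv_mul, le_div_iff₀ (by linarith [h.lt_one])]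
  linarith

end IsContractingField

theorem continuous_gradient {n : ℕ} {f : Eu n → ℝ} (hf : ContDiff ℝ 1 f) :
    Continuous (gradient f) :=
  (InnerProductSpace.toDual ℝ (Eu n)).symm.continuous.comp (hf.continuous_fderiv one_ne_zero)

end ChangeOfVariables

section LocalEnergy

variable {n : ℕ} {V : Eu n → Eu n} {ℓ p : ℝ} {H : Eu n → ℝ}

theorem IsFinslerMinkowski.exists_lipschitzWith (hH : IsFinslerMinkowski H) :
    ∃ K : ℝ≥0, LipschitzWith K H := by
  obtain ⟨C₁, C₂, -, h0, h⟩ := hH.equiv_norm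
  refine ⟨⟨C₂, h0.le⟩, LipschitzWith.of_le_add_mul _ fun x y => ?_⟩
  have h1 := hH.map_add_le y (x - y)
  rw [add_sub_cancel] at h1
  rw [dist_eq_norm]
  exact h1.trans (add_le_add le_rfl (h _).2)

/-- The anisotropic energy after composition with the inverse of `x ↦ x + V x`, where `V` is the
dilation field on the ball of radius `R`. -/
theorem IsContractingField.integral_finsler_rpow_le (h : IsContractingField V ℓ) (hp : 1 < p)
    (hH : IsFinslerMinkowski H) {c : ℝ} (hc : ∀ x y, ‖x‖ ≤ ℓ * ‖y‖ → H x ≤ c * ℓ * H y)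
    (hcl : c * ℓ < 1) {R t : ℝ} (ht : |t| < 1)
    (hV : ∀ x ∈ Metric.ball (0 : Eu n) R, fderiv ℝ V x = t • .id ℝ (Eu n))
    {f : Eu n → ℝ} (hf : ContDiff ℝ 1 f) (hfp : MemLp (gradient f) (ENNReal.ofReal p) volume) :
    ∫ x, H (gradient (f ∘ h.homeo.symm) x) ^ p ≤
      (1 + t) ^ (n - p) * (∫ x in Metric.ball (0 : Eu n) R, H (gradient f x) ^ p) +
      (1 + ℓ) ^ n * (1 - c * ℓ) ^ (-p) *
        (∫ x in (Metric.ball (0 : Eu n) R)ᶜ, H (gradient f x) ^ p) := by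
  obtain ⟨K, hK⟩ := hH.exists_lipschitzWith
  have p0 : 0 < p := by linarith
  have ht1 : 0 < 1 + t := by linarith [(abs_lt.1 ht).1]
  have hcl' : 0 < 1 - c * ℓ := by linarith
  rw [h.integral_eq]
  refine integral_le_piecewise Metric.isOpen_ball.measurableSet
    (fun y => mul_nonneg (h.jac_nonneg y) (Real.rpow_nonneg (hH.nonneg _) _))
    (integrable_gauge_rpow hp hK hH.map_zero hH.nonneg hfp) (fun y hy => ?_) (fun y _ => ?_)
  · have h1 := h.gradient_comp_symm hf y
    rw [hV y hy] at h1
    have h2 : gradient f y = (1 + t) • gradient (f ∘ h.homeo.symm) (h.homeo y) := by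
      rw [← h1, add_smul, one_smul]
      congr 1
      refine ext_inner_right ℝ fun v => ?_
      rw [ContinuousLinearMap.adjoint_inner_left]
      simp [real_inner_smul_left]
    rw [h.jac_eq_of_fderiv_eq (hV y hy), abs_of_pos ht1, h2, hH.map_smul_of_nonneg ht1.le,
      Real.mul_rpow ht1.le (hH.nonneg _), ← mul_assoc, ← Real.rpow_add ht1, sub_add_cancel,
      Real.rpow_natCast]
  · have h1 := h.gradient_comp_symm hf y
    set ζ := gradient (f ∘ h.homeo.symm) (h.homeo y)
    have h2 := ((fderiv ℝ V y).adjoint).le_of_opNorm_le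
      ((LinearIsometryEquiv.norm_map _ _).trans_le (h.norm_fderiv_le _)) ζ
    have h3 : H ζ ≤ H (gradient f y) + c * ℓ * H ζ := by
      have h4 : ζ = gradient f y + (-1 : ℝ) • (fderiv ℝ V y).adjoint ζ := by
        rw [← h1]; simp
      have h5 := hH.map_add_le (gradient f y) ((-1 : ℝ) • (fderiv ℝ V y).adjoint ζ)
      rw [← h4, hH.homogeneous, abs_neg, abs_one, one_mul] at h5
      linarith [hc _ _ h2]
    have h6 : H ζ ≤ (1 - c * ℓ)⁻¹ * H (gradient f y) := by
      rw [← div_eq_inv_mul, le_div_iff₀ hcl']; linarith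
    have h7 : H ζ ^ p ≤ (1 - c * ℓ) ^ (-p) * H (gradient f y) ^ p := by
      refine (Real.rpow_le_rpow (hH.nonneg _) h6 p0.le).trans_eq ?_
      rw [Real.mul_rpow (by positivity) (hH.nonneg _), Real.inv_rpow hcl'.le,
        Real.rpow_neg hcl'.le]
    rw [mul_assoc]
    exact mul_le_mul (h.jac_le y) h7 (Real.rpow_nonneg (hH.nonneg _) _)
      (by have := h.nonneg; positivity)

end LocalEnergy

/-! ### Test functions and the local term -/

section TestFunctions

variable {n : ℕ} {V : Eu n → Eu n} {ℓ p : ℝ} {H : Eu n → ℝ}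

/-- The mollification `u_k` of `u`. -/
noncomputable abbrev smooth (u : Eu n → ℝ) (k : ℕ) : Eu n → ℝ := mollify (.id ℝ (Eu n)) k u

/-- The test functions `u_k ∘ S⁻¹ - u_k`, where `S x = x + V x` and `u_k` is the mollification
of `u`. -/
noncomputable def testFunction (h : IsContractingField V ℓ) (u : Eu n → ℝ) (k : ℕ) : Eu n → ℝ :=
  fun x => smooth u k (h.homeo.symm x) - smooth u k x

theorem contDiff_smooth {u : Eu n → ℝ} (hu : LocallyIntegrable u volume) (k : ℕ) :
    ContDiff ℝ 1 (smooth u k) :=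
  (contDiff_mollify k hu).of_le (by exact_mod_cast le_top)

theorem contDiff_testFunction (h : IsContractingField V ℓ) {u : Eu n → ℝ}
    (hu : LocallyIntegrable u volume) (k : ℕ) : ContDiff ℝ 1 (testFunction h u k) :=
  ((contDiff_smooth hu k).comp h.contDiff_symm).sub (contDiff_smooth hu k)

theorem hasCompactSupport_testFunction (h : IsContractingField V ℓ) (hV : HasCompactSupport V)
    (u : Eu n → ℝ) (k : ℕ) : HasCompactSupport (testFunction h u k) :=
  HasCompactSupport.intro hV.isCompact fun x hx => by
    have h1 : h.homeo x = x := by rw [h.homeo_apply, image_eq_zero_of_notMem_tsupport hx, add_zero]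
    have h2 : h.homeo.symm x = x := by rw [Homeomorph.symm_apply_eq, h1]
    rw [testFunction, h2, sub_self]

theorem locallyIntegrable_of_memLp (hp : 1 < p) {u : Eu n → ℝ}
    (hu : MemLp u (ENNReal.ofReal p) volume) : LocallyIntegrable u volume :=
  hu.locallyIntegrable (by simpa using hp.le)

theorem weakGradient_spec {u : Eu n → ℝ} (hu : ∃ G, IsWeakGradient u G) :
    IsWeakGradient u (weakGradient u) := by
  rw [weakGradient, dif_pos hu]; exact hu.choose_spec

/-- The local part of the weak form of `u`, tested with `testFunction h u k`, is bounded by a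
sequence which converges to the bound for the change in anisotropic energy. -/
theorem exists_tendsto_local_variation (h : IsContractingField V ℓ) (hp : 1 < p)
    (hH : IsFinslerMinkowski H) {c : ℝ} (hc : ∀ x y, ‖x‖ ≤ ℓ * ‖y‖ → H x ≤ c * ℓ * H y)
    (hcl : c * ℓ < 1) {R t : ℝ} (ht : |t| < 1)
    (hV : ∀ x ∈ Metric.ball (0 : Eu n) R, fderiv ℝ V x = t • .id ℝ (Eu n))
    {u : Eu n → ℝ} (hu : u ∈ W1p n p) :
    ∃ U : ℕ → ℝ, (∀ k, ∫ x, H (weakGradient u x) ^ (p - 1) *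
        inner ℝ (gradient H (weakGradient u x)) (gradient (testFunction h u k) x) ≤ U k) ∧
      Tendsto U atTop (𝓝 (((1 + t) ^ (n - p) *
          (∫ x in Metric.ball (0 : Eu n) R, H (weakGradient u x) ^ p) +
        (1 + ℓ) ^ n * (1 - c * ℓ) ^ (-p) *
          (∫ x in (Metric.ball (0 : Eu n) R)ᶜ, H (weakGradient u x) ^ p) -
        anisoEnergy H p u) / p)) := by
  obtain ⟨huL, huG, hGL⟩ := hu
  obtain ⟨K, hK⟩ := hH.exists_lipschitzWith
  obtain ⟨C, hC⟩ := hH.norm_flux_le hp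
  have hloc := locallyIntegrable_of_memLp hp huL
  have hgr : ∀ k, gradient (smooth u k) = mollify (.id ℝ (Eu n)) k (weakGradient u) :=
    fun k => gradient_mollify k (weakGradient_spec huG)
  have hfk : ∀ k, MemLp (gradient (smooth u k)) (ENNReal.ofReal p) volume := fun k => by
    rw [hgr]; exact memLp_mollify _ hp.le hGL k
  have hζ : ∀ k, MemLp (gradient (smooth u k ∘ h.homeo.symm)) (ENNReal.ofReal p) volume :=
    fun k => (h.memLp_comp_symm ENNReal.ofReal_ne_top (hfk k)).of_le_mul
      (continuous_gradient ((contDiff_smooth hloc k).comp h.contDiff_symm)).aestronglyMeasurable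
      (Eventually.of_forall fun x => h.norm_gradient_comp_symm_le (contDiff_smooth hloc k) x)
  obtain ⟨U, hU, hlim⟩ := exists_tendsto_variation_bound hp hK hH.map_zero hH.nonneg hC
    (hH.inner_flux_sub_le hp)
    ((hH.measurable_flux p).comp_aemeasurable hGL.1.aemeasurable).aestronglyMeasurable
    hGL hfk hζ
    (by simpa only [hgr] using tendsto_eLpNorm_mollify_sub (.id ℝ (Eu n)) hp.le hGL)
    (fun k => h.integral_finsler_rpow_le hp hH hc hcl ht hV (contDiff_smooth hloc k) (hfk k))
  refine ⟨U, fun k => le_trans (le_of_eq ?_) (hU k), hlim⟩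
  refine integral_congr_ae (Eventually.of_forall fun x => ?_)
  have h1 : gradient (testFunction h u k) x =
      gradient (smooth u k ∘ h.homeo.symm) x - gradient (smooth u k) x := by
    simp only [gradient]
    rw [← map_sub]
    congr 1
    exact fderiv_sub (((contDiff_smooth hloc k).comp h.contDiff_symm).differentiable
      one_ne_zero).differentiableAt
      ((contDiff_smooth hloc k).differentiable one_ne_zero).differentiableAt
  simp only [h1, flux, real_inner_smul_left]

end TestFunctions

/-! ### The nonlocal term -/

section Nonlocal

variable {n : ℕ} {V : Eu n → Eu n} {ℓ p s : ℝ}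

/-- The fractional difference quotient `(u(x) - u(y)) / |x - y|^{n/p + s}`, whose `L^p` norm is the
Gagliardo seminorm. -/
noncomputable def diffQuot (s p : ℝ) (u : Eu n → ℝ) (z : Eu n × Eu n) : ℝ :=
  (u z.1 - u z.2) / ‖z.1 - z.2‖ ^ ((n : ℝ) / p + s)

theorem norm_rpow_mul (hp : 0 < p) (z : Eu n × Eu n) :
    (‖z.1 - z.2‖ ^ ((n : ℝ) / p + s)) ^ p = ‖z.1 - z.2‖ ^ (n + s * p) := by
  rw [← Real.rpow_mul (norm_nonneg _), add_mul, div_mul_cancel₀ _ hp.ne']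

theorem abs_diffQuot_rpow (hp : 0 < p) (u : Eu n → ℝ) (z : Eu n × Eu n) :
    |diffQuot s p u z| ^ p = |u z.1 - u z.2| ^ p / ‖z.1 - z.2‖ ^ (n + p * s) := by
  rw [diffQuot, abs_div, abs_of_nonneg (Real.rpow_nonneg (norm_nonneg _) _),
    Real.div_rpow (abs_nonneg _) (Real.rpow_nonneg (norm_nonneg _) _), norm_rpow_mul hp, mul_comm s]

theorem J_diffQuot_mul (hp : 1 < p) (u φ : Eu n → ℝ) (z : Eu n × Eu n) :
    J p (diffQuot s p u z) * diffQuot s p φ z =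
      J p (u z.1 - u z.2) * (φ z.1 - φ z.2) / ‖z.1 - z.2‖ ^ (n + s * p) := by
  by_cases hz : z.1 = z.2
  · simp [diffQuot, hz]
  · have h0 : 0 < ‖z.1 - z.2‖ ^ ((n : ℝ) / p + s) :=
      Real.rpow_pos_of_pos (norm_pos_iff.2 (sub_ne_zero.2 hz)) _
    rw [← norm_rpow_mul (by linarith)]
    simp only [diffQuot]
    set r := ‖z.1 - z.2‖ ^ ((n : ℝ) / p + s)
    have h1 : r ^ p = r ^ (p - 2) * (r * r) := by
      rw [← mul_assoc, ← Real.rpow_add_one h0.ne', ← Real.rpow_add_one h0.ne']; ring_nf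
    rw [J, J, abs_div, abs_of_pos h0, Real.div_rpow (abs_nonneg _) h0.le, h1]
    have := (Real.rpow_pos_of_pos h0 (p - 2)).ne'
    field_simp

theorem aestronglyMeasurable_diffQuot {u : Eu n → ℝ} (hu : AEStronglyMeasurable u volume) :
    AEStronglyMeasurable (diffQuot s p u) (volume.prod volume) := by
  have h1 : AEStronglyMeasurable (fun z : Eu n × Eu n => u z.1 - u z.2) (volume.prod volume) :=
    (hu.comp_quasiMeasurePreserving Measure.quasiMeasurePreserving_fst).sub
      (hu.comp_quasiMeasurePreserving Measure.quasiMeasurePreserving_snd)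
  have h2 : Measurable fun z : Eu n × Eu n => ‖z.1 - z.2‖ ^ ((n : ℝ) / p + s) :=
    (measurable_fst.sub measurable_snd).norm.pow_const _
  exact (h1.aemeasurable.div h2.aemeasurable).aestronglyMeasurable

theorem memLp_diffQuot {u : Eu n → ℝ} (hu : u ∈ Wsp n s p) :
    MemLp (diffQuot s p u) (ENNReal.ofReal p) (volume.prod volume) :=
  hu.2.of_le (aestronglyMeasurable_diffQuot hu.1.1) (Eventually.of_forall fun z => by
    simp [diffQuot])

/-- Mollifying `u` mollifies its difference quotient along the diagonal. -/
theorem diffQuot_smooth {u : Eu n → ℝ} (hu : LocallyIntegrable u volume) (k : ℕ) :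
    diffQuot s p (smooth u k) =
      mollify ((ContinuousLinearMap.id ℝ (Eu n)).prod (.id ℝ (Eu n))) k (diffQuot s p u) := by
  ext z
  simp only [diffQuot, mollify, ContinuousLinearMap.prod_apply, ContinuousLinearMap.id_apply,
    Prod.fst_sub, Prod.snd_sub, sub_sub_sub_cancel_right]
  rw [integral_div, integral_sub (integrable_mollifierMeasure_sub k hu z.1)
    (integrable_mollifierMeasure_sub k hu z.2)]

namespace IsContractingField

theorem abs_diffQuot_comp_symm_le (h : IsContractingField V ℓ) (hs : 0 < s) (hp : 1 < p)
    (w : Eu n → ℝ) (z : Eu n × Eu n) :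
    |diffQuot s p (w ∘ h.homeo.symm) (h.homeo z.1, h.homeo z.2)| ≤
      (1 - ℓ) ^ (-((n : ℝ) / p + s)) * |diffQuot s p w z| := by
  have hl : 0 < 1 - ℓ := by linarith [h.lt_one]
  by_cases hz : z.1 = z.2
  · simp [diffQuot, hz]
  · have h0 : 0 < ‖z.1 - z.2‖ := norm_pos_iff.2 (sub_ne_zero.2 hz)
    have h1 := h.le_norm_add_sub z.1 z.2
    have hσ : 0 ≤ (n : ℝ) / p + s := by positivity
    simp only [diffQuot, Function.comp_apply, Homeomorph.symm_apply_apply, abs_div,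
      abs_of_nonneg (Real.rpow_nonneg (norm_nonneg _) _)]
    rw [homeo_apply, homeo_apply]
    rw [Real.rpow_neg hl.le, ← div_eq_inv_mul, div_div]
    have h2 : ‖z.1 - z.2‖ ^ ((n : ℝ) / p + s) * (1 - ℓ) ^ ((n : ℝ) / p + s) ≤
        ‖z.1 + V z.1 - (z.2 + V z.2)‖ ^ ((n : ℝ) / p + s) := by
      rw [mul_comm, ← Real.mul_rpow hl.le h0.le]
      exact Real.rpow_le_rpow (by positivity) h1 hσ
    gcongr

theorem abs_diffQuot_comp_symm_eq (h : IsContractingField V ℓ) {R t : ℝ} (ht : |t| < 1)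
    (hV : ∀ x ∈ Metric.ball (0 : Eu n) R, V x = t • x) (w : Eu n → ℝ) {z : Eu n × Eu n}
    (hz : z ∈ Metric.ball (0 : Eu n) R ×ˢ Metric.ball (0 : Eu n) R) :
    |diffQuot s p (w ∘ h.homeo.symm) (h.homeo z.1, h.homeo z.2)| =
      (1 + t) ^ (-((n : ℝ) / p + s)) * |diffQuot s p w z| := by
  have ht1 : 0 < 1 + t := by linarith [(abs_lt.1 ht).1]
  have h1 : z.1 + V z.1 - (z.2 + V z.2) = (1 + t) • (z.1 - z.2) := by
    rw [hV _ hz.1, hV _ hz.2, add_smul, one_smul, smul_sub]; abel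
  simp only [diffQuot, Function.comp_apply, Homeomorph.symm_apply_apply, abs_div,
    abs_of_nonneg (Real.rpow_nonneg (norm_nonneg _) _)]
  rw [homeo_apply, homeo_apply, h1, norm_smul, Real.norm_of_nonneg ht1.le,
    Real.mul_rpow ht1.le (norm_nonneg _), Real.rpow_neg ht1.le, ← div_eq_inv_mul, div_div, mul_comm]

theorem memLp_diffQuot_comp_symm (h : IsContractingField V ℓ) (hs : 0 < s) (hp : 1 < p)
    {w : Eu n → ℝ} (hwm : AEStronglyMeasurable w volume)
    (hw : MemLp (diffQuot s p w) (ENNReal.ofReal p) (volume.prod volume)) :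
    MemLp (diffQuot s p (w ∘ h.homeo.symm)) (ENNReal.ofReal p) (volume.prod volume) := by
  have hle : ((volume : Measure (Eu n)).prod volume).map (Prod.map h.homeo.symm h.homeo.symm) ≤
      ENNReal.ofReal ((1 + ℓ) ^ n * (1 + ℓ) ^ n) • (volume.prod volume) := by
    rw [h.map_prod_homeo_symm, ← withDensity_const]
    refine withDensity_mono (Eventually.of_forall fun x => ENNReal.ofReal_le_ofReal ?_)
    exact mul_le_mul (h.jac_le _) (h.jac_le _) (h.jac_nonneg _)
      (by have := h.nonneg; positivity)
  have hmeas : Measurable (Prod.map h.homeo.symm h.homeo.symm) :=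
    h.homeo.symm.measurable.prodMap h.homeo.symm.measurable
  have h1 : MemLp (diffQuot s p w ∘ Prod.map h.homeo.symm h.homeo.symm) (ENNReal.ofReal p)
      (volume.prod volume) := by
    have h2 := (hw.smul_measure (c := ENNReal.ofReal ((1 + ℓ) ^ n * (1 + ℓ) ^ n))
      ENNReal.ofReal_ne_top).mono_measure hle
    exact (memLp_map_measure_iff h2.1 hmeas.aemeasurable).1 h2
  refine h1.of_le_mul (c := (1 - ℓ) ^ (-((n : ℝ) / p + s))) (aestronglyMeasurable_diffQuot
    (hwm.comp_quasiMeasurePreserving h.quasiMeasurePreserving_symm))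
    (Eventually.of_forall fun z => ?_)
  have := h.abs_diffQuot_comp_symm_le hs hp w (h.homeo.symm z.1, h.homeo.symm z.2)
  simpa [Prod.map] using this

/-- The Gagliardo energy after composition with the inverse of `x ↦ x + V x`, where `V` is the
dilation field on the ball of radius `R`. -/
theorem integral_diffQuot_rpow_le (h : IsContractingField V ℓ) (hs : 0 < s) (hp : 1 < p)
    {R t : ℝ} (ht : |t| < 1) (hV : ∀ x ∈ Metric.ball (0 : Eu n) R, V x = t • x)
    (hV' : ∀ x ∈ Metric.ball (0 : Eu n) R, fderiv ℝ V x = t • .id ℝ (Eu n)) {w : Eu n → ℝ}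
    (hw : MemLp (diffQuot s p w) (ENNReal.ofReal p) (volume.prod volume)) :
    ∫ z, |diffQuot s p (w ∘ h.homeo.symm) z| ^ p ∂((volume : Measure (Eu n)).prod volume) ≤
      (1 + t) ^ (n - s * p) * ∫ z in Metric.ball (0 : Eu n) R ×ˢ Metric.ball (0 : Eu n) R,
        |diffQuot s p w z| ^ p ∂((volume : Measure (Eu n)).prod volume) +
      (1 + ℓ) ^ (2 * n) * (1 - ℓ) ^ (-(n + s * p)) *
        ∫ z in (Metric.ball (0 : Eu n) R ×ˢ Metric.ball (0 : Eu n) R)ᶜ,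
          |diffQuot s p w z| ^ p ∂((volume : Measure (Eu n)).prod volume) := by
  have p0 : 0 < p := by linarith
  have ht1 : 0 < 1 + t := by linarith [(abs_lt.1 ht).1]
  have hl : 0 < 1 - ℓ := by linarith [h.lt_one]
  have hσ : -((n : ℝ) / p + s) * p = -(n + s * p) := by field_simp
  rw [h.integral_prod_eq]
  refine integral_le_piecewise
    (Metric.isOpen_ball.measurableSet.prod Metric.isOpen_ball.measurableSet)
    (fun z => mul_nonneg (mul_nonneg (h.jac_nonneg _) (h.jac_nonneg _))
      (Real.rpow_nonneg (abs_nonneg _) _))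
    (integrable_gauge_rpow hp (N := fun r : ℝ => |r|) lipschitzWith_one_norm abs_zero abs_nonneg hw)
    (fun z hz => le_of_eq ?_) (fun z _ => ?_)
  · rw [h.abs_diffQuot_comp_symm_eq ht hV w hz, h.jac_eq_of_fderiv_eq (hV' _ hz.1),
      h.jac_eq_of_fderiv_eq (hV' _ hz.2), abs_of_pos ht1,
      Real.mul_rpow (Real.rpow_nonneg ht1.le _) (abs_nonneg _), ← Real.rpow_mul ht1.le, hσ,
      ← mul_assoc, ← Real.rpow_natCast, ← Real.rpow_add ht1, ← Real.rpow_add ht1]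
    ring_nf
  · have h1 : |diffQuot s p (w ∘ h.homeo.symm) (h.homeo z.1, h.homeo z.2)| ^ p ≤
        (1 - ℓ) ^ (-(n + s * p)) * |diffQuot s p w z| ^ p := by
      refine (Real.rpow_le_rpow (abs_nonneg _) (h.abs_diffQuot_comp_symm_le hs hp w z)
        p0.le).trans_eq ?_
      rw [Real.mul_rpow (Real.rpow_nonneg hl.le _) (abs_nonneg _), ← Real.rpow_mul hl.le, hσ]
    have h2 : h.jac z.1 * h.jac z.2 ≤ (1 + ℓ) ^ (2 * n) := by
      rw [two_mul, pow_add]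
      exact mul_le_mul (h.jac_le _) (h.jac_le _) (h.jac_nonneg _)
        (by have := h.nonneg; positivity)
    rw [mul_assoc ((1 + ℓ) ^ (2 * n))]
    exact mul_le_mul h2 h1 (Real.rpow_nonneg (abs_nonneg _) _)
      (by have := h.nonneg; positivity)

end IsContractingField

/-- The nonlocal part of the weak form of `u`, tested with `testFunction h u k`, is bounded by a
sequence which converges to the bound for the change in Gagliardo energy. -/
theorem exists_tendsto_nonlocal_variation (h : IsContractingField V ℓ) (hs : 0 < s) (hp : 1 < p)
    {R t : ℝ} (ht : |t| < 1) (hV : ∀ x ∈ Metric.ball (0 : Eu n) R, V x = t • x)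
    (hV' : ∀ x ∈ Metric.ball (0 : Eu n) R, fderiv ℝ V x = t • .id ℝ (Eu n))
    {u : Eu n → ℝ} (hu : u ∈ Wsp n s p) :
    ∃ U : ℕ → ℝ, (∀ k, ∫ z : Eu n × Eu n, J p (u z.1 - u z.2) *
        (testFunction h u k z.1 - testFunction h u k z.2) / ‖z.1 - z.2‖ ^ (n + s * p)
          ∂(volume.prod volume) ≤ U k) ∧
      Tendsto U atTop (𝓝 (((1 + t) ^ (n - s * p) *
          ∫ z in Metric.ball (0 : Eu n) R ×ˢ Metric.ball (0 : Eu n) R,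
            |diffQuot s p u z| ^ p ∂((volume : Measure (Eu n)).prod volume) +
        (1 + ℓ) ^ (2 * n) * (1 - ℓ) ^ (-(n + s * p)) *
          ∫ z in (Metric.ball (0 : Eu n) R ×ˢ Metric.ball (0 : Eu n) R)ᶜ,
            |diffQuot s p u z| ^ p ∂((volume : Measure (Eu n)).prod volume) -
        gagliardo s p u) / p)) := by
  have p0 : 0 < p := by linarith
  have hloc := locallyIntegrable_of_memLp hp hu.1
  have hf := memLp_diffQuot hu
  have hfk : ∀ k, MemLp (diffQuot s p (smooth u k)) (ENNReal.ofReal p) (volume.prod volume) :=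
    fun k => by rw [diffQuot_smooth hloc]; exact memLp_mollify _ hp.le hf k
  have hζ := fun k => h.memLp_diffQuot_comp_symm hs hp
    (contDiff_smooth hloc k).continuous.aestronglyMeasurable (hfk k)
  obtain ⟨U, hU, hlim⟩ := exists_tendsto_variation_bound hp (N := fun r : ℝ => |r|) (a := J p)
    (C := 1) lipschitzWith_one_norm abs_zero abs_nonneg
    (fun ξ => by rw [Real.norm_eq_abs, abs_J hp, one_mul, Real.norm_eq_abs])
    (fun ξ ζ => by
      have := J_mul_sub_le hp ξ ζ
      simpa [mul_comm] using this)
    ((measurable_J p).comp_aemeasurable hf.1.aemeasurable).aestronglyMeasurable hf hfk hζ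
    (by simpa only [diffQuot_smooth hloc] using tendsto_eLpNorm_mollify_sub _ hp.le hf)
    (fun k => h.integral_diffQuot_rpow_le hs hp ht hV hV' (hfk k))
  have hg : gagliardo s p u = ∫ z, |diffQuot s p u z| ^ p ∂(volume.prod volume) := by
    simp only [gagliardo, abs_diffQuot_rpow p0]
  rw [hg]
  refine ⟨U, fun k => le_trans (le_of_eq ?_) (hU k), hlim⟩
  refine integral_congr_ae (Eventually.of_forall fun z => ?_)
  have h1 : diffQuot s p (smooth u k ∘ h.homeo.symm) z - diffQuot s p (smooth u k) z =
      diffQuot s p (testFunction h u k) z := by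
    simp only [diffQuot, testFunction, Function.comp_apply]; ring
  simp only [h1, ← J_diffQuot_mul hp]
  simp [mul_comm]

end Nonlocal

/-! ### Deformations in `L^p` -/

section Shift

variable {n : ℕ} {V : Eu n → Eu n} {ℓ p : ℝ}

theorem IsContractingField.smul (h : IsContractingField V ℓ) {τ : ℝ} (hτ : τ ∈ Set.Icc (0 : ℝ) 1) :
    IsContractingField (fun x => τ • V x) ℓ where
  contDiff := h.contDiff.const_smul τ
  norm_fderiv_le x := by
    have h1 : HasFDerivAt (fun x => τ • V x) (τ • fderiv ℝ V x) x :=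
      (h.contDiff.differentiable one_ne_zero).differentiableAt.hasFDerivAt.const_smul τ
    rw [h1.fderiv, norm_smul, Real.norm_of_nonneg hτ.1]
    calc τ * ‖fderiv ℝ V x‖ ≤ 1 * ‖fderiv ℝ V x‖ := by gcongr; exact hτ.2
      _ ≤ ℓ := by rw [one_mul]; exact h.norm_fderiv_le x
  lt_one := h.lt_one

theorem IsContractingField.map_homeo_le_two_pow (h : IsContractingField V ℓ) (hℓ : ℓ ≤ 1 / 2) :
    (volume : Measure (Eu n)).map h.homeo ≤ (2 : ℝ≥0∞) ^ n • volume := by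
  refine h.map_homeo_le.trans ?_
  gcongr
  have : ENNReal.ofReal ((2 : ℝ) ^ n) = 2 ^ n := by
    rw [ENNReal.ofReal_pow zero_le_two, ENNReal.ofReal_ofNat]
  rw [← this, ← inv_pow]
  refine ENNReal.ofReal_le_ofReal ?_
  have h1 : 0 < 1 - ℓ := by linarith [h.lt_one]
  gcongr
  rw [inv_le_comm₀ h1 two_pos]
  linarith

theorem IsContractingField.eLpNorm_comp_le {F : Type*} [NormedAddCommGroup F]
    (h : IsContractingField V ℓ) (hℓ : ℓ ≤ 1 / 2) {p : ℝ≥0∞} (hp : p ≠ ∞) {f : Eu n → F}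
    (hf : AEStronglyMeasurable f volume) :
    eLpNorm (f ∘ h.homeo) p volume ≤
      ((2 : ℝ≥0∞) ^ n) ^ (1 / p).toReal * eLpNorm f p volume := by
  have hle := h.map_homeo_le_two_pow hℓ
  have hac : (volume : Measure (Eu n)).map h.homeo ≪ volume :=
    (Measure.absolutelyContinuous_of_le hle).trans Measure.smul_absolutelyContinuous
  rw [← eLpNorm_map_measure (hf.mono_ac hac) h.homeo.measurable.aemeasurable]
  refine (eLpNorm_mono_measure f hle).trans_eq ?_
  rw [eLpNorm_smul_measure_of_ne_top hp, smul_eq_mul]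

theorem IsContractingField.eLpNorm_comp_symm_le_two_pow {F : Type*} [NormedAddCommGroup F]
    (h : IsContractingField V ℓ) {p : ℝ≥0∞} (hp : p ≠ ∞) {f : Eu n → F}
    (hf : AEStronglyMeasurable f volume) :
    eLpNorm (f ∘ h.homeo.symm) p volume ≤
      ((2 : ℝ≥0∞) ^ n) ^ (1 / p).toReal * eLpNorm f p volume := by
  refine (h.eLpNorm_comp_symm_le hp hf).trans ?_
  gcongr
  rw [ENNReal.ofReal_pow (by linarith [h.nonneg])]
  gcongr
  exact ENNReal.ofReal_le_of_le_toReal (by simp; linarith [h.lt_one])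

theorem IsContractingField.quasiMeasurePreserving (h : IsContractingField V ℓ) :
    Measure.QuasiMeasurePreserving h.homeo (volume : Measure (Eu n)) volume :=
  ⟨h.homeo.measurable, (Measure.absolutelyContinuous_of_le h.map_homeo_le).trans
    Measure.smul_absolutelyContinuous⟩

/-- The shift estimate for `C¹` functions: integrate the derivative along the segments
`[y, y + V y]`, and observe that each `y ↦ y + τ V y` distorts volumes by a bounded factor. -/
theorem IsContractingField.eLpNorm_comp_sub_le_of_contDiff (h : IsContractingField V ℓ)
    (hℓ : ℓ ≤ 1 / 2) (hp : 1 < p) {M : ℝ} (hM : ∀ x, ‖V x‖ ≤ M) {f : Eu n → ℝ}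
    (hf : ContDiff ℝ 1 f) :
    eLpNorm (f ∘ h.homeo - f) (ENNReal.ofReal p) volume ≤
      ((2 : ℝ≥0∞) ^ n) ^ p⁻¹ *
        (ENNReal.ofReal M * eLpNorm (gradient f) (ENNReal.ofReal p) volume) := by
  have p0 : 0 < p := by linarith
  have hp0 : ENNReal.ofReal p ≠ 0 := by simpa using p0
  have hp1 : (1 : ℝ≥0∞) ≤ ENNReal.ofReal p := by simpa using hp.le
  have htr : (ENNReal.ofReal p).toReal = p := ENNReal.toReal_ofReal p0.le
  have hG := continuous_gradient hf
  let ν : Measure ℝ := volume.restrict (Set.Ioc 0 1)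
  have : IsProbabilityMeasure ν := ⟨by simp [ν]⟩
  have hcont : Continuous fun q : Eu n × ℝ => gradient f (q.1 + q.2 • V q.1) :=
    hG.comp (continuous_fst.add (continuous_snd.smul (h.contDiff.continuous.comp continuous_fst)))
  have hpt : ∀ y, ‖(f ∘ h.homeo - f) y‖ₑ ^ p ≤
      ENNReal.ofReal M ^ p * ∫⁻ τ, ‖gradient f (y + τ • V y)‖ₑ ^ p ∂ν := by
    intro y
    have hcy : Continuous fun τ : ℝ => gradient f (y + τ • V y) :=
      hcont.comp (Continuous.prodMk_right y)
    have hd : ∀ τ : ℝ, HasDerivAt (fun τ : ℝ => f (y + τ • V y))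
        (inner ℝ (gradient f (y + τ • V y)) (V y)) τ := fun τ => by
      have h1 := (hf.differentiable one_ne_zero (y + τ • V y)).hasFDerivAt
      have h2 : HasDerivAt (fun τ : ℝ => y + τ • V y) (V y) τ := by
        simpa using ((hasDerivAt_id τ).smul_const (V y)).const_add y
      rw [gradient, InnerProductSpace.toDual_symm_apply]
      exact h1.comp_hasDerivAt τ h2
    have h1 : (f ∘ h.homeo - f) y = ∫ τ, (inner ℝ (gradient f (y + τ • V y)) (V y) : ℝ) ∂ν := by
      have := intervalIntegral.integral_eq_sub_of_hasDerivAt (a := 0) (b := 1)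
        (fun τ _ => hd τ) ((hcy.inner continuous_const).intervalIntegrable 0 1)
      rw [intervalIntegral.integral_of_le zero_le_one] at this
      rw [this]
      simp [h.homeo_apply]
    have h2 : ‖(f ∘ h.homeo - f) y‖ₑ ≤
        ENNReal.ofReal M * eLpNorm (fun τ => gradient f (y + τ • V y)) (ENNReal.ofReal p) ν := by
      rw [h1]
      calc _ ≤ ∫⁻ τ, ‖(inner ℝ (gradient f (y + τ • V y)) (V y) : ℝ)‖ₑ ∂ν :=
            enorm_integral_le_lintegral_enorm _
        _ ≤ ∫⁻ τ, ENNReal.ofReal M * ‖gradient f (y + τ • V y)‖ₑ ∂ν := by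
            refine lintegral_mono fun τ => ?_
            rw [← ofReal_norm, ← ofReal_norm, ← ENNReal.ofReal_mul ((norm_nonneg _).trans (hM y))]
            refine ENNReal.ofReal_le_ofReal ((norm_inner_le_norm _ _).trans ?_)
            rw [mul_comm]
            gcongr
            exact hM y
        _ = ENNReal.ofReal M * eLpNorm (fun τ => gradient f (y + τ • V y)) 1 ν := by
            rw [lintegral_const_mul' _ _ ENNReal.ofReal_ne_top, eLpNorm_one_eq_lintegral_enorm]
        _ ≤ _ := by
            gcongr
            exact eLpNorm_le_eLpNorm_of_exponent_le hp1 hcy.aestronglyMeasurable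
    calc _ ≤ (ENNReal.ofReal M *
          eLpNorm (fun τ => gradient f (y + τ • V y)) (ENNReal.ofReal p) ν) ^ p := by gcongr
      _ = _ := by
        rw [ENNReal.mul_rpow_of_nonneg _ _ p0.le,
          eLpNorm_eq_lintegral_rpow_enorm_toReal hp0 ENNReal.ofReal_ne_top, htr,
          ← ENNReal.rpow_mul, one_div, inv_mul_cancel₀ p0.ne', ENNReal.rpow_one]
  rw [eLpNorm_eq_lintegral_rpow_enorm_toReal hp0 ENNReal.ofReal_ne_top, htr, one_div,
    ENNReal.rpow_inv_le_iff p0, ENNReal.mul_rpow_of_nonneg _ _ p0.le, ← ENNReal.rpow_mul,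
    inv_mul_cancel₀ p0.ne', ENNReal.rpow_one, ENNReal.mul_rpow_of_nonneg _ _ p0.le,
    eLpNorm_eq_lintegral_rpow_enorm_toReal hp0 ENNReal.ofReal_ne_top, htr, one_div,
    ← ENNReal.rpow_mul, inv_mul_cancel₀ p0.ne', ENNReal.rpow_one]
  calc _ ≤ ∫⁻ y, ENNReal.ofReal M ^ p * ∫⁻ τ, ‖gradient f (y + τ • V y)‖ₑ ^ p ∂ν :=
        lintegral_mono hpt
    _ = ENNReal.ofReal M ^ p * ∫⁻ τ, ∫⁻ y, ‖gradient f (y + τ • V y)‖ₑ ^ p ∂volume ∂ν := by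
        rw [lintegral_const_mul' _ _ (ENNReal.rpow_ne_top_of_nonneg p0.le ENNReal.ofReal_ne_top),
          lintegral_lintegral_swap]
        simp only [Function.uncurry_def]
        exact (hcont.enorm.measurable.pow_const p).aemeasurable
    _ ≤ ENNReal.ofReal M ^ p * ∫⁻ τ, 2 ^ n * ∫⁻ y, ‖gradient f y‖ₑ ^ p ∂volume ∂ν := by
        gcongr 1
        refine setLIntegral_mono' measurableSet_Ioc fun τ hτ => ?_
        have hτ' := h.smul ⟨hτ.1.le, hτ.2⟩
        have hm : Measurable fun y => ‖gradient f y‖ₑ ^ p := hG.enorm.measurable.pow_const p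
        have e := lintegral_map (μ := volume) hm hτ'.homeo.measurable
        simp only [hτ'.homeo_apply] at e
        rw [← e, ← smul_eq_mul, ← lintegral_smul_measure]
        exact lintegral_mono' (hτ'.map_homeo_le_two_pow hℓ) le_rfl
    _ = _ := by
        rw [lintegral_const, measure_univ, mul_one]; ring

theorem IsContractingField.eLpNorm_comp_symm_sub_le (h : IsContractingField V ℓ) {p : ℝ≥0∞}
    (hp : p ≠ ∞) {u : Eu n → ℝ} (hu : AEStronglyMeasurable u volume) :
    eLpNorm (u ∘ h.homeo.symm - u) p volume ≤
      ((2 : ℝ≥0∞) ^ n) ^ (1 / p).toReal * eLpNorm (u ∘ h.homeo - u) p volume := by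
  have e : u ∘ h.homeo.symm - u = -((u ∘ h.homeo - u) ∘ h.homeo.symm) := by
    ext x; simp
  rw [e, eLpNorm_neg]
  exact h.eLpNorm_comp_symm_le_two_pow hp
    ((hu.comp_quasiMeasurePreserving h.quasiMeasurePreserving).sub hu)

theorem IsContractingField.eLpNorm_comp_sub_le_of_mem_W1p (h : IsContractingField V ℓ)
    (hℓ : ℓ ≤ 1 / 2) (hp : 1 < p) {M : ℝ} (hM : ∀ x, ‖V x‖ ≤ M) {u : Eu n → ℝ}
    (hu : u ∈ W1p n p) :
    eLpNorm (u ∘ h.homeo - u) (ENNReal.ofReal p) volume ≤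
      ((2 : ℝ≥0∞) ^ n) ^ p⁻¹ *
        (ENNReal.ofReal M * eLpNorm (weakGradient u) (ENNReal.ofReal p) volume) := by
  obtain ⟨huL, huG, hGL⟩ := hu
  have p0 : 0 < p := by linarith
  have hp1 : (1 : ℝ≥0∞) ≤ ENNReal.ofReal p := by simpa using hp.le
  have hloc := locallyIntegrable_of_memLp hp huL
  have hexp : (1 / ENNReal.ofReal p).toReal = p⁻¹ := by
    rw [one_div, ENNReal.toReal_inv, ENNReal.toReal_ofReal p0.le]
  set D : ℝ≥0∞ := ((2 : ℝ≥0∞) ^ n) ^ p⁻¹ with hD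
  have hDtop : D ≠ ∞ := ENNReal.rpow_ne_top_of_nonneg (by positivity)
    (ENNReal.pow_ne_top ENNReal.ofNat_ne_top)
  set P := ENNReal.ofReal p
  have hδ := tendsto_eLpNorm_mollify_sub (.id ℝ (Eu n)) hp.le huL
  have hδ' := tendsto_eLpNorm_mollify_sub (.id ℝ (Eu n)) hp.le hGL
  have key : ∀ k, eLpNorm (u ∘ h.homeo - u) P volume ≤
      D * eLpNorm (smooth u k - u) P volume +
      D * (ENNReal.ofReal M * (eLpNorm (mollify (.id ℝ (Eu n)) k (weakGradient u) - weakGradient u)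
        P volume + eLpNorm (weakGradient u) P volume)) +
      eLpNorm (smooth u k - u) P volume := by
    intro k
    have hsm : MemLp (smooth u k) P volume := memLp_mollify _ hp.le huL k
    have hdm := (hsm.sub huL).1
    have e : u ∘ h.homeo - u = (-((smooth u k - u) ∘ h.homeo) + (smooth u k ∘ h.homeo - smooth u k))
        + (smooth u k - u) := by
      ext x; simp
    have m1 := hdm.comp_quasiMeasurePreserving h.quasiMeasurePreserving
    have m2 := (hsm.1.comp_quasiMeasurePreserving h.quasiMeasurePreserving).sub hsm.1
    rw [e]
    refine (eLpNorm_add_le (m1.neg.add m2) hdm hp1).trans (add_le_add ?_ le_rfl)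
    refine (eLpNorm_add_le m1.neg m2 hp1).trans (add_le_add ?_ ?_)
    · rw [eLpNorm_neg, hD, ← hexp]
      exact h.eLpNorm_comp_le hℓ ENNReal.ofReal_ne_top hdm
    · refine (h.eLpNorm_comp_sub_le_of_contDiff hℓ hp hM (contDiff_smooth hloc k)).trans ?_
      rw [smooth, gradient_mollify k (weakGradient_spec huG)]
      gcongr
      have m3 := ((memLp_mollify (.id ℝ (Eu n)) hp.le hGL k).sub hGL).1
      simpa using eLpNorm_add_le m3 hGL.1 hp1
  have hlim := ((ENNReal.Tendsto.const_mul hδ (Or.inr hDtop)).add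
    (ENNReal.Tendsto.const_mul (ENNReal.Tendsto.const_mul (hδ'.add_const
      (eLpNorm (weakGradient u) P volume)) (Or.inr (ENNReal.ofReal_ne_top (r := M))))
      (Or.inr hDtop))).add hδ
  have := ge_of_tendsto' hlim key
  simpa using this

/-- Functions in `W^{1,p}` or in `C^{1,1}` are moved in `L^p` by a deformation of a fixed ball by at
most a multiple of its size. -/
theorem exists_eLpNorm_comp_symm_sub_le (hp : 1 < p) {u : Eu n → ℝ}
    (huL : MemLp u (ENNReal.ofReal p) volume) (hu : u ∈ W1p n p ∨ u ∈ C11 n) (R : ℝ) :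
    ∃ C : ℝ≥0∞, C ≠ ∞ ∧ ∀ (V : Eu n → Eu n) (ℓ : ℝ) (h : IsContractingField V ℓ), ℓ ≤ 1 / 2 →
      ∀ M : ℝ, (∀ x, ‖V x‖ ≤ M) → (∀ x, R ≤ ‖x‖ → V x = 0) →
        eLpNorm (u ∘ h.homeo.symm - u) (ENNReal.ofReal p) volume ≤ C * ENNReal.ofReal M := by
  have p0 : 0 < p := by linarith
  have hexp : (1 / ENNReal.ofReal p).toReal = p⁻¹ := by
    rw [one_div, ENNReal.toReal_inv, ENNReal.toReal_ofReal p0.le]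
  set D : ℝ≥0∞ := ((2 : ℝ≥0∞) ^ n) ^ p⁻¹ with hD
  have hDtop : D ≠ ∞ := ENNReal.rpow_ne_top_of_nonneg (by positivity)
    (ENNReal.pow_ne_top ENNReal.ofNat_ne_top)
  have hsymm : ∀ (V : Eu n → Eu n) (ℓ : ℝ) (h : IsContractingField V ℓ),
      eLpNorm (u ∘ h.homeo.symm - u) (ENNReal.ofReal p) volume ≤
        D * eLpNorm (u ∘ h.homeo - u) (ENNReal.ofReal p) volume := fun V ℓ h => by
    rw [hD, ← hexp]
    exact h.eLpNorm_comp_symm_sub_le ENNReal.ofReal_ne_top huL.1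
  rcases hu with hu | ⟨hC, -, ⟨M', hM'⟩, -⟩
  · refine ⟨D * (D * eLpNorm (weakGradient u) (ENNReal.ofReal p) volume),
      ENNReal.mul_ne_top hDtop (ENNReal.mul_ne_top hDtop hu.2.2.2.ne), fun V ℓ h hℓ M hM _ => ?_⟩
    refine (hsymm V ℓ h).trans ?_
    calc _ ≤ D * (D * (ENNReal.ofReal M *
          eLpNorm (weakGradient u) (ENNReal.ofReal p) volume)) := by
            gcongr; exact h.eLpNorm_comp_sub_le_of_mem_W1p hℓ hp hM hu
      _ = _ := by ring
  · have hM0 : 0 ≤ M' := (norm_nonneg _).trans (hM' 0)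
    set A : ℝ≥0∞ := volume (Metric.closedBall (0 : Eu n) R) ^ (1 / (ENNReal.ofReal p).toReal)
    have hA : A ≠ ∞ := ENNReal.rpow_ne_top_of_nonneg (by positivity) measure_closedBall_lt_top.ne
    refine ⟨D * (ENNReal.ofReal M' * A), ENNReal.mul_ne_top hDtop
      (ENNReal.mul_ne_top ENNReal.ofReal_ne_top hA), fun V ℓ h _ M hM hV => ?_⟩
    have hlip : ∀ x y, ‖u x - u y‖ ≤ M' * ‖x - y‖ := fun x y =>
      convex_univ.norm_image_sub_le_of_norm_fderiv_le (𝕜 := ℝ)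
        (fun _ _ => (hC.differentiable one_ne_zero).differentiableAt)
        (fun z _ => hM' z) (Set.mem_univ y) (Set.mem_univ x)
    have hMn : 0 ≤ M := (norm_nonneg _).trans (hM 0)
    have hb : eLpNorm (u ∘ h.homeo - u) (ENNReal.ofReal p) volume ≤
        eLpNorm ((Metric.closedBall (0 : Eu n) R).indicator fun _ => M' * M) (ENNReal.ofReal p)
          volume := by
      refine eLpNorm_mono_real fun x => ?_
      have h1 : ‖(u ∘ h.homeo - u) x‖ ≤ M' * ‖V x‖ := by
        simpa [h.homeo_apply] using hlip (h.homeo x) x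
      by_cases hx : x ∈ Metric.closedBall (0 : Eu n) R
      · rw [Set.indicator_of_mem hx]
        exact h1.trans (by gcongr; exact hM x)
      · rw [Set.indicator_of_notMem hx]
        rw [mem_closedBall_zero_iff, not_le] at hx
        rwa [hV x hx.le, norm_zero, mul_zero] at h1
    refine (hsymm V ℓ h).trans ?_
    calc _ ≤ D * (ENNReal.ofReal (M' * M) * A) := by
          gcongr
          refine hb.trans_eq ?_
          rw [eLpNorm_indicator_const measurableSet_closedBall (by simpa using p0)
            ENNReal.ofReal_ne_top, Real.enorm_of_nonneg (by positivity)]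
      _ = _ := by rw [ENNReal.ofReal_mul hM0]; ring

end Shift

/-! ### Taylor expansion of the potential -/

section Remainder

variable {E : Type*} [NormedAddCommGroup E] [NormedSpace ℝ E] {p : ℝ}

/-- The first order Taylor remainder of `g`. -/
noncomputable def taylorRemainder (g : E → ℝ) (a w : E) : ℝ := g (a + w) - g a - fderiv ℝ g a w

theorem abs_taylorRemainder_le (hp : 1 < p) {g : E → ℝ} (hg : Differentiable ℝ g) {C : ℝ}
    (hC0 : 0 ≤ C) (hC : ∀ a, ‖fderiv ℝ g a‖ ≤ C * ‖a‖ ^ (p - 1)) (a w : E) :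
    |taylorRemainder g a w| ≤ 2 * C * (‖a‖ + ‖w‖) ^ (p - 1) * ‖w‖ := by
  have hp1 : 0 ≤ p - 1 := by linarith
  have h1 : ‖g (a + w) - g a‖ ≤ C * (‖a‖ + ‖w‖) ^ (p - 1) * ‖(a + w) - a‖ := by
    refine (convex_closedBall (0 : E) (‖a‖ + ‖w‖)).norm_image_sub_le_of_norm_fderiv_le (𝕜 := ℝ)
      (fun x _ => hg x) (fun x hx => ?_) ?_ ?_
    · rw [mem_closedBall_zero_iff] at hx
      exact (hC x).trans (by gcongr)
    · rw [mem_closedBall_zero_iff]; linarith [norm_nonneg w]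
    · rw [mem_closedBall_zero_iff]; exact norm_add_le a w
  have h2 : ‖fderiv ℝ g a w‖ ≤ C * (‖a‖ + ‖w‖) ^ (p - 1) * ‖w‖ := by
    refine ((fderiv ℝ g a).le_of_opNorm_le (hC a) w).trans ?_
    gcongr
    linarith [norm_nonneg w]
  rw [add_sub_cancel_left] at h1
  have h3 := norm_sub_le (g (a + w) - g a) (fderiv ℝ g a w)
  rw [taylorRemainder, ← Real.norm_eq_abs]
  linarith

theorem tendsto_taylorRemainder_div {g : E → ℝ} (hg : Differentiable ℝ g) (a : E) {w : ℕ → E}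
    (hw : Tendsto w atTop (𝓝 0)) :
    Tendsto (fun j => taylorRemainder g a (w j) / ‖w j‖) atTop (𝓝 0) := by
  have h1 := (hasFDerivAt_iff_isLittleO_nhds_zero.1 (hg a).hasFDerivAt).comp_tendsto hw
  exact h1.norm_right.tendsto_div_nhds_zero

variable {Y : Type*} [MeasurableSpace Y] {μ : Measure Y}

/-- Superposition with `g` is differentiable on `L^p` along a summable sequence of increments: the
quotient `|remainder| / |w|` tends to zero almost everywhere and is dominated in `L^{p/(p-1)}`. -/
theorem exists_tendsto_taylorRemainder (hp : 1 < p) {g : E → ℝ} (hg : ContDiff ℝ 1 g) {C : ℝ}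
    (hC0 : 0 ≤ C) (hC : ∀ a, ‖fderiv ℝ g a‖ ≤ C * ‖a‖ ^ (p - 1)) {a : Y → E}
    (ha : MemLp a (ENNReal.ofReal p) μ) {w : ℕ → Y → E} (hw : ∀ j, AEStronglyMeasurable (w j) μ)
    (hsum : ∑' j, eLpNorm (w j) (ENNReal.ofReal p) μ ^ p ≠ ∞) :
    ∃ δ : ℕ → ℝ≥0∞, Tendsto δ atTop (𝓝 0) ∧ ∀ j,
      ∫⁻ y, ‖taylorRemainder g (a y) (w j y)‖ₑ ∂μ ≤
        δ j * eLpNorm (w j) (ENNReal.ofReal p) μ := by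
  have p0 : 0 < p := by linarith
  have hp1 : 0 < p - 1 := by linarith
  have hp0 : ENNReal.ofReal p ≠ 0 := by simpa using p0
  have htr : (ENNReal.ofReal p).toReal = p := ENNReal.toReal_ofReal p0.le
  set q := p / (p - 1) with hq
  have q0 : 0 < q := by positivity
  have hq0 : ENNReal.ofReal q ≠ 0 := by simpa using q0
  have htrq : (ENNReal.ofReal q).toReal = q := ENNReal.toReal_ofReal q0.le
  have hgd : Differentiable ℝ g := hg.differentiable one_ne_zero
  have hnorm : ∀ f : Y → E, eLpNorm f (ENNReal.ofReal p) μ ^ p = ∫⁻ y, ‖f y‖ₑ ^ p ∂μ := fun f => by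
    rw [eLpNorm_eq_lintegral_rpow_enorm_toReal hp0 ENNReal.ofReal_ne_top, htr,
      ← ENNReal.rpow_mul, one_div, inv_mul_cancel₀ p0.ne', ENNReal.rpow_one]
  have hmw : ∀ j, AEMeasurable (fun y => ‖w j y‖ₑ ^ p) μ := fun j => (hw j).enorm.pow_const p
  simp only [hnorm] at hsum
  rw [← lintegral_tsum hmw] at hsum
  have hDm : AEMeasurable (fun y => ∑' j, ‖w j y‖ₑ ^ p) μ := AEMeasurable.tsum hmw
  -- the increments tend to zero almost everywhere
  have hae : ∀ᵐ y ∂μ, Tendsto (fun j => w j y) atTop (𝓝 0) := by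
    filter_upwards [ae_lt_top' hDm hsum] with y hy
    have h1 := (ENNReal.tendsto_atTop_zero_of_tsum_ne_top hy.ne).ennrpow_const p⁻¹
    rw [ENNReal.zero_rpow_of_pos (by positivity)] at h1
    simp only [← ENNReal.rpow_mul, mul_inv_cancel₀ p0.ne', ENNReal.rpow_one] at h1
    rw [tendsto_iff_edist_tendsto_0]
    simpa [edist_zero_right] using h1
  let m : ℕ → Y → ℝ := fun j y => taylorRemainder g (a y) (w j y) / ‖w j y‖
  have hrm : ∀ j, AEStronglyMeasurable (fun y => taylorRemainder g (a y) (w j y)) μ := by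
    intro j
    have hc : Continuous fun x : E × E => taylorRemainder g x.1 x.2 := by
      have h1 : Continuous fun x : E × E => fderiv ℝ g x.1 x.2 :=
        ((hg.continuous_fderiv one_ne_zero).comp continuous_fst).clm_apply continuous_snd
      exact ((hg.continuous.comp (continuous_fst.add continuous_snd)).sub
        (hg.continuous.comp continuous_fst)).sub h1
    exact hc.comp_aestronglyMeasurable (ha.1.prodMk (hw j))
  have hmm : ∀ j, AEStronglyMeasurable (m j) μ := fun j =>
    ((hrm j).aemeasurable.div (hw j).norm.aemeasurable).aestronglyMeasurable
  have hmb : ∀ j y, ‖m j y‖ₑ ^ q ≤ ENNReal.ofReal (2 * C) ^ q * ((2 : ℝ≥0∞) ^ (p - 1) *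
      (‖a y‖ₑ ^ p + ∑' j, ‖w j y‖ₑ ^ p)) := by
    intro j y
    have h1 : ‖m j y‖ ≤ 2 * C * (‖a y‖ + ‖w j y‖) ^ (p - 1) := by
      rcases (norm_nonneg (w j y)).eq_or_lt with h0 | h0
      · simp only [m, ← h0, div_zero, norm_zero]; positivity
      · simp only [m, norm_div, norm_norm]
        rw [div_le_iff₀ h0]
        exact abs_taylorRemainder_le hp hgd hC0 hC _ _
    have h2 : ‖m j y‖ₑ ≤ ENNReal.ofReal (2 * C) * (‖a y‖ₑ + ‖w j y‖ₑ) ^ (p - 1) := by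
      rw [← ofReal_norm, ← ofReal_norm, ← ofReal_norm,
        ← ENNReal.ofReal_add (norm_nonneg _) (norm_nonneg _),
        ENNReal.ofReal_rpow_of_nonneg (by positivity) hp1.le,
        ← ENNReal.ofReal_mul (by positivity)]
      exact ENNReal.ofReal_le_ofReal h1
    calc ‖m j y‖ₑ ^ q ≤ (ENNReal.ofReal (2 * C) * (‖a y‖ₑ + ‖w j y‖ₑ) ^ (p - 1)) ^ q := by gcongr
      _ = ENNReal.ofReal (2 * C) ^ q * (‖a y‖ₑ + ‖w j y‖ₑ) ^ p := by
          rw [ENNReal.mul_rpow_of_nonneg _ _ q0.le, ← ENNReal.rpow_mul, hq,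
            mul_div_cancel₀ _ hp1.ne']
      _ ≤ ENNReal.ofReal (2 * C) ^ q * ((2 : ℝ≥0∞) ^ (p - 1) * (‖a y‖ₑ ^ p + ‖w j y‖ₑ ^ p)) := by
          gcongr
          exact ENNReal.rpow_add_le_mul_rpow_add_rpow _ _ hp.le
      _ ≤ _ := by
          gcongr
          exact ENNReal.le_tsum j
  have hlim : Tendsto (fun j => ∫⁻ y, ‖m j y‖ₑ ^ q ∂μ) atTop (𝓝 0) := by
    have := tendsto_lintegral_of_dominated_convergence' (μ := μ) (f := fun _ => 0)
      (F := fun j y => ‖m j y‖ₑ ^ q)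
      (fun y => ENNReal.ofReal (2 * C) ^ q * ((2 : ℝ≥0∞) ^ (p - 1) *
        (‖a y‖ₑ ^ p + ∑' j, ‖w j y‖ₑ ^ p))) (fun j => (hmm j).enorm.pow_const q)
      (fun j => Eventually.of_forall (hmb j)) ?_ ?_
    · simpa using this
    · rw [lintegral_const_mul' _ _ (ENNReal.rpow_ne_top_of_nonneg q0.le ENNReal.ofReal_ne_top),
        lintegral_const_mul' _ _ (ENNReal.rpow_ne_top_of_nonneg hp1.le ENNReal.ofNat_ne_top),
        lintegral_add_right' _ hDm]
      refine ENNReal.mul_ne_top (ENNReal.rpow_ne_top_of_nonneg q0.le ENNReal.ofReal_ne_top)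
        (ENNReal.mul_ne_top (ENNReal.rpow_ne_top_of_nonneg hp1.le ENNReal.ofNat_ne_top)
          (ENNReal.add_ne_top.2 ⟨?_, hsum⟩))
      rw [← hnorm]
      exact ENNReal.rpow_ne_top_of_nonneg p0.le ha.2.ne
    · filter_upwards [hae] with y hy
      have h1 := (continuous_enorm.tendsto _).comp (tendsto_taylorRemainder_div hgd (a y) hy)
      have h2 := h1.ennrpow_const q
      simpa [ENNReal.zero_rpow_of_pos q0] using h2
  refine ⟨fun j => eLpNorm (m j) (ENNReal.ofReal q) μ, ?_, fun j => ?_⟩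
  · have h1 := hlim.ennrpow_const q⁻¹
    rw [ENNReal.zero_rpow_of_pos (by positivity)] at h1
    refine h1.congr fun j => ?_
    rw [eLpNorm_eq_lintegral_rpow_enorm_toReal hq0 ENNReal.ofReal_ne_top, htrq, one_div]
  · have hh := eLpNorm_inner_le hp (hmm j) (hw j).norm
    rw [eLpNorm_one_eq_lintegral_enorm, eLpNorm_norm] at hh
    refine le_trans (lintegral_mono fun y => le_of_eq ?_) hh
    have : taylorRemainder g (a y) (w j y) = m j y * ‖w j y‖ := by
      by_cases h0 : w j y = 0
      · simp [h0, taylorRemainder]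
      · rw [div_mul_cancel₀ _ (norm_ne_zero_iff.2 h0)]
    rw [this]
    simp [mul_comm]

end Remainder

/-! ### Domain variation for one equation -/

section Variation

variable {n : ℕ} {V : Eu n → Eu n} {ℓ p s α β : ℝ} {H : Eu n → ℝ}

/-- The properties of the functions in `X_{α,β}` on which the identity rests: finite energies for
those terms of the equation which are present, and a regularity which bounds the `L^p` effect of
deformations of compact sets. -/
structure IsAdmissible (s p α β : ℝ) (u : Eu n → ℝ) : Prop where
  memLp : MemLp u (ENNReal.ofReal p) volume
  local_term : α = 0 ∨ 0 ≤ α ∧ u ∈ W1p n p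
  nonlocal_term : β = 0 ∨ 0 ≤ β ∧ u ∈ Wsp n s p
  regular : u ∈ W1p n p ∨ u ∈ C11 n

theorem isAdmissible_of_mem_X {u : Eu n → ℝ} (hu : u ∈ X n s p α β) :
    IsAdmissible s p α β u := by
  rcases hu with ⟨rfl, rfl, h⟩ | ⟨rfl, hβ, ⟨h, h'⟩, -⟩ | ⟨rfl, rfl, ⟨h, h'⟩ | ⟨h, h'⟩⟩
  · exact ⟨h.1, Or.inr ⟨zero_le_one, h⟩, Or.inl rfl, Or.inl h⟩
  · exact ⟨h.1, Or.inr ⟨zero_le_one, h⟩, Or.inr ⟨hβ.le, h'⟩, Or.inl h⟩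
  · exact ⟨h.1, Or.inl rfl, Or.inr ⟨zero_le_one, h⟩, Or.inr h'⟩
  · exact ⟨h.1, Or.inl rfl, Or.inr ⟨zero_le_one, h'⟩, Or.inl h⟩

theorem tendsto_eLpNorm_testFunction_sub (h : IsContractingField V ℓ) (hp : 1 < p)
    {u : Eu n → ℝ} (hu : MemLp u (ENNReal.ofReal p) volume) :
    Tendsto (fun k => eLpNorm (testFunction h u k - (u ∘ h.homeo.symm - u)) (ENNReal.ofReal p)
      volume) atTop (𝓝 0) := by
  have hδ := tendsto_eLpNorm_mollify_sub (.id ℝ (Eu n)) hp.le hu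
  have hp1 : (1 : ℝ≥0∞) ≤ ENNReal.ofReal p := by simpa using hp.le
  set D : ℝ≥0∞ := ((2 : ℝ≥0∞) ^ n) ^ (1 / ENNReal.ofReal p).toReal with hD
  have hDtop : D ≠ ∞ := ENNReal.rpow_ne_top_of_nonneg (by positivity)
    (ENNReal.pow_ne_top ENNReal.ofNat_ne_top)
  have hlim := (ENNReal.Tendsto.const_mul hδ (Or.inr hDtop)).add hδ
  rw [mul_zero, add_zero] at hlim
  refine tendsto_of_tendsto_of_tendsto_of_le_of_le tendsto_const_nhds hlim (fun _ => zero_le)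
    fun k => ?_
  have hm := ((memLp_mollify (.id ℝ (Eu n)) hp.le hu k).sub hu).1
  have e : testFunction h u k - (u ∘ h.homeo.symm - u) =
      (smooth u k - u) ∘ h.homeo.symm - (smooth u k - u) := by
    ext x; simp [testFunction]; ring
  rw [e]
  exact (eLpNorm_sub_le (hm.comp_quasiMeasurePreserving h.quasiMeasurePreserving_symm) hm
    hp1).trans (add_le_add (h.eLpNorm_comp_symm_le_two_pow ENNReal.ofReal_ne_top hm) le_rfl)

/-- Domain variation for one equation with right-hand side `f`: by convexity, testing with the
variation `u ∘ S⁻¹ - u` gives at most the change in energy. -/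
theorem integral_mul_variation_le (h : IsContractingField V ℓ) (hVc : HasCompactSupport V)
    (hs : 0 < s) (hp : 1 < p)
    (hH : IsFinslerMinkowski H) {c : ℝ} (hc : ∀ x y, ‖x‖ ≤ ℓ * ‖y‖ → H x ≤ c * ℓ * H y)
    (hcl : c * ℓ < 1) {R t : ℝ} (ht : |t| < 1)
    (hV : ∀ x ∈ Metric.ball (0 : Eu n) R, V x = t • x)
    (hV' : ∀ x ∈ Metric.ball (0 : Eu n) R, fderiv ℝ V x = t • .id ℝ (Eu n))
    {u f : Eu n → ℝ} (hu : IsAdmissible s p α β u)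
    (hf : MemLp f (ENNReal.ofReal (p / (p - 1))) volume)
    (heq : ∀ φ : Eu n → ℝ, ContDiff ℝ 1 φ → HasCompactSupport φ →
      weakForm H s p α β u φ = ∫ x, f x * φ x) :
    ∫ x, f x * (u (h.homeo.symm x) - u x) ≤
      α * ((((1 + t) ^ (n - p) - 1) *
          (∫ x in Metric.ball (0 : Eu n) R, H (weakGradient u x) ^ p) +
        ((1 + ℓ) ^ n * (1 - c * ℓ) ^ (-p) - 1) *
          (∫ x in (Metric.ball (0 : Eu n) R)ᶜ, H (weakGradient u x) ^ p)) / p) +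
      β * ((((1 + t) ^ (n - s * p) - 1) *
          (∫ z in Metric.ball (0 : Eu n) R ×ˢ Metric.ball (0 : Eu n) R,
            |diffQuot s p u z| ^ p ∂((volume : Measure (Eu n)).prod volume)) +
        ((1 + ℓ) ^ (2 * n) * (1 - ℓ) ^ (-(n + s * p)) - 1) *
          (∫ z in (Metric.ball (0 : Eu n) R ×ˢ Metric.ball (0 : Eu n) R)ᶜ,
            |diffQuot s p u z| ^ p ∂((volume : Measure (Eu n)).prod volume))) / p) := by
  have p0 : 0 < p := by linarith
  have hloc := locallyIntegrable_of_memLp hp hu.memLp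
  obtain ⟨U, hU, hUlim⟩ : ∃ U : ℕ → ℝ, (∀ k, α * (∫ x, H (weakGradient u x) ^ (p - 1) *
        inner ℝ (gradient H (weakGradient u x)) (gradient (testFunction h u k) x)) ≤ U k) ∧
      Tendsto U atTop (𝓝 (α * ((((1 + t) ^ (n - p) - 1) *
          (∫ x in Metric.ball (0 : Eu n) R, H (weakGradient u x) ^ p) +
        ((1 + ℓ) ^ n * (1 - c * ℓ) ^ (-p) - 1) *
          (∫ x in (Metric.ball (0 : Eu n) R)ᶜ, H (weakGradient u x) ^ p)) / p))) := by
    rcases hu.local_term with rfl | ⟨hα, huW⟩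
    · exact ⟨fun _ => 0, fun k => by simp, by simp⟩
    · obtain ⟨U, hU, hlim⟩ := exists_tendsto_local_variation h hp hH hc hcl ht hV' huW
      refine ⟨fun k => α * U k, fun k => mul_le_mul_of_nonneg_left (hU k) hα, ?_⟩
      convert hlim.const_mul α using 4
      obtain ⟨K, hK⟩ := hH.exists_lipschitzWith
      rw [anisoEnergy, ← integral_add_compl
        (Metric.isOpen_ball (x := (0 : Eu n)) (ε := R)).measurableSet
        (integrable_gauge_rpow hp hK hH.map_zero hH.nonneg huW.2.2)]
      ring
  obtain ⟨W, hW, hWlim⟩ : ∃ W : ℕ → ℝ, (∀ k, β * (∫ z : Eu n × Eu n, J p (u z.1 - u z.2) *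
        (testFunction h u k z.1 - testFunction h u k z.2) / ‖z.1 - z.2‖ ^ (n + s * p)
          ∂(volume.prod volume)) ≤ W k) ∧
      Tendsto W atTop (𝓝 (β * ((((1 + t) ^ (n - s * p) - 1) *
          (∫ z in Metric.ball (0 : Eu n) R ×ˢ Metric.ball (0 : Eu n) R,
            |diffQuot s p u z| ^ p ∂((volume : Measure (Eu n)).prod volume)) +
        ((1 + ℓ) ^ (2 * n) * (1 - ℓ) ^ (-(n + s * p)) - 1) *
          (∫ z in (Metric.ball (0 : Eu n) R ×ˢ Metric.ball (0 : Eu n) R)ᶜ,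
            |diffQuot s p u z| ^ p ∂((volume : Measure (Eu n)).prod volume))) / p))) := by
    rcases hu.nonlocal_term with rfl | ⟨hβ, huW⟩
    · exact ⟨fun _ => 0, fun k => by simp, by simp⟩
    · obtain ⟨W, hW, hlim⟩ := exists_tendsto_nonlocal_variation h hs hp ht hV hV' huW
      refine ⟨fun k => β * W k, fun k => mul_le_mul_of_nonneg_left (hW k) hβ, ?_⟩
      convert hlim.const_mul β using 4
      have hg : gagliardo s p u = ∫ z, |diffQuot s p u z| ^ p ∂(volume.prod volume) := by
        simp only [gagliardo, abs_diffQuot_rpow p0]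
      rw [hg, ← integral_add_compl
        ((Metric.isOpen_ball (x := (0 : Eu n)) (ε := R)).measurableSet.prod
        (Metric.isOpen_ball (x := (0 : Eu n)) (ε := R)).measurableSet)
        (integrable_gauge_rpow hp (N := fun r : ℝ => |r|) lipschitzWith_one_norm abs_zero abs_nonneg
          (memLp_diffQuot huW))]
      ring
  have hT : ∀ k, MemLp (testFunction h u k) (ENNReal.ofReal p) volume := fun k =>
    (contDiff_testFunction h hloc k).continuous.memLp_of_hasCompactSupport
      (hasCompactSupport_testFunction h hVc u k)
  have hS : MemLp (u ∘ h.homeo.symm - u) (ENNReal.ofReal p) volume :=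
    (h.memLp_comp_symm ENNReal.ofReal_ne_top hu.memLp).sub hu.memLp
  have hlim := tendsto_integral_inner hp hf hS hT (tendsto_eLpNorm_testFunction_sub h hp hu.memLp)
  have e : ∫ x, f x * (u (h.homeo.symm x) - u x) =
      ∫ x, (inner ℝ (f x) ((u ∘ h.homeo.symm - u) x) : ℝ) := by
    simp [mul_comm]
  rw [e]
  refine le_of_tendsto_of_tendsto' hlim (hUlim.add hWlim) fun k => ?_
  have e2 : ∫ x, (inner ℝ (f x) (testFunction h u k x) : ℝ) = ∫ x, f x * testFunction h u k x := by
    simp [mul_comm]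
  rw [e2, ← heq _ (contDiff_testFunction h hloc k) (hasCompactSupport_testFunction h hVc u k),
    weakForm]
  exact add_le_add (hU k) (hW k)

/-- The effect of the change of variables on the integral of the potential. -/
theorem le_integral_comp_symm_sub (h : IsContractingField V ℓ) {R t : ℝ} (ht : |t| < 1)
    (hV' : ∀ x ∈ Metric.ball (0 : Eu n) R, fderiv ℝ V x = t • .id ℝ (Eu n))
    {f : Eu n → ℝ} (hf : Integrable f volume) :
    ((1 + t) ^ n - 1) * (∫ x in Metric.ball (0 : Eu n) R, f x) -
      ((1 + ℓ) ^ n - (1 - ℓ) ^ n) * (∫ x in (Metric.ball (0 : Eu n) R)ᶜ, |f x|) ≤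
      (∫ x, f (h.homeo.symm x)) - ∫ x, f x := by
  have hB := (Metric.isOpen_ball (x := (0 : Eu n)) (ε := R)).measurableSet
  have ht1 : 0 < 1 + t := by linarith [(abs_lt.1 ht).1]
  have hi : Integrable (fun y => h.jac y * f y) volume :=
    hf.bdd_mul h.measurable_jac.aestronglyMeasurable (c := (1 + ℓ) ^ n)
      (Eventually.of_forall fun y => by
        rw [Real.norm_of_nonneg (h.jac_nonneg y)]; exact h.jac_le y)
  have e : (∫ x, f (h.homeo.symm x)) = ∫ y, h.jac y * f y := by
    rw [h.integral_eq]; simp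
  have hsub : Integrable (fun y => h.jac y * f y - f y) volume := hi.sub hf
  rw [e, ← integral_sub hi hf, ← integral_add_compl hB hsub, sub_eq_add_neg]
  refine add_le_add (le_of_eq ?_) ?_
  · rw [← integral_const_mul]
    refine setIntegral_congr_fun hB fun x hx => ?_
    simp only [h.jac_eq_of_fderiv_eq (hV' x hx), abs_of_pos ht1]
    ring
  · rw [← integral_const_mul, ← integral_neg]
    refine integral_mono (hf.abs.integrableOn.const_mul _).neg hsub.integrableOn fun x => ?_
    have h1 := h.jac_le x
    have h2 := h.le_jac x
    have h3 : (1 : ℝ) ≤ (1 + ℓ) ^ n := one_le_pow₀ (by linarith [h.nonneg])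
    have h4 : (1 - ℓ) ^ n ≤ 1 := pow_le_one₀ (by linarith [h.lt_one]) (by linarith [h.nonneg])
    have h5 : |h.jac x - 1| ≤ (1 + ℓ) ^ n - (1 - ℓ) ^ n := abs_le.2 ⟨by linarith, by linarith⟩
    have h6 := neg_abs_le ((h.jac x - 1) * f x)
    rw [abs_mul] at h6
    have h7 := mul_le_mul_of_nonneg_right h5 (abs_nonneg (f x))
    change -(((1 + ℓ) ^ n - (1 - ℓ) ^ n) * |f x|) ≤ h.jac x * f x - f x
    linarith

end Variation

/-! ### The potential and its partial derivatives -/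

section Potential

variable {p : ℝ} {g : ℝ × ℝ → ℝ}

theorem fderiv_apply_eq_partial (hg : ContDiff ℝ 1 g) (a w : ℝ × ℝ) :
    fderiv ℝ g a w = partialFst g a.1 a.2 * w.1 + partialSnd g a.1 a.2 * w.2 := by
  have hd : HasFDerivAt g (fderiv ℝ g a) (a.1, a.2) :=
    (hg.differentiable one_ne_zero a).hasFDerivAt
  have h1 : HasDerivAt (fun τ : ℝ => g (τ, a.2)) (fderiv ℝ g a (1, 0)) a.1 :=
    hd.comp_hasDerivAt a.1 ((hasDerivAt_id a.1).prodMk (hasDerivAt_const a.1 a.2))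
  have h2 : HasDerivAt (fun ρ : ℝ => g (a.1, ρ)) (fderiv ℝ g a (0, 1)) a.2 :=
    hd.comp_hasDerivAt a.2 ((hasDerivAt_const a.2 a.1).prodMk (hasDerivAt_id a.2))
  have h3 : w = w.1 • ((1 : ℝ), (0 : ℝ)) + w.2 • ((0 : ℝ), (1 : ℝ)) := by ext <;> simp
  rw [partialFst, partialSnd, h1.deriv, h2.deriv]
  conv_lhs => rw [h3, map_add, map_smul, map_smul]
  simp [mul_comm]

theorem continuous_partialFst (hg : ContDiff ℝ 1 g) :
    Continuous fun a : ℝ × ℝ => partialFst g a.1 a.2 := by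
  have h : Continuous fun a : ℝ × ℝ => fderiv ℝ g a (1, 0) :=
    (hg.continuous_fderiv one_ne_zero).clm_apply continuous_const
  simpa [fderiv_apply_eq_partial hg] using h

theorem continuous_partialSnd (hg : ContDiff ℝ 1 g) :
    Continuous fun a : ℝ × ℝ => partialSnd g a.1 a.2 := by
  have h : Continuous fun a : ℝ × ℝ => fderiv ℝ g a (0, 1) :=
    (hg.continuous_fderiv one_ne_zero).clm_apply continuous_const
  simpa [fderiv_apply_eq_partial hg] using h

theorem partial_growth (hp : 1 < p) {C : ℝ} (hC0 : 0 < C)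
    (hC : ∀ t r : ℝ, |partialFst g t r| + |partialSnd g t r| ≤
      C * (|t| ^ (p - 1) + |r| ^ (p - 1))) (a : ℝ × ℝ) :
    |partialFst g a.1 a.2| + |partialSnd g a.1 a.2| ≤ 2 * C * ‖a‖ ^ (p - 1) := by
  have hp1 : 0 ≤ p - 1 := by linarith
  have h1 : |a.1| ^ (p - 1) ≤ ‖a‖ ^ (p - 1) :=
    Real.rpow_le_rpow (abs_nonneg _) (norm_fst_le a) hp1
  have h2 : |a.2| ^ (p - 1) ≤ ‖a‖ ^ (p - 1) :=
    Real.rpow_le_rpow (abs_nonneg _) (norm_snd_le a) hp1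
  refine (hC a.1 a.2).trans ?_
  calc C * (|a.1| ^ (p - 1) + |a.2| ^ (p - 1)) ≤ C * (‖a‖ ^ (p - 1) + ‖a‖ ^ (p - 1)) := by gcongr
    _ = _ := by ring

theorem norm_fderiv_le_of_partial_growth (hp : 1 < p) (hg : ContDiff ℝ 1 g) {C : ℝ} (hC0 : 0 < C)
    (hC : ∀ t r : ℝ, |partialFst g t r| + |partialSnd g t r| ≤
      C * (|t| ^ (p - 1) + |r| ^ (p - 1))) (a : ℝ × ℝ) :
    ‖fderiv ℝ g a‖ ≤ 2 * C * ‖a‖ ^ (p - 1) := by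
  refine ContinuousLinearMap.opNorm_le_bound _ (by positivity) fun w => ?_
  rw [fderiv_apply_eq_partial hg]
  calc _ ≤ |partialFst g a.1 a.2| * |w.1| + |partialSnd g a.1 a.2| * |w.2| := by
        rw [← abs_mul, ← abs_mul]; exact abs_add_le _ _
    _ ≤ |partialFst g a.1 a.2| * ‖w‖ + |partialSnd g a.1 a.2| * ‖w‖ := by
        gcongr
        · exact norm_fst_le w
        · exact norm_snd_le w
    _ = (|partialFst g a.1 a.2| + |partialSnd g a.1 a.2|) * ‖w‖ := by ring
    _ ≤ _ := by gcongr; exact partial_growth hp hC0 hC a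

theorem memLp_pair {Y : Type*} [MeasurableSpace Y] {μ : Measure Y} {q : ℝ≥0∞} {u v : Y → ℝ}
    (hu : MemLp u q μ) (hv : MemLp v q μ) : MemLp (fun y => (u y, v y)) q μ := by
  refine (hu.norm.add hv.norm).of_le (hu.1.prodMk hv.1) (Eventually.of_forall fun y => ?_)
  rw [Real.norm_of_nonneg (by simp only [Pi.add_apply]; positivity)]
  exact max_le (le_add_of_nonneg_right (norm_nonneg _)) (le_add_of_nonneg_left (norm_nonneg _))

theorem eLpNorm_pair_le {Y : Type*} [MeasurableSpace Y] {μ : Measure Y} {q : ℝ≥0∞} (hq : 1 ≤ q)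
    {u v : Y → ℝ} (hu : AEStronglyMeasurable u μ) (hv : AEStronglyMeasurable v μ) :
    eLpNorm (fun y => (u y, v y)) q μ ≤ eLpNorm u q μ + eLpNorm v q μ := by
  have h := eLpNorm_add_le hu.norm hv.norm hq
  rw [eLpNorm_norm, eLpNorm_norm] at h
  refine le_trans (eLpNorm_mono_real fun y => ?_) h
  exact max_le (le_add_of_nonneg_right (norm_nonneg _)) (le_add_of_nonneg_left (norm_nonneg _))

theorem tendsto_div_of_hasDerivAt {κ : ℝ → ℝ} {κ' : ℝ} (h : HasDerivAt κ κ' 0) {t : ℕ → ℝ}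
    (ht : Tendsto t atTop (𝓝 0)) (h0 : ∀ j, t j ≠ 0) :
    Tendsto (fun j => (κ (t j) - κ 0) / t j) atTop (𝓝 κ') := by
  have h1 := (hasDerivAt_iff_tendsto_slope_zero.1 h).comp
    (tendsto_nhdsWithin_iff.2 ⟨ht, Eventually.of_forall fun j => h0 j⟩)
  refine h1.congr fun j => ?_
  simp [div_eq_inv_mul]

end Potential

/-! ### The identity on a ball -/

section Ball

variable {n : ℕ} {p s α β : ℝ} {H : Eu n → ℝ} {g : ℝ × ℝ → ℝ} {u v : Eu n → ℝ}

/-- The anisotropic energy of `u` on the set `A`. -/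
noncomputable def energyOn (H : Eu n → ℝ) (p : ℝ) (u : Eu n → ℝ) (A : Set (Eu n)) : ℝ :=
  ∫ x in A, H (weakGradient u x) ^ p

/-- The Gagliardo energy of `u` on the set `A` of pairs. -/
noncomputable def gagliardoOn (s p : ℝ) (u : Eu n → ℝ) (A : Set (Eu n × Eu n)) : ℝ :=
  ∫ z in A, |diffQuot s p u z| ^ p ∂((volume : Measure (Eu n)).prod volume)

/-- The identity on a ball, with an error controlled by the energies and the potential outside the
ball: differentiate the domain variation at `t = 0` from the right (`σ = 1`) or from the left
(`σ = -1`).  The constants `K₁`, `K₂`, `K₃` do not depend on the radius. -/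
theorem pohozaev_ball_le (hs : 0 < s) (hp : 1 < p) (hH : IsFinslerMinkowski H) {c : ℝ}
    (hc0 : 0 ≤ c) (hc : ∀ ℓ : ℝ, 0 ≤ ℓ → ∀ x y, ‖x‖ ≤ ℓ * ‖y‖ → H x ≤ c * ℓ * H y) {L : ℝ}
    (hL0 : 0 < L) (hL : ∀ R : ℝ, 0 < R → ∀ t : ℝ, |t| * L < 1 →
      IsContractingField (dilationField n R t) (|t| * L))
    (hg : ContDiff ℝ 1 g) {C : ℝ} (hC0 : 0 < C)
    (hC : ∀ t r : ℝ, |partialFst g t r| + |partialSnd g t r| ≤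
      C * (|t| ^ (p - 1) + |r| ^ (p - 1)))
    (hu : IsAdmissible s p α β u) (hv : IsAdmissible s p α β v)
    (hequ : ∀ φ : Eu n → ℝ, ContDiff ℝ 1 φ → HasCompactSupport φ →
      weakForm H s p α β u φ = ∫ x, partialFst g (u x) (v x) * φ x)
    (heqv : ∀ φ : Eu n → ℝ, ContDiff ℝ 1 φ → HasCompactSupport φ →
      weakForm H s p α β v φ = ∫ x, partialSnd g (u x) (v x) * φ x)
    (hint : Integrable (fun x => g (u x, v x)) volume) {K₁ K₂ K₃ : ℝ}
    (h1 : HasDerivAt (fun x : ℝ => (1 + x * L) ^ n * (1 - c * (x * L)) ^ (-p)) K₁ 0)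
    (h2 : HasDerivAt (fun x : ℝ => (1 + x * L) ^ (2 * n) * (1 - x * L) ^ (-(n + s * p))) K₂ 0)
    (h3 : HasDerivAt (fun x : ℝ => (1 + x * L) ^ n - (1 - x * L) ^ n) K₃ 0)
    {σ : ℝ} (hσ : |σ| = 1) {R : ℝ} (hR : 0 < R) :
    σ * n * (∫ x in Metric.ball (0 : Eu n) R, g (u x, v x)) -
      K₃ * (∫ x in (Metric.ball (0 : Eu n) R)ᶜ, |g (u x, v x)|) ≤
    α * ((σ * (n - p) * energyOn H p u (Metric.ball 0 R) +
        K₁ * energyOn H p u (Metric.ball 0 R)ᶜ) / p) +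
      β * ((σ * (n - s * p) * gagliardoOn s p u (Metric.ball 0 R ×ˢ Metric.ball 0 R) +
        K₂ * gagliardoOn s p u (Metric.ball 0 R ×ˢ Metric.ball 0 R)ᶜ) / p) +
    (α * ((σ * (n - p) * energyOn H p v (Metric.ball 0 R) +
        K₁ * energyOn H p v (Metric.ball 0 R)ᶜ) / p) +
      β * ((σ * (n - s * p) * gagliardoOn s p v (Metric.ball 0 R ×ˢ Metric.ball 0 R) +
        K₂ * gagliardoOn s p v (Metric.ball 0 R ×ˢ Metric.ball 0 R)ᶜ) / p)) := by
  have hp1 : (1 : ℝ≥0∞) ≤ ENNReal.ofReal p := by simpa using hp.le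
  have hσ0 : σ ≠ 0 := by intro h; simp [h] at hσ
  -- for `|t| ≤ τ₀` each of `|t|`, `|t| L` and `c |t| L` is at most `1 / 2`
  set τ₀ : ℝ := 1 / (2 * (1 + L + c * L)) with hτ₀
  have hcL : 0 ≤ c * L := by positivity
  have hτ₀0 : 0 < τ₀ := by positivity
  have hτ₀1 : τ₀ * (1 + L + c * L) = 1 / 2 := by rw [hτ₀]; field_simp
  -- the parameters of the deformation, small and summable
  set τ : ℕ → ℝ := fun j => τ₀ * (1 / 2) ^ j with hτ
  have hτ0 : ∀ j, 0 < τ j := fun j => by positivity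
  have hτle : ∀ j, τ j ≤ τ₀ := fun j =>
    mul_le_of_le_one_right hτ₀0.le (pow_le_one₀ (by norm_num) (by norm_num))
  have hτlim : Tendsto τ atTop (𝓝 0) := by
    simpa [hτ] using (tendsto_pow_atTop_nhds_zero_of_lt_one (r := (1 / 2 : ℝ)) (by norm_num)
      (by norm_num)).const_mul τ₀
  have ht : ∀ j, |σ * τ j| = τ j := fun j => by rw [abs_mul, hσ, one_mul, abs_of_pos (hτ0 j)]
  have htL : ∀ j, |σ * τ j| * L ≤ 1 / 2 := fun j => by
    rw [ht]; nlinarith [mul_le_mul_of_nonneg_right (hτle j) hL0.le]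
  have htc : ∀ j, c * (|σ * τ j| * L) < 1 := fun j => by
    rw [ht]; nlinarith [mul_le_mul_of_nonneg_right (hτle j) hcL]
  have ht1 : ∀ j, |σ * τ j| < 1 := fun j => by
    rw [ht]; nlinarith [hτle j]
  have hcon : ∀ j, IsContractingField (dilationField n R (σ * τ j)) (|σ * τ j| * L) :=
    fun j => hL R hR _ (by linarith [htL j])
  have hball : ∀ j, ∀ x ∈ Metric.ball (0 : Eu n) R,
      dilationField n R (σ * τ j) x = (σ * τ j) • x := fun j x hx =>
    dilationField_eq hR (mem_ball_zero_iff.1 hx).le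
  have hball' : ∀ j, ∀ x ∈ Metric.ball (0 : Eu n) R,
      fderiv ℝ (dilationField n R (σ * τ j)) x = (σ * τ j) • .id ℝ (Eu n) := fun j x hx =>
    fderiv_dilationField_eq hR (mem_ball_zero_iff.1 hx)
  -- integrability of the right-hand sides
  have hpair := memLp_pair hu.memLp hv.memLp
  have hfu : MemLp (fun x => partialFst g (u x) (v x)) (ENNReal.ofReal (p / (p - 1))) volume :=
    memLp_conjExponent hp hpair ((continuous_partialFst hg).comp_aestronglyMeasurable hpair.1)
      (Eventually.of_forall fun x =>
        (le_add_of_nonneg_right (abs_nonneg _)).trans (partial_growth hp hC0 hC (u x, v x)))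
  have hfv : MemLp (fun x => partialSnd g (u x) (v x)) (ENNReal.ofReal (p / (p - 1))) volume :=
    memLp_conjExponent hp hpair ((continuous_partialSnd hg).comp_aestronglyMeasurable hpair.1)
      (Eventually.of_forall fun x =>
        (le_add_of_nonneg_left (abs_nonneg _)).trans (partial_growth hp hC0 hC (u x, v x)))
  -- the Taylor remainder of the potential is of lower order
  let wu : ℕ → Eu n → ℝ := fun j x => u ((hcon j).homeo.symm x) - u x
  let wv : ℕ → Eu n → ℝ := fun j x => v ((hcon j).homeo.symm x) - v x
  have hwu : ∀ j, MemLp (wu j) (ENNReal.ofReal p) volume := fun j =>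
    ((hcon j).memLp_comp_symm ENNReal.ofReal_ne_top hu.memLp).sub hu.memLp
  have hwv : ∀ j, MemLp (wv j) (ENNReal.ofReal p) volume := fun j =>
    ((hcon j).memLp_comp_symm ENNReal.ofReal_ne_top hv.memLp).sub hv.memLp
  obtain ⟨Cu, hCu, hCu'⟩ := exists_eLpNorm_comp_symm_sub_le hp hu.memLp hu.regular (2 * R)
  obtain ⟨Cv, hCv, hCv'⟩ := exists_eLpNorm_comp_symm_sub_le hp hv.memLp hv.regular (2 * R)
  set A : ℝ≥0∞ := (Cu + Cv) * ENNReal.ofReal (τ₀ * (2 * R)) with hA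
  have hAtop : A ≠ ∞ := ENNReal.mul_ne_top (ENNReal.add_ne_top.2 ⟨hCu, hCv⟩) ENNReal.ofReal_ne_top
  have hhalf : ENNReal.ofReal (1 / 2) = 2⁻¹ := by
    rw [one_div, ENNReal.ofReal_inv_of_pos two_pos, ENNReal.ofReal_ofNat]
  have hW : ∀ j, eLpNorm (fun x => (wu j x, wv j x)) (ENNReal.ofReal p) volume ≤
      A * (2⁻¹) ^ j := by
    intro j
    refine (eLpNorm_pair_le hp1 (hwu j).1 (hwv j).1).trans ?_
    have b1 := hCu' _ _ (hcon j) (htL j) _ (norm_dilationField_le hR)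
      (fun x hx => dilationField_eq_zero hR hx)
    have b2 := hCv' _ _ (hcon j) (htL j) _ (norm_dilationField_le hR)
      (fun x hx => dilationField_eq_zero hR hx)
    refine (add_le_add b1 b2).trans_eq ?_
    have e : |σ * τ j| * (2 * R) = τ₀ * (2 * R) * (1 / 2) ^ j := by rw [ht, hτ]; ring
    rw [e, ENNReal.ofReal_mul (by positivity), ENNReal.ofReal_pow (by norm_num), hhalf, hA]
    ring
  have hsum : ∑' j, eLpNorm (fun x => (wu j x, wv j x)) (ENNReal.ofReal p) volume ^ p ≠ ∞ := by
    have p0 : 0 < p := by linarith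
    have b : ∑' j, eLpNorm (fun x => (wu j x, wv j x)) (ENNReal.ofReal p) volume ^ p ≤
        ∑' j : ℕ, A ^ p * (((2 : ℝ≥0∞)⁻¹) ^ p) ^ j := by
      refine ENNReal.tsum_le_tsum fun j => ?_
      refine (ENNReal.rpow_le_rpow (hW j) p0.le).trans_eq ?_
      rw [ENNReal.mul_rpow_of_nonneg _ _ p0.le, ← ENNReal.rpow_natCast, ← ENNReal.rpow_natCast,
        ← ENNReal.rpow_mul, ← ENNReal.rpow_mul, mul_comm (j : ℝ)]
    refine ne_top_of_le_ne_top ?_ b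
    rw [ENNReal.tsum_mul_left, ENNReal.tsum_geometric]
    refine ENNReal.mul_ne_top (ENNReal.rpow_ne_top_of_nonneg p0.le hAtop) (ENNReal.inv_ne_top.2 ?_)
    rw [Ne, tsub_eq_zero_iff_le, not_le]
    exact ENNReal.rpow_lt_one (by simp) p0
  obtain ⟨δ, hδ, hδ'⟩ := exists_tendsto_taylorRemainder hp hg (by positivity)
    (norm_fderiv_le_of_partial_growth hp hg hC0 hC) hpair
    (fun j => (memLp_pair (hwu j) (hwv j)).1) hsum
  set ρ : ℕ → ℝ := fun j => ∫ x, taylorRemainder g (u x, v x) (wu j x, wv j x) with hρ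
  have hρlim : Tendsto (fun j => ρ j / τ j) atTop (𝓝 0) := by
    have e1 : Tendsto (fun j => 2 ^ j * ρ j) atTop (𝓝 0) := by
      rw [tendsto_iff_edist_tendsto_0]
      have hlim : Tendsto (fun j => δ j * A) atTop (𝓝 0) := by
        simpa using ENNReal.Tendsto.mul_const hδ (Or.inr hAtop)
      refine tendsto_of_tendsto_of_tendsto_of_le_of_le tendsto_const_nhds hlim (fun _ => zero_le)
        fun j => ?_
      rw [edist_zero_right, enorm_mul, enorm_pow]
      have e2 : ‖(2 : ℝ)‖ₑ = 2 := by
        rw [Real.enorm_of_nonneg zero_le_two, ENNReal.ofReal_ofNat]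
      calc ‖(2 : ℝ)‖ₑ ^ j * ‖ρ j‖ₑ ≤ 2 ^ j * (δ j * (A * (2⁻¹) ^ j)) := by
            rw [e2]
            gcongr
            exact (enorm_integral_le_lintegral_enorm _).trans ((hδ' j).trans (by
              gcongr; exact hW j))
        _ = δ j * A * (2 * 2⁻¹) ^ j := by rw [mul_pow]; ring
        _ = δ j * A := by
            rw [ENNReal.mul_inv_cancel two_ne_zero ENNReal.ofNat_ne_top, one_pow, mul_one]
    have e3 := e1.const_mul τ₀⁻¹
    rw [mul_zero] at e3
    refine e3.congr fun j => ?_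
    simp only [hτ, one_div, inv_pow]
    field_simp
  -- the inequality for each member of the family of deformations
  have hmain : ∀ j, ((1 + σ * τ j) ^ n - 1) * (∫ x in Metric.ball (0 : Eu n) R, g (u x, v x)) -
      ((1 + τ j * L) ^ n - (1 - τ j * L) ^ n) *
        (∫ x in (Metric.ball (0 : Eu n) R)ᶜ, |g (u x, v x)|) - ρ j ≤
      α * ((((1 + σ * τ j) ^ (n - p) - 1) * energyOn H p u (Metric.ball 0 R) +
        ((1 + τ j * L) ^ n * (1 - c * (τ j * L)) ^ (-p) - 1) *
          energyOn H p u (Metric.ball 0 R)ᶜ) / p) +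
      β * ((((1 + σ * τ j) ^ (n - s * p) - 1) *
          gagliardoOn s p u (Metric.ball 0 R ×ˢ Metric.ball 0 R) +
        ((1 + τ j * L) ^ (2 * n) * (1 - τ j * L) ^ (-(n + s * p)) - 1) *
          gagliardoOn s p u (Metric.ball 0 R ×ˢ Metric.ball 0 R)ᶜ) / p) +
      (α * ((((1 + σ * τ j) ^ (n - p) - 1) * energyOn H p v (Metric.ball 0 R) +
        ((1 + τ j * L) ^ n * (1 - c * (τ j * L)) ^ (-p) - 1) *
          energyOn H p v (Metric.ball 0 R)ᶜ) / p) +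
      β * ((((1 + σ * τ j) ^ (n - s * p) - 1) *
          gagliardoOn s p v (Metric.ball 0 R ×ˢ Metric.ball 0 R) +
        ((1 + τ j * L) ^ (2 * n) * (1 - τ j * L) ^ (-(n + s * p)) - 1) *
          gagliardoOn s p v (Metric.ball 0 R ×ˢ Metric.ball 0 R)ᶜ) / p)) := by
    intro j
    have iu := integral_mul_variation_le (hcon j) (hasCompactSupport_dilationField hR) hs hp hH
      (hc _ (hcon j).nonneg) (htc j) (ht1 j) (hball j) (hball' j) hu hfu hequ
    have iv := integral_mul_variation_le (hcon j) (hasCompactSupport_dilationField hR) hs hp hH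
      (hc _ (hcon j).nonneg) (htc j) (ht1 j) (hball j) (hball' j) hv hfv heqv
    have ig := le_integral_comp_symm_sub (hcon j) (ht1 j) (hball' j) hint
    have jg : Integrable (fun x => g (u ((hcon j).homeo.symm x), v ((hcon j).homeo.symm x)))
        volume := by
      have := (hcon j).memLp_comp_symm ENNReal.one_ne_top (memLp_one_iff_integrable.2 hint)
      exact memLp_one_iff_integrable.1 this
    have ju : Integrable (fun x => partialFst g (u x) (v x) * wu j x) volume := by
      simpa [mul_comm] using integrable_inner hp hfu (hwu j)
    have jv : Integrable (fun x => partialSnd g (u x) (v x) * wv j x) volume := by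
      simpa [mul_comm] using integrable_inner hp hfv (hwv j)
    have e : ρ j = (∫ x, g (u ((hcon j).homeo.symm x), v ((hcon j).homeo.symm x))) -
        (∫ x, g (u x, v x)) - ((∫ x, partialFst g (u x) (v x) * wu j x) +
          ∫ x, partialSnd g (u x) (v x) * wv j x) := by
      have jsub : Integrable (fun x => g (u ((hcon j).homeo.symm x), v ((hcon j).homeo.symm x)) -
          g (u x, v x)) volume := jg.sub hint
      have jadd : Integrable (fun x => partialFst g (u x) (v x) * wu j x +
          partialSnd g (u x) (v x) * wv j x) volume := ju.add jv
      rw [← integral_sub jg hint, ← integral_add ju jv, ← integral_sub jsub jadd]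
      refine integral_congr_ae (Eventually.of_forall fun x => ?_)
      simp only [taylorRemainder, fderiv_apply_eq_partial hg, Prod.mk_add_mk, wu, wv,
        add_sub_cancel]
    simp only [ht] at iu iv ig
    change ∫ x, partialFst g (u x) (v x) * wu j x ≤ _ at iu
    change ∫ x, partialSnd g (u x) (v x) * wv j x ≤ _ at iv
    refine le_trans ?_ (add_le_add iu iv)
    rw [sub_le_iff_le_add, e, add_sub_cancel]
    exact ig
  -- divide by `τ j` and let `j → ∞`
  have ht0 : ∀ j, σ * τ j ≠ 0 := fun j => mul_ne_zero hσ0 (hτ0 j).ne'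
  have htlim : Tendsto (fun j => σ * τ j) atTop (𝓝 0) := by
    have h0 := hτlim.const_mul σ
    rwa [mul_zero] at h0
  have hpow : ∀ a : ℝ, Tendsto (fun j => ((1 + σ * τ j) ^ a - 1) / τ j) atTop (𝓝 (σ * a)) := by
    intro a
    have hd : HasDerivAt (fun x : ℝ => (1 + x) ^ a) a 0 := by
      have := ((hasDerivAt_id (0 : ℝ)).const_add 1).rpow_const (p := a) (Or.inl (by norm_num))
      simpa using this
    refine ((tendsto_div_of_hasDerivAt hd htlim ht0).const_mul σ).congr fun j => ?_
    have := hτ0 j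
    simp only [add_zero, Real.one_rpow]
    rw [← mul_div_mul_left _ (τ j) hσ0, mul_div_assoc]
  have k1 := tendsto_div_of_hasDerivAt h1 hτlim fun j => (hτ0 j).ne'
  have k2 := tendsto_div_of_hasDerivAt h2 hτlim fun j => (hτ0 j).ne'
  have k3 := tendsto_div_of_hasDerivAt h3 hτlim fun j => (hτ0 j).ne'
  have k4 := hpow n
  have k5 := hpow (n - p)
  have k6 := hpow (n - s * p)
  simp only [zero_mul, add_zero, mul_zero, sub_zero, one_pow, Real.one_rpow, mul_one, sub_self,
    Real.rpow_natCast] at k1 k2 k3 k4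
  refine le_of_tendsto_of_tendsto' (b := atTop) ?_ ?_
    fun j => div_le_div_of_nonneg_right (hmain j) (hτ0 j).le
  · have := ((k4.mul_const (∫ x in Metric.ball (0 : Eu n) R, g (u x, v x))).sub
      (k3.mul_const (∫ x in (Metric.ball (0 : Eu n) R)ᶜ, |g (u x, v x)|))).sub hρlim
    rw [sub_zero] at this
    exact this.congr fun j => by ring
  · have hw : ∀ w : Eu n → ℝ, Tendsto (fun j =>
        α * ((((1 + σ * τ j) ^ (n - p) - 1) / τ j * energyOn H p w (Metric.ball 0 R) +
          ((1 + τ j * L) ^ n * (1 - c * (τ j * L)) ^ (-p) - 1) / τ j *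
            energyOn H p w (Metric.ball 0 R)ᶜ) / p) +
        β * ((((1 + σ * τ j) ^ (n - s * p) - 1) / τ j *
            gagliardoOn s p w (Metric.ball 0 R ×ˢ Metric.ball 0 R) +
          ((1 + τ j * L) ^ (2 * n) * (1 - τ j * L) ^ (-(n + s * p)) - 1) / τ j *
            gagliardoOn s p w (Metric.ball 0 R ×ˢ Metric.ball 0 R)ᶜ) / p)) atTop _ := fun w =>
      ((((k5.mul_const _).add (k1.mul_const _)).div_const p).const_mul α).add
        ((((k6.mul_const _).add (k2.mul_const _)).div_const p).const_mul β)
    refine ((hw u).add (hw v)).congr fun j => ?_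
    ring

end Ball

/-! ### Exhaustion by balls -/

section Exhaustion

variable {n : ℕ} {p s α β : ℝ} {H : Eu n → ℝ} {u : Eu n → ℝ}

theorem tendsto_setIntegral_exhaustion {Y : Type*} [MeasurableSpace Y] {μ : Measure Y} {f : Y → ℝ}
    (hf : Integrable f μ) {B : ℕ → Set Y} (hB : ∀ k, MeasurableSet (B k)) (hmono : Monotone B)
    (huniv : ⋃ k, B k = Set.univ) :
    Tendsto (fun k => ∫ y in B k, f y ∂μ) atTop (𝓝 (∫ y, f y ∂μ)) ∧
      Tendsto (fun k => ∫ y in (B k)ᶜ, f y ∂μ) atTop (𝓝 0) := by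
  have h := tendsto_setIntegral_of_monotone hB hmono (f := f) (μ := μ) hf.integrableOn
  rw [huniv, setIntegral_univ] at h
  refine ⟨h, ?_⟩
  have h' := h.const_sub (∫ y, f y ∂μ)
  rw [sub_self] at h'
  exact h'.congr fun k => sub_eq_of_eq_add' (integral_add_compl (hB k) hf).symm

theorem monotone_ball_add_one :
    Monotone fun k : ℕ => Metric.ball (0 : Eu n) (k + 1) := fun i j hij =>
  Metric.ball_subset_ball (by exact_mod_cast Nat.succ_le_succ hij)

theorem iUnion_ball_add_one : ⋃ k : ℕ, Metric.ball (0 : Eu n) (k + 1) = Set.univ := by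
  refine Set.iUnion_eq_univ_iff.2 fun x => ?_
  obtain ⟨k, hk⟩ := exists_nat_gt ‖x‖
  exact ⟨k, mem_ball_zero_iff.2 (by linarith)⟩

theorem tendsto_setIntegral_ball {f : Eu n → ℝ} (hf : Integrable f volume) :
    Tendsto (fun k : ℕ => ∫ x in Metric.ball 0 (k + 1 : ℝ), f x) atTop (𝓝 (∫ x, f x)) ∧
      Tendsto (fun k : ℕ => ∫ x in (Metric.ball 0 (k + 1 : ℝ))ᶜ, f x) atTop (𝓝 0) :=
  tendsto_setIntegral_exhaustion hf (fun _ => Metric.isOpen_ball.measurableSet)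
    monotone_ball_add_one iUnion_ball_add_one

theorem tendsto_setIntegral_ball_prod {f : Eu n × Eu n → ℝ}
    (hf : Integrable f (volume.prod volume)) :
    Tendsto (fun k : ℕ => ∫ z in Metric.ball 0 (k + 1 : ℝ) ×ˢ Metric.ball 0 (k + 1 : ℝ), f z
        ∂((volume : Measure (Eu n)).prod volume)) atTop (𝓝 (∫ z, f z ∂(volume.prod volume))) ∧
      Tendsto (fun k : ℕ => ∫ z in (Metric.ball 0 (k + 1 : ℝ) ×ˢ Metric.ball 0 (k + 1 : ℝ))ᶜ, f z
        ∂((volume : Measure (Eu n)).prod volume)) atTop (𝓝 0) := by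
  refine tendsto_setIntegral_exhaustion hf
    (fun _ => Metric.isOpen_ball.measurableSet.prod Metric.isOpen_ball.measurableSet)
    (fun i j hij => Set.prod_mono (monotone_ball_add_one hij) (monotone_ball_add_one hij)) ?_
  rw [Set.iUnion_prod_of_monotone monotone_ball_add_one monotone_ball_add_one,
    iUnion_ball_add_one, Set.univ_prod_univ]

theorem tendsto_energyOn_ball (hp : 1 < p) (hH : IsFinslerMinkowski H)
    (hu : IsAdmissible s p α β u) (a K : ℝ) :
    Tendsto (fun k : ℕ => α * ((a * energyOn H p u (Metric.ball 0 (k + 1)) +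
      K * energyOn H p u (Metric.ball 0 (k + 1))ᶜ) / p)) atTop
      (𝓝 (α * (a * anisoEnergy H p u / p))) := by
  rcases hu.local_term with rfl | ⟨-, huW⟩
  · simp
  · obtain ⟨K', hK'⟩ := hH.exists_lipschitzWith
    obtain ⟨h1, h2⟩ := tendsto_setIntegral_ball
      (integrable_gauge_rpow hp hK' hH.map_zero hH.nonneg huW.2.2)
    have h := (((h1.const_mul a).add (h2.const_mul K)).div_const p).const_mul α
    rwa [mul_zero, add_zero] at h

theorem tendsto_gagliardoOn_ball (hp : 1 < p) (hu : IsAdmissible s p α β u) (a K : ℝ) :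
    Tendsto (fun k : ℕ => β * ((a * gagliardoOn s p u
        (Metric.ball 0 (k + 1) ×ˢ Metric.ball 0 (k + 1)) +
      K * gagliardoOn s p u (Metric.ball 0 (k + 1) ×ˢ Metric.ball 0 (k + 1))ᶜ) / p)) atTop
      (𝓝 (β * (a * gagliardo s p u / p))) := by
  rcases hu.nonlocal_term with rfl | ⟨-, huW⟩
  · simp
  · obtain ⟨h1, h2⟩ := tendsto_setIntegral_ball_prod (integrable_gauge_rpow hp
      (N := fun r : ℝ => |r|) lipschitzWith_one_norm abs_zero abs_nonneg (memLp_diffQuot huW))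
    have h := (((h1.const_mul a).add (h2.const_mul K)).div_const p).const_mul β
    rw [mul_zero, add_zero] at h
    simpa only [gagliardo, gagliardoOn, abs_diffQuot_rpow (by linarith : 0 < p)] using h

end Exhaustion

end Pohozaev

open Pohozaev Filter

theorem theorem2p2 (n : ℕ) (hn : 1 ≤ n) (s p : ℝ) (hs₀ : 0 < s) (hs₁ : s < 1) (hp : 1 < p)
    (H : Pohozaev.Eu n → ℝ) (hH : Pohozaev.IsFinslerMinkowski H)
    (g : ℝ × ℝ → ℝ) (hg : ContDiff ℝ 1 g)
    (hg₁ : ∃ C : ℝ, 0 < C ∧ ∀ t r : ℝ,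
      |Pohozaev.partialFst g t r| + |Pohozaev.partialSnd g t r|
        ≤ C * (|t| ^ (p - 1) + |r| ^ (p - 1)))
    (α β : ℝ) (hαβ : (α, β) ∈ Pohozaev.S)
    (u v : Pohozaev.Eu n → ℝ) (huv : Pohozaev.IsWeakSolution H s p α β g u v)
    (hint : MeasureTheory.Integrable (fun x => g (u x, v x)) MeasureTheory.volume) :
    α * (n - p) / p * (Pohozaev.anisoEnergy H p u + Pohozaev.anisoEnergy H p v) +
      β * (n - s * p) / p * (Pohozaev.gagliardo s p u + Pohozaev.gagliardo s p v) =
    n * ∫ x, g (u x, v x) := by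
  obtain ⟨C, hC0, hC⟩ := hg₁
  obtain ⟨C₁, C₂, hC₁, hC₂, hCH⟩ := hH.equiv_norm
  obtain ⟨L, hL0, hL⟩ := exists_isContractingField_dilationField n
  have hu := isAdmissible_of_mem_X huv.1
  have hv := isAdmissible_of_mem_X huv.2.1
  -- an operator of Euclidean norm `ℓ` has norm at most `(C₂ / C₁) ℓ` with respect to `H`
  have hc : ∀ ℓ : ℝ, 0 ≤ ℓ → ∀ x y, ‖x‖ ≤ ℓ * ‖y‖ → H x ≤ C₂ / C₁ * ℓ * H y := by
    intro ℓ hℓ x y hxy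
    calc H x ≤ C₂ * (ℓ * ‖y‖) := (hCH x).2.trans (by gcongr)
      _ = C₂ / C₁ * ℓ * (C₁ * ‖y‖) := by field_simp
      _ ≤ _ := by gcongr; exact (hCH y).1
  have d1 : DifferentiableAt ℝ
      (fun x : ℝ => (1 + x * L) ^ n * (1 - C₂ / C₁ * (x * L)) ^ (-p)) 0 := by
    refine DifferentiableAt.mul (by fun_prop) ?_
    exact DifferentiableAt.rpow_const (by fun_prop) (Or.inl (by simp))
  have d2 : DifferentiableAt ℝ
      (fun x : ℝ => (1 + x * L) ^ (2 * n) * (1 - x * L) ^ (-(n + s * p))) 0 := by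
    refine DifferentiableAt.mul (by fun_prop) ?_
    exact DifferentiableAt.rpow_const (by fun_prop) (Or.inl (by simp))
  have d3 : DifferentiableAt ℝ (fun x : ℝ => (1 + x * L) ^ n - (1 - x * L) ^ n) 0 := by fun_prop
  obtain ⟨g1, -⟩ := tendsto_setIntegral_ball hint
  obtain ⟨-, g2⟩ := tendsto_setIntegral_ball hint.abs
  have key : ∀ σ : ℝ, |σ| = 1 → σ * n * (∫ x, g (u x, v x)) ≤
      α * (σ * (n - p) * anisoEnergy H p u / p) + β * (σ * (n - s * p) * gagliardo s p u / p) +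
      (α * (σ * (n - p) * anisoEnergy H p v / p) +
        β * (σ * (n - s * p) * gagliardo s p v / p)) := by
    intro σ hσ
    have l1 := (g1.const_mul (σ * n)).sub (g2.const_mul (deriv
      (fun x : ℝ => (1 + x * L) ^ n - (1 - x * L) ^ n) 0))
    rw [mul_zero, sub_zero] at l1
    refine le_of_tendsto_of_tendsto' l1
      (((tendsto_energyOn_ball hp hH hu _ _).add (tendsto_gagliardoOn_ball hp hu _ _)).add
        ((tendsto_energyOn_ball hp hH hv _ _).add (tendsto_gagliardoOn_ball hp hv _ _)))
      fun k => pohozaev_ball_le hs₀ hp hH (by positivity) hc hL0 hL hg hC0 hC hu hv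
        (fun φ h h' => (huv.2.2 φ φ h h' h h').1) (fun φ h h' => (huv.2.2 φ φ h h' h h').2) hint
        d1.hasDerivAt d2.hasDerivAt d3.hasDerivAt hσ (by positivity)
  -- deformations with `t > 0` and with `t < 0` give opposite inequalities
  have k1 := key 1 (by simp)
  have k2 := key (-1) (by simp)
  refine le_antisymm ?_ ?_
  · ring_nf at k2 ⊢
    linarith
  · ring_nf at k1 ⊢
    linarith
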